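/- Let $N\ge 3$ be an integer, let $p_S:=\frac{N+2}{N-2}$, and let $p>p_S$ be real. Put $f(u):=-u+u^p$. For every $\gamma>0$ the initial value problem \[ u''+\frac{N-1}{s}u'+f(u)=0\quad (s>0),\qquad u(0)=\gamma,\quad u'(0)=0, \] has exactly one solution on $[0,\infty)$, it is positive, and we denote it by $u(s,\gamma)$. There is a function $u^*\in C^2(0,\infty)$, $u^*>0$, such that \[ (u^*)''+\frac{N-1}{s}(u^*)'+f(u^*)=0\quad (0<s<\infty),\qquad u^*(s)\to\infty\quad (s\downarrow 0), \] and the following hold. (i) $u^*$ oscillates around $1$: there are arbitrarily large $s$ with $u^*(s)<1$ and arbitrarily large $s$ with $u^*(s)>1$. It has infinitely many critical points; they form a sequence $0<s_1^*<s_2^*<\cdots\to\infty$, where $s_n^*$ is a local minimum point with $u^*(s_n^*)<1$ if $n$ is odd, and a local maximum point with $u^*(s_n^*)>1$ if $n$ is even. (ii) $u(\cdot,\gamma)\to u^*$ in $C^0_{loc}(0,\infty)$ as $\gamma\to\infty$, that is, uniformly on every compact subset of $(0,\infty)$. -/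

import Mathlib

open Set Filter Topology

noncomputable section

/-- The critical Sobolev exponent `p_S = (N+2)/(N-2)` (used for `N ≥ 3`). -/
def sobolevExponent (N : ℕ) : ℝ := ((N : ℝ) + 2) / ((N : ℝ) - 2)

/-- The nonlinearity `f(x) = -x + x^p`. -/
def nonlin (p x : ℝ) : ℝ := -x + x ^ p

/-- `u` is a classical (`C²`) solution of `u'' + (N-1)/s u' + f(u) = 0` on `(0,∞)`. -/
def IsRadialSolution (N : ℕ) (p : ℝ) (u : ℝ → ℝ) : Prop :=
  ContDiffOn ℝ 2 u (Ioi 0) ∧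
    ∀ s : ℝ, 0 < s →
      deriv (deriv u) s + ((N : ℝ) - 1) / s * deriv u s + nonlin p (u s) = 0

/-- `u` solves the initial value problem `u'' + (N-1)/s u' + f(u) = 0` for `s > 0`,
`u(0) = γ`, `u'(0) = 0` (one-sided derivative at `0`, so that `u` is continuous on `[0,∞)`). -/
def IsRegularSolution (N : ℕ) (p γ : ℝ) (u : ℝ → ℝ) : Prop :=
  IsRadialSolution N p u ∧ u 0 = γ ∧ HasDerivWithinAt u 0 (Ici 0) 0

/-- `u` is a positive singular solution on `(0,∞)`: it blows up at the origin. -/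
def IsPositiveSingularSolution (N : ℕ) (p : ℝ) (u : ℝ → ℝ) : Prop :=
  IsRadialSolution N p u ∧ (∀ s : ℝ, 0 < s → 0 < u s) ∧ Tendsto u (𝓝[>] 0) atTop

/-- `u` oscillates around `c`: it lies below `c`, and above `c`, at arbitrarily large arguments. -/
def OscillatesAround (u : ℝ → ℝ) (c : ℝ) : Prop :=
  (∃ᶠ s in atTop, u s < c) ∧ (∃ᶠ s in atTop, c < u s)

/-- The set of critical points of `u` in `(0,∞)`. -/
def criticalPoints (u : ℝ → ℝ) : Set ℝ := {s : ℝ | 0 < s ∧ deriv u s = 0}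

end

noncomputable section

/-! The singular solution is constructed as the limit of the regular ones: the regular solutions
form a Cauchy family as `γ → ∞`, so existence of the limit and convergence to it are obtained
together.

Two monotone quantities control each regular solution. The energy `v²/2 + F(u)` decreases and bounds
`u` from above. The Pohozaev functional vanishes at the origin and, because `p` is supercritical,
strictly decreases while `u > 0`. It would be nonnegative at a zero of `u`, so `u` stays positive
(`exists_regularSol`). Its negativity also gives bounds on `u` and `u'` away from the origin, and on
the rescaled variables near it, that do not depend on `γ`.

Near the origin put `y(t) = s^θ u(s)`, with `s = e^t` and `θ = 2/(p-1)`. The equation becomes `y'' +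
a y' + y^p - b y = e^{2t} y` with `a, b > 0`: a damped oscillator with equilibrium `A = b^{1/(p-1)}`
and a perturbation negligible as `t → -∞`. At a time which tends to `-∞` with `γ`, the energy of `y`
is below a fixed negative number (`exists_efEnergy_matchTime`). This keeps `y` away from `0`, and a
Lyapunov functional then brings `y` close to `A` (`exists_ef_attraction`). Any two solutions close
to `A` contract exponentially towards each other (`exists_ef_contraction`), and the contraction
lasts arbitrarily long as `γ → ∞`. Hence the phase points at a fixed small radius are Cauchy;
Gronwall carries this to compact intervals, and the lower bound on `y` makes the limit blow up at
the origin.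

For oscillation, a Prüfer angle argument excludes that `u*` stays above `1`, or stays below `1`
while bounded away from `0`. Decrease to `0` would be exponential and would force the Pohozaev
functional to tend to `0`, although it is negative and nonincreasing. Critical points are isolated
because none lies at level `1`, and they alternate because the flux `s^{N-1} u'` is strictly
monotone while `u` stays on one side of `1`. -/

/-- The second order equation at the point `s`, as a first order system for `u` and its derivative `v`. -/
def SolAt (N : ℕ) (p : ℝ) (u v : ℝ → ℝ) (s : ℝ) : Prop :=
  HasDerivAt u (v s) s ∧ HasDerivAt v (-(((N : ℝ) - 1) / s * v s) - nonlin p (u s)) s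

/-! ### Differential inequalities and Lipschitz bounds -/

theorem le_of_hasDerivAt_nonpos {f f' : ℝ → ℝ} {a b : ℝ} (hab : a ≤ b)
    (hf : ∀ x ∈ Icc a b, HasDerivAt f (f' x) x) (hf' : ∀ x ∈ Icc a b, f' x ≤ 0) : f b ≤ f a := by
  have : AntitoneOn f (Icc a b) := by
    apply antitoneOn_of_deriv_nonpos (convex_Icc a b)
    · exact fun x hx => (hf x hx).continuousAt.continuousWithinAt
    · rw [interior_Icc]
      exact fun x hx => (hf x (Ioo_subset_Icc_self hx)).differentiableAt.differentiableWithinAt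
    · rw [interior_Icc]
      intro x hx
      rw [(hf x (Ioo_subset_Icc_self hx)).deriv]
      exact hf' x (Ioo_subset_Icc_self hx)
  exact this (left_mem_Icc.2 hab) (right_mem_Icc.2 hab) hab

/-- Differential Gronwall inequality. -/
theorem le_exp_mul_of_hasDerivAt_le {e e' : ℝ → ℝ} {a b K : ℝ} (hab : a ≤ b)
    (he : ∀ x ∈ Icc a b, HasDerivAt e (e' x) x) (he' : ∀ x ∈ Icc a b, e' x ≤ K * e x) :
    e b ≤ Real.exp (K * (b - a)) * e a := by
  have h := le_of_hasDerivAt_nonpos (f := fun x => Real.exp (-(K * x)) * e x)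
    (f' := fun x => Real.exp (-(K * x)) * (e' x - K * e x)) hab
    (fun x hx => by
      have h1 : HasDerivAt (fun x => Real.exp (-(K * x))) (Real.exp (-(K * x)) * (-(K * 1))) x :=
        (((hasDerivAt_id x).const_mul K).neg).exp
      exact (h1.mul (he x hx)).congr_deriv (by ring))
    (fun x hx => mul_nonpos_of_nonneg_of_nonpos (Real.exp_pos _).le
      (by linarith [he' x hx]))
  have h2 : Real.exp (K * (b - a)) = Real.exp (-(K * a)) * Real.exp (K * b) := by
    rw [← Real.exp_add]; congr 1; ring
  have h3 : Real.exp (K * b) * Real.exp (-(K * b)) = 1 := by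
    rw [← Real.exp_add]; simp
  calc e b = Real.exp (K * b) * (Real.exp (-(K * b)) * e b) := by rw [← mul_assoc, h3, one_mul]
    _ ≤ Real.exp (K * b) * (Real.exp (-(K * a)) * e a) :=
        mul_le_mul_of_nonneg_left h (Real.exp_pos _).le
    _ = _ := by rw [h2]; ring

/-- Backward differential Gronwall inequality. -/
theorem le_exp_mul_of_le_hasDerivAt {e e' : ℝ → ℝ} {a b K : ℝ} (hab : a ≤ b)
    (he : ∀ x ∈ Icc a b, HasDerivAt e (e' x) x) (he' : ∀ x ∈ Icc a b, -(K * e x) ≤ e' x) :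
    e a ≤ Real.exp (K * (b - a)) * e b := by
  have h := le_exp_mul_of_hasDerivAt_le (e := fun x => e (-x)) (e' := fun x => - e' (-x))
    (a := -b) (b := -a) (K := K) (by linarith)
    (fun x hx => by
      have := (he (-x) ⟨by linarith [hx.2], by linarith [hx.1]⟩).comp x (hasDerivAt_neg x)
      exact this.congr_deriv (by ring))
    (fun x hx => by
      have := he' (-x) ⟨by linarith [hx.2], by linarith [hx.1]⟩
      linarith)
  simp only [neg_neg] at h
  convert h using 3
  ring

theorem contDiff_nonlin {p : ℝ} (hp : 1 ≤ p) : ContDiff ℝ 1 (nonlin p) := by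
  have h : ContDiff ℝ ((1 : ℕ) : WithTop ℕ∞) fun x : ℝ => x ^ p :=
    Real.contDiff_rpow_const_of_le (by simpa using hp)
  exact contDiff_neg.add (by simpa using h)

theorem exists_lipschitz_of_contDiff {g : ℝ → ℝ} (hg : ContDiff ℝ 1 g) (B : ℝ) :
    ∃ L : ℝ, 0 ≤ L ∧ ∀ x ∈ Icc (-B) B, ∀ y ∈ Icc (-B) B, |g x - g y| ≤ L * |x - y| := by
  have hc : Continuous (deriv g) := hg.continuous_deriv le_rfl
  obtain ⟨L, hL⟩ := isCompact_Icc.exists_bound_of_continuousOn (s := Icc (-B) B) hc.continuousOn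
  refine ⟨max L 0, le_max_right _ _, fun x hx y hy => ?_⟩
  have := Convex.norm_image_sub_le_of_norm_deriv_le (f := g) (C := max L 0) (s := Icc (-B) B)
    (fun z _ => (hg.differentiable one_ne_zero) z)
    (fun z hz => (hL z hz).trans (le_max_left _ _)) (convex_Icc _ _) hy hx
  simpa [Real.norm_eq_abs] using this

theorem exists_lipschitz_nonlin {p : ℝ} (hp : 1 ≤ p) (B : ℝ) :
    ∃ L : ℝ, 0 ≤ L ∧ ∀ x ∈ Icc (-B) B, ∀ y ∈ Icc (-B) B,
      |nonlin p x - nonlin p y| ≤ L * |x - y| :=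
  exists_lipschitz_of_contDiff (contDiff_nonlin hp) B

/-! ### Distance in phase space, continuous dependence and uniqueness -/

/-- The squared distance in phase space of two solutions. -/
def gap (u₁ v₁ u₂ v₂ : ℝ → ℝ) (s : ℝ) : ℝ := (v₁ s - v₂ s) ^ 2 + (u₁ s - u₂ s) ^ 2

theorem gap_nonneg (u₁ v₁ u₂ v₂ : ℝ → ℝ) (s : ℝ) : 0 ≤ gap u₁ v₁ u₂ v₂ s := by
  unfold gap; positivity

section Gap

variable {N : ℕ} {p : ℝ} {u₁ v₁ u₂ v₂ : ℝ → ℝ}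

theorem hasDerivAt_gap {s : ℝ} (h₁ : SolAt N p u₁ v₁ s) (h₂ : SolAt N p u₂ v₂ s) :
    HasDerivAt (gap u₁ v₁ u₂ v₂)
      (-(2 * (((N : ℝ) - 1) / s) * (v₁ s - v₂ s) ^ 2)
        - 2 * (v₁ s - v₂ s) * (nonlin p (u₁ s) - nonlin p (u₂ s))
        + 2 * (u₁ s - u₂ s) * (v₁ s - v₂ s)) s := by
  have h := ((h₁.2.sub h₂.2).pow 2).add ((h₁.1.sub h₂.1).pow 2)
  refine h.congr_deriv ?_
  simp only [Pi.sub_apply]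
  ring

theorem gap_cross_bound {d e q L : ℝ} (hL : 0 ≤ L) (h : |q| ≤ L * |d|) :
    |-(2 * e * q) + 2 * d * e| ≤ (1 + L) * (e ^ 2 + d ^ 2) := by
  have h1 : |e * q| ≤ L * (|d| * |e|) := by
    rw [abs_mul]
    nlinarith [abs_nonneg e]
  have h2 : |d| * |e| ≤ (e ^ 2 + d ^ 2) / 2 := by
    nlinarith [sq_nonneg (|d| - |e|), sq_abs d, sq_abs e]
  have h3 : |d * e| = |d| * |e| := abs_mul d e
  have h4 : L * (|d| * |e|) ≤ L * ((e ^ 2 + d ^ 2) / 2) := mul_le_mul_of_nonneg_left h2 hL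
  have h5 := abs_le.1 h1
  have h6 := abs_le.1 (le_of_eq h3)
  rw [abs_le]
  constructor <;> nlinarith

/-- The singular friction only shrinks the gap forward in `s` and is dropped. The rate `1 + L`
therefore does not see `s₀`, which allows starting points arbitrarily close to the origin. -/
theorem gap_forward (hN : 3 ≤ N) {s₀ s₁ L : ℝ} (h₀ : 0 < s₀) (h₀₁ : s₀ ≤ s₁) (hL : 0 ≤ L)
    (h₁ : ∀ s ∈ Icc s₀ s₁, SolAt N p u₁ v₁ s) (h₂ : ∀ s ∈ Icc s₀ s₁, SolAt N p u₂ v₂ s)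
    (hlip : ∀ s ∈ Icc s₀ s₁, |nonlin p (u₁ s) - nonlin p (u₂ s)| ≤ L * |u₁ s - u₂ s|) :
    gap u₁ v₁ u₂ v₂ s₁ ≤ Real.exp ((1 + L) * (s₁ - s₀)) * gap u₁ v₁ u₂ v₂ s₀ := by
  refine le_exp_mul_of_hasDerivAt_le h₀₁ (fun s hs => hasDerivAt_gap (h₁ s hs) (h₂ s hs)) ?_
  intro s hs
  have hb := (abs_le.1 (gap_cross_bound (e := v₁ s - v₂ s) hL (hlip s hs))).2
  have hs0 : 0 < s := h₀.trans_le hs.1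
  have hN' : (3 : ℝ) ≤ N := by exact_mod_cast hN
  have hd : 0 ≤ 2 * (((N : ℝ) - 1) / s) * (v₁ s - v₂ s) ^ 2 := by
    have : 0 ≤ ((N : ℝ) - 1) / s := div_nonneg (by linarith) hs0.le
    positivity
  unfold gap
  linarith

/-- Backward in `s` the friction amplifies, at a rate bounded by its value at the left end `s₀`. -/
theorem gap_backward (hN : 3 ≤ N) {s₀ s₁ L : ℝ} (h₀ : 0 < s₀) (h₀₁ : s₀ ≤ s₁) (hL : 0 ≤ L)
    (h₁ : ∀ s ∈ Icc s₀ s₁, SolAt N p u₁ v₁ s) (h₂ : ∀ s ∈ Icc s₀ s₁, SolAt N p u₂ v₂ s)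
    (hlip : ∀ s ∈ Icc s₀ s₁, |nonlin p (u₁ s) - nonlin p (u₂ s)| ≤ L * |u₁ s - u₂ s|) :
    gap u₁ v₁ u₂ v₂ s₀ ≤ Real.exp ((1 + L + 2 * (((N : ℝ) - 1) / s₀)) * (s₁ - s₀)) *
      gap u₁ v₁ u₂ v₂ s₁ := by
  refine le_exp_mul_of_le_hasDerivAt h₀₁ (fun s hs => hasDerivAt_gap (h₁ s hs) (h₂ s hs)) ?_
  intro s hs
  have hb := (abs_le.1 (gap_cross_bound (e := v₁ s - v₂ s) hL (hlip s hs))).1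
  have hs0 : 0 < s := h₀.trans_le hs.1
  have hN' : (3 : ℝ) ≤ N := by exact_mod_cast hN
  have h3 : ((N : ℝ) - 1) / s ≤ ((N : ℝ) - 1) / s₀ :=
    div_le_div_of_nonneg_left (by linarith) h₀ hs.1
  have h4 : 0 ≤ ((N : ℝ) - 1) / s₀ := div_nonneg (by linarith) h₀.le
  have h5 := mul_le_mul_of_nonneg_right h3 (sq_nonneg (v₁ s - v₂ s))
  have h6 := mul_nonneg h4 (sq_nonneg (u₁ s - u₂ s))
  unfold gap
  nlinarith

theorem exists_lipschitz_along (hp : 1 ≤ p) {s₀ s₁ : ℝ} (h₁ : ContinuousOn u₁ (Icc s₀ s₁))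
    (h₂ : ContinuousOn u₂ (Icc s₀ s₁)) : ∃ L : ℝ, 0 ≤ L ∧ ∀ s ∈ Icc s₀ s₁,
      |nonlin p (u₁ s) - nonlin p (u₂ s)| ≤ L * |u₁ s - u₂ s| := by
  obtain ⟨B₁, hB₁⟩ := isCompact_Icc.exists_bound_of_continuousOn h₁
  obtain ⟨B₂, hB₂⟩ := isCompact_Icc.exists_bound_of_continuousOn h₂
  obtain ⟨L, hL, h⟩ := exists_lipschitz_nonlin hp (max B₁ B₂)
  exact ⟨L, hL, fun s hs => h _ (abs_le.1 ((hB₁ s hs).trans (le_max_left _ _))) _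
    (abs_le.1 ((hB₂ s hs).trans (le_max_right _ _)))⟩

/-- Two solutions that meet in phase space coincide. -/
theorem solution_unique (hN : 3 ≤ N) (hp : 1 ≤ p) (h₁ : ∀ s, 0 < s → SolAt N p u₁ v₁ s)
    (h₂ : ∀ s, 0 < s → SolAt N p u₂ v₂ s) {r : ℝ} (hr : 0 < r) (hu : u₁ r = u₂ r)
    (hv : v₁ r = v₂ r) {s : ℝ} (hs : 0 < s) : u₁ s = u₂ s := by
  have key : ∀ t, 0 < t → gap u₁ v₁ u₂ v₂ t ≤ 0 → u₁ t = u₂ t := by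
    intro t _ h
    unfold gap at h
    nlinarith [sq_nonneg (v₁ t - v₂ t), sq_nonneg (u₁ t - u₂ t)]
  have hc : gap u₁ v₁ u₂ v₂ r = 0 := by simp [gap, hu, hv]
  rcases le_total r s with h | h
  · have hpos : ∀ t ∈ Icc r s, 0 < t := fun t ht => hr.trans_le ht.1
    obtain ⟨L, hL, hl⟩ := exists_lipschitz_along (p := p) hp
      (fun t ht => (h₁ t (hpos t ht)).1.continuousAt.continuousWithinAt)
      (fun t ht => (h₂ t (hpos t ht)).1.continuousAt.continuousWithinAt)
    have := gap_forward hN hr h hL (fun t ht => h₁ t (hpos t ht)) (fun t ht => h₂ t (hpos t ht)) hl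
    rw [hc, mul_zero] at this
    exact key s hs this
  · have hpos : ∀ t ∈ Icc s r, 0 < t := fun t ht => hs.trans_le ht.1
    obtain ⟨L, hL, hl⟩ := exists_lipschitz_along (p := p) hp
      (fun t ht => (h₁ t (hpos t ht)).1.continuousAt.continuousWithinAt)
      (fun t ht => (h₂ t (hpos t ht)).1.continuousAt.continuousWithinAt)
    have := gap_backward hN hs h hL (fun t ht => h₁ t (hpos t ht)) (fun t ht => h₂ t (hpos t ht)) hl
    rw [hc, mul_zero] at this
    exact key s hs this

theorem SolAt.isRadialSolution (hp : 1 ≤ p) (h : ∀ s, 0 < s → SolAt N p u₁ v₁ s) :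
    IsRadialSolution N p u₁ ∧ ∀ s, 0 < s → deriv u₁ s = v₁ s := by
  have hd : ∀ s, 0 < s → deriv u₁ s = v₁ s := fun s hs => (h s hs).1.deriv
  have hev : ∀ s, 0 < s → deriv u₁ =ᶠ[𝓝 s] v₁ := fun s hs => by
    filter_upwards [Ioi_mem_nhds hs] with t ht using hd t ht
  have hdd : ∀ s, 0 < s → HasDerivAt (deriv u₁)
      (-(((N : ℝ) - 1) / s * v₁ s) - nonlin p (u₁ s)) s := fun s hs =>
    (h s hs).2.congr_of_eventuallyEq (hev s hs)
  refine ⟨⟨?_, fun s hs => ?_⟩, hd⟩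
  · rw [show (2 : WithTop ℕ∞) = 1 + 1 by norm_num, contDiffOn_succ_iff_deriv_of_isOpen isOpen_Ioi]
    refine ⟨fun s hs => (h s hs).1.differentiableAt.differentiableWithinAt, by simp, ?_⟩
    rw [show (1 : WithTop ℕ∞) = 0 + 1 by norm_num, contDiffOn_succ_iff_deriv_of_isOpen isOpen_Ioi]
    refine ⟨fun s hs => (hdd s hs).differentiableAt.differentiableWithinAt, by simp, ?_⟩
    rw [contDiffOn_zero]
    have hc : ContinuousOn (fun s => -(((N : ℝ) - 1) / s * v₁ s) - nonlin p (u₁ s)) (Ioi 0) := by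
      intro s hs
      have hs' : (0 : ℝ) < s := hs
      have h1 : ContinuousAt (fun s : ℝ => ((N : ℝ) - 1) / s) s :=
        continuousAt_const.div continuousAt_id hs'.ne'
      have h2 : ContinuousAt (fun s => nonlin p (u₁ s)) s :=
        ((contDiff_nonlin hp).continuous.continuousAt).comp (h s hs).1.continuousAt
      exact ((h1.mul (h s hs).2.continuousAt).neg.sub h2).continuousWithinAt
    exact hc.congr fun s hs => (hdd s hs).deriv
  · rw [(hdd s hs).deriv, hd s hs]
    ring

theorem IsRadialSolution.solAt (h : IsRadialSolution N p u₁) {s : ℝ} (hs : 0 < s) :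
    SolAt N p u₁ (deriv u₁) s := by
  have h1 := h.1
  rw [show (2 : WithTop ℕ∞) = 1 + 1 by norm_num,
    contDiffOn_succ_iff_deriv_of_isOpen isOpen_Ioi] at h1
  refine ⟨((h1.1 s hs).differentiableAt (Ioi_mem_nhds hs)).hasDerivAt, ?_⟩
  have h2 := ((h1.2.2.differentiableOn one_ne_zero s hs).differentiableAt
    (Ioi_mem_nhds hs)).hasDerivAt
  refine h2.congr_deriv ?_
  linarith [h.2 s hs]

/-- Near the origin a function with vanishing one-sided derivative is small in phase space
at some points. -/
theorem exists_small_of_hasDerivWithinAt {d d' : ℝ → ℝ} (h₀ : d 0 = 0)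
    (hd0 : HasDerivWithinAt d 0 (Ici 0) 0) (hd : ∀ s, 0 < s → HasDerivAt d (d' s) s)
    {ε δ : ℝ} (hε : 0 < ε) (hδ : 0 < δ) :
    ∃ ξ, 0 < ξ ∧ ξ < δ ∧ |d ξ| ≤ ε ∧ |d' ξ| ≤ ε := by
  have hlo := hd0.isLittleO.def hε
  have hcont : ∀ᶠ x in 𝓝[≥] (0 : ℝ), |d x| ≤ ε := by
    have := hd0.continuousWithinAt.tendsto.abs
    rw [h₀, abs_zero] at this
    exact this.eventually_le_const hε
  obtain ⟨r, hr, hr'⟩ := mem_nhdsGE_iff_exists_Ico_subset.1 (hlo.and hcont)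
  set x := min (r / 2) (δ / 2)
  have hr : 0 < r := hr
  have hx0 : 0 < x := by positivity
  have hxr : x < r := (min_le_left _ _).trans_lt (by linarith)
  have hxδ : x < δ := (min_le_right _ _).trans_lt (by linarith)
  -- No continuity of `d'` at `0` is assumed; only the mean value point on `[0, x]` is known to have
  -- a small derivative.
  obtain ⟨ξ, hξ, hξ'⟩ := exists_hasDerivAt_eq_slope d d' hx0
    (fun y hy => by
      rcases eq_or_lt_of_le hy.1 with h | h
      · rw [← h]
        exact hd0.continuousWithinAt.mono Icc_subset_Ici_self
      · exact (hd y h).continuousAt.continuousWithinAt)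
    (fun y hy => hd y hy.1)
  refine ⟨ξ, hξ.1, hξ.2.trans hxδ, (hr' ⟨hξ.1.le, hξ.2.trans hxr⟩).2, ?_⟩
  have h1 := (hr' ⟨hx0.le, hxr⟩).1
  simp only [h₀, sub_zero, smul_zero, Real.norm_eq_abs, abs_of_pos hx0] at h1
  rw [hξ', h₀, sub_zero, sub_zero, abs_div, abs_of_pos hx0, div_le_iff₀ hx0]
  exact h1

/-- Solutions that are regular at the origin are determined by their value there. -/
theorem regular_unique (hN : 3 ≤ N) (hp : 1 ≤ p) (h₁ : ∀ s, 0 < s → SolAt N p u₁ v₁ s)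
    (h₂ : ∀ s, 0 < s → SolAt N p u₂ v₂ s) (h₀ : u₁ 0 = u₂ 0)
    (hd₁ : HasDerivWithinAt u₁ 0 (Ici 0) 0) (hd₂ : HasDerivWithinAt u₂ 0 (Ici 0) 0)
    {s : ℝ} (hs : 0 < s) : u₁ s = u₂ s := by
  have hc : ∀ {u v : ℝ → ℝ}, (∀ s, 0 < s → SolAt N p u v s) → HasDerivWithinAt u 0 (Ici 0) 0 →
      ContinuousOn u (Icc 0 s) := by
    intro u v h hd y hy
    rcases eq_or_lt_of_le hy.1 with h' | h'
    · rw [← h']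
      exact hd.continuousWithinAt.mono Icc_subset_Ici_self
    · exact (h y h').1.continuousAt.continuousWithinAt
  obtain ⟨L, hL, hl⟩ := exists_lipschitz_along (p := p) hp (hc h₁ hd₁) (hc h₂ hd₂)
  set K := Real.exp ((1 + L) * s)
  have hK : 0 < K := Real.exp_pos _
  -- Start `gap_forward` from a point `ξ` near `0` where the gap is at most `2ε²`; the constant `K`
  -- is independent of `ξ`.
  have key : ∀ ε, 0 < ε → gap u₁ v₁ u₂ v₂ s ≤ K * (2 * ε ^ 2) := by
    intro ε hε
    obtain ⟨ξ, hξ0, hξs, h1, h2⟩ := exists_small_of_hasDerivWithinAt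
      (d := fun t => u₁ t - u₂ t) (d' := fun t => v₁ t - v₂ t) (by simp [h₀])
      ((hd₁.sub hd₂).congr_deriv (sub_zero 0)) (fun t ht => (h₁ t ht).1.sub (h₂ t ht).1) hε hs
    have hg := gap_forward hN hξ0 hξs.le hL (fun t ht => h₁ t (hξ0.trans_le ht.1))
      (fun t ht => h₂ t (hξ0.trans_le ht.1)) (fun t ht => hl t ⟨hξ0.le.trans ht.1, ht.2⟩)
    have h3 : gap u₁ v₁ u₂ v₂ ξ ≤ 2 * ε ^ 2 := by
      unfold gap
      have := sq_le_sq' (abs_le.1 h1).1 (abs_le.1 h1).2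
      have := sq_le_sq' (abs_le.1 h2).1 (abs_le.1 h2).2
      linarith
    refine hg.trans (mul_le_mul (Real.exp_le_exp.2 ?_) h3 (gap_nonneg _ _ _ _ _) hK.le)
    exact mul_le_mul_of_nonneg_left (by linarith) (by linarith)
  have h0 : gap u₁ v₁ u₂ v₂ s ≤ 0 := by
    by_contra! hpos
    set g := gap u₁ v₁ u₂ v₂ s
    have := key (Real.sqrt (g / (4 * K))) (by positivity)
    rw [Real.sq_sqrt (by positivity)] at this
    have h4 : K * (2 * (g / (4 * K))) = g / 2 := by field_simp; ring
    linarith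
  unfold gap at h0
  nlinarith [sq_nonneg (v₁ s - v₂ s), sq_nonneg (u₁ s - u₂ s)]

end Gap

/-! ### The integral equation and the regular problem for bounded Lipschitz nonlinearities -/

/-- `r * ∫₀¹ τ^(N-1) g(rτ) dτ`, which for `r > 0` is `r^(1-N) ∫₀^r t^(N-1) g(t) dt`. -/
def radialFlux (N : ℕ) (g : ℝ → ℝ) (r : ℝ) : ℝ := r * ∫ τ in (0 : ℝ)..1, τ ^ (N - 1) * g (r * τ)

/-- Rescaling to the fixed interval `[0, 1]` has removed the singularity at `r = 0`, so a continuous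
parameter integral remains. -/
theorem continuous_radialFlux (N : ℕ) {g : ℝ → ℝ} (hg : Continuous g) :
    Continuous (radialFlux N g) := by
  refine continuous_id.mul ?_
  apply intervalIntegral.continuous_parametric_intervalIntegral_of_continuous'
  fun_prop

theorem abs_radialFlux_le (N : ℕ) {g : ℝ → ℝ} {r C : ℝ} (hr : 0 ≤ r)
    (h : ∀ t ∈ Icc 0 r, |g t| ≤ C) : |radialFlux N g r| ≤ r * C := by
  unfold radialFlux
  rw [abs_mul, abs_of_nonneg hr]
  refine mul_le_mul_of_nonneg_left ?_ hr
  have := intervalIntegral.norm_integral_le_of_norm_le_const (a := 0) (b := 1) (C := C)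
    (f := fun τ : ℝ => τ ^ (N - 1) * g (r * τ)) (fun τ hτ => by
      rw [uIoc_of_le zero_le_one] at hτ
      rw [norm_mul, norm_pow, Real.norm_eq_abs, Real.norm_eq_abs, abs_of_pos hτ.1]
      have h1 := h (r * τ) ⟨mul_nonneg hr hτ.1.le, mul_le_of_le_one_right hr hτ.2⟩
      have h2 : τ ^ (N - 1) ≤ 1 := pow_le_one₀ hτ.1.le hτ.2
      have h3 : 0 ≤ τ ^ (N - 1) := pow_nonneg hτ.1.le _
      nlinarith [abs_nonneg (g (r * τ))])
  simpa using this

/-- Each integration of the weight `e^{kt}` gains a factor `1/k`; two of them make the fixed point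
map a contraction. -/
theorem abs_radialFlux_sub_le (N : ℕ) {g₁ g₂ : ℝ → ℝ} (h₁ : Continuous g₁) (h₂ : Continuous g₂)
    {r C k : ℝ} (hr : 0 ≤ r) (hk : 0 < k) (hC : 0 ≤ C)
    (h : ∀ t ∈ Icc 0 r, |g₁ t - g₂ t| ≤ C * Real.exp (k * t)) :
    |radialFlux N g₁ r - radialFlux N g₂ r| ≤ C / k * Real.exp (k * r) := by
  have i₁ : IntervalIntegrable (fun τ : ℝ => τ ^ (N - 1) * g₁ (r * τ)) MeasureTheory.volume 0 1 :=
    Continuous.intervalIntegrable (by fun_prop) _ _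
  have i₂ : IntervalIntegrable (fun τ : ℝ => τ ^ (N - 1) * g₂ (r * τ)) MeasureTheory.volume 0 1 :=
    Continuous.intervalIntegrable (by fun_prop) _ _
  unfold radialFlux
  rw [← mul_sub, ← intervalIntegral.integral_sub i₁ i₂, ← intervalIntegral.integral_const_mul]
  have hb := intervalIntegral.norm_integral_le_of_norm_le (a := 0) (b := 1)
    (μ := MeasureTheory.volume)
    (f := fun τ : ℝ => r * (τ ^ (N - 1) * g₁ (r * τ) - τ ^ (N - 1) * g₂ (r * τ)))
    (g := fun τ => r * (C * Real.exp (k * (r * τ)))) zero_le_one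
    (Eventually.of_forall fun τ hτ => by
      rw [← mul_sub, norm_mul, norm_mul, norm_pow, Real.norm_eq_abs, Real.norm_eq_abs,
        Real.norm_eq_abs, abs_of_pos hτ.1, abs_of_nonneg hr]
      refine mul_le_mul_of_nonneg_left ?_ hr
      have h1 := h (r * τ) ⟨mul_nonneg hr hτ.1.le, mul_le_of_le_one_right hr hτ.2⟩
      have h2 : τ ^ (N - 1) ≤ 1 := pow_le_one₀ hτ.1.le hτ.2
      have h3 : 0 ≤ τ ^ (N - 1) := pow_nonneg hτ.1.le _
      nlinarith [abs_nonneg (g₁ (r * τ) - g₂ (r * τ))])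
    (Continuous.intervalIntegrable (by fun_prop) _ _)
  have hi : ∫ τ in (0 : ℝ)..1, r * (C * Real.exp (k * (r * τ))) =
      C / k * Real.exp (k * (r * 1)) - C / k * Real.exp (k * (r * 0)) := by
    apply intervalIntegral.integral_eq_sub_of_hasDerivAt
      (f := fun τ => C / k * Real.exp (k * (r * τ)))
    · intro τ _
      have h1 : HasDerivAt (fun τ : ℝ => Real.exp (k * (r * τ)))
          (Real.exp (k * (r * τ)) * (k * (r * 1))) τ :=
        (((hasDerivAt_id τ).const_mul r).const_mul k).exp
      refine (h1.const_mul (C / k)).congr_deriv ?_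
      field_simp
    · exact Continuous.intervalIntegrable (by fun_prop) _ _
  rw [hi, Real.norm_eq_abs] at hb
  refine hb.trans ?_
  have : 0 ≤ C / k * Real.exp (k * (r * 0)) := by positivity
  rw [mul_one]
  linarith

/-- Global solvability of the integral equation `u(s) = γ - ∫₀^s radialFlux (g ∘ u)` for a bounded
Lipschitz nonlinearity. -/
theorem exists_integral_solution (N : ℕ) {g : ℝ → ℝ} {L B : ℝ} (hL : 0 ≤ L)
    (hlip : ∀ x y, |g x - g y| ≤ L * |x - y|) (hB : ∀ x, |g x| ≤ B) (γ : ℝ) :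
    ∃ u : ℝ → ℝ, Continuous u ∧
      ∀ s, 0 ≤ s → u s = γ - ∫ r in (0 : ℝ)..s, radialFlux N (g ∘ u) r := by
  have hgc : Continuous g := by
    have : LipschitzWith (Real.toNNReal L) g := by
      refine LipschitzWith.of_dist_le_mul fun x y => ?_
      rw [Real.dist_eq, Real.dist_eq, Real.coe_toNNReal L hL]
      exact hlip x y
    exact this.continuous
  have hB0 : 0 ≤ B := (abs_nonneg _).trans (hB 0)
  -- Large enough for the contraction constant `L/k²` to be below `1`.
  set k := L + 1
  have hk : 1 ≤ k := by simp only [k]; linarith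
  -- Bielecki weight: the unknown is `φ = e^{-ks} u`, so bounded functions suffice on the whole half
  -- line. Replacing `s` by `max s 0` makes the map act on functions on all of `ℝ`.
  let unw : BoundedContinuousFunction ℝ ℝ → ℝ → ℝ := fun φ s => Real.exp (k * max s 0) * φ s
  have hunw : ∀ φ, Continuous (unw φ) := fun φ => by
    simp only [unw]
    exact (by fun_prop : Continuous fun s : ℝ => Real.exp (k * max s 0)).mul φ.continuous
  let op : BoundedContinuousFunction ℝ ℝ → ℝ → ℝ := fun φ s =>
    Real.exp (-(k * max s 0)) * (γ - ∫ r in (0 : ℝ)..(max s 0), radialFlux N (g ∘ unw φ) r)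
  have hflux : ∀ φ, Continuous (radialFlux N (g ∘ unw φ)) := fun φ =>
    continuous_radialFlux N (hgc.comp (hunw φ))
  have hopc : ∀ φ, Continuous (op φ) := fun φ => by
    have h1 : Continuous fun x : ℝ => ∫ r in (0 : ℝ)..x, radialFlux N (g ∘ unw φ) r :=
      intervalIntegral.continuous_primitive
        (fun a b => (hflux φ).intervalIntegrable a b) 0
    have h2 : Continuous fun s : ℝ => max s 0 := by fun_prop
    exact (by fun_prop : Continuous fun s : ℝ => Real.exp (-(k * max s 0))).mul
      (continuous_const.sub (h1.comp h2))
  have hopb : ∀ φ s, ‖op φ s‖ ≤ |γ| + 2 * B := by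
    intro φ s
    set x := max s 0
    have hx : 0 ≤ x := le_max_right _ _
    have h1 := intervalIntegral.norm_integral_le_of_norm_le_const (a := 0) (b := x) (C := x * B)
      (f := radialFlux N (g ∘ unw φ)) (fun r hr => by
        rw [uIoc_of_le hx] at hr
        refine (abs_radialFlux_le N hr.1.le (fun t _ => hB _)).trans ?_
        exact mul_le_mul_of_nonneg_right hr.2 hB0)
    rw [sub_zero, abs_of_nonneg hx, Real.norm_eq_abs] at h1
    have h2 : |γ - ∫ r in (0 : ℝ)..x, radialFlux N (g ∘ unw φ) r| ≤ |γ| + x * B * x :=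
      (abs_sub _ _).trans (by linarith)
    -- The unweighted image grows at most like `|γ| + B x²`, which `1 + x²/2 ≤ e^{kx}` absorbs into
    -- the weight.
    have h3 := Real.quadratic_le_exp_of_nonneg (x := k * x) (by positivity)
    have h4 : x ≤ k * x := le_mul_of_one_le_left hx hk
    have h5 : 1 + x ^ 2 / 2 ≤ Real.exp (k * x) := by nlinarith
    simp only [op]
    rw [norm_mul, Real.norm_eq_abs, Real.norm_eq_abs, Real.exp_neg, abs_inv, Real.abs_exp,
      inv_mul_le_iff₀ (Real.exp_pos _)]
    refine h2.trans ?_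
    have h6 : (1 + x ^ 2 / 2) * (|γ| + 2 * B) ≤ Real.exp (k * x) * (|γ| + 2 * B) :=
      mul_le_mul_of_nonneg_right h5 (by positivity)
    have h7 : 0 ≤ x ^ 2 * |γ| := by positivity
    nlinarith
  let T : BoundedContinuousFunction ℝ ℝ → BoundedContinuousFunction ℝ ℝ := fun φ =>
    BoundedContinuousFunction.ofNormedAddCommGroup (op φ) (hopc φ) _ (hopb φ)
  have hTop : ∀ φ s, T φ s = op φ s := fun φ s => rfl
  have hk2 : L / (k * k) < 1 := by
    rw [div_lt_one (by positivity)]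
    nlinarith
  have hcontr : ContractingWith (Real.toNNReal (L / (k * k))) T := by
    refine ⟨by simpa using hk2, LipschitzWith.of_dist_le_mul fun φ ψ => ?_⟩
    rw [Real.coe_toNNReal _ (by positivity)]
    rw [BoundedContinuousFunction.dist_le (by positivity)]
    intro s
    rw [hTop, hTop, Real.dist_eq]
    set x := max s 0 with hxs
    have hx : 0 ≤ x := le_max_right _ _
    have hd : ∀ t, 0 ≤ t → |(g ∘ unw φ) t - (g ∘ unw ψ) t| ≤ L * dist φ ψ * Real.exp (k * t) := by
      intro t ht
      refine (hlip _ _).trans ?_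
      simp only [unw]
      rw [max_eq_left ht, ← mul_sub, abs_mul, Real.abs_exp]
      have := BoundedContinuousFunction.dist_coe_le_dist (f := φ) (g := ψ) t
      rw [Real.dist_eq] at this
      have h1 := mul_le_mul_of_nonneg_left this (Real.exp_pos (k * t)).le
      calc L * (Real.exp (k * t) * |φ t - ψ t|) ≤ L * (Real.exp (k * t) * dist φ ψ) :=
            mul_le_mul_of_nonneg_left h1 hL
        _ = _ := by ring
    have hfl : ∀ r, 0 ≤ r → |radialFlux N (g ∘ unw φ) r - radialFlux N (g ∘ unw ψ) r| ≤
        L * dist φ ψ / k * Real.exp (k * r) := fun r hr =>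
      abs_radialFlux_sub_le N (hgc.comp (hunw φ)) (hgc.comp (hunw ψ)) hr (by linarith)
        (by positivity) (fun t ht => hd t ht.1)
    have hb := intervalIntegral.norm_integral_le_of_norm_le (a := 0) (b := x)
      (μ := MeasureTheory.volume)
      (f := fun r => radialFlux N (g ∘ unw φ) r - radialFlux N (g ∘ unw ψ) r)
      (g := fun r => L * dist φ ψ / k * Real.exp (k * r)) hx
      (Eventually.of_forall fun r hr => hfl r hr.1.le)
      (Continuous.intervalIntegrable (by fun_prop) _ _)
    have hi : ∫ r in (0 : ℝ)..x, L * dist φ ψ / k * Real.exp (k * r) =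
        L / (k * k) * dist φ ψ * Real.exp (k * x) -
          L / (k * k) * dist φ ψ * Real.exp (k * 0) := by
      apply intervalIntegral.integral_eq_sub_of_hasDerivAt
        (f := fun r => L / (k * k) * dist φ ψ * Real.exp (k * r))
      · intro r _
        have h1 : HasDerivAt (fun r : ℝ => Real.exp (k * r)) (Real.exp (k * r) * (k * 1)) r :=
          ((hasDerivAt_id r).const_mul k).exp
        refine (h1.const_mul (L / (k * k) * dist φ ψ)).congr_deriv ?_
        field_simp
      · exact Continuous.intervalIntegrable (by fun_prop) _ _
    rw [hi, intervalIntegral.integral_sub ((hflux φ).intervalIntegrable _ _)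
      ((hflux ψ).intervalIntegrable _ _), Real.norm_eq_abs] at hb
    simp only [op]
    rw [← hxs, ← mul_sub, abs_mul, Real.exp_neg, abs_inv, Real.abs_exp,
      inv_mul_le_iff₀ (Real.exp_pos _), sub_sub_sub_cancel_left, abs_sub_comm]
    have : 0 ≤ L / (k * k) * dist φ ψ * Real.exp (k * 0) := by positivity
    linarith
  have hfix : T (ContractingWith.fixedPoint T hcontr) = ContractingWith.fixedPoint T hcontr :=
    hcontr.fixedPoint_isFixedPt
  set φ := ContractingWith.fixedPoint T hcontr
  refine ⟨unw φ, hunw φ, fun s hs => ?_⟩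
  have h1 : op φ s = φ s := by rw [← hTop, hfix]
  have h2 : unw φ s = Real.exp (k * s) * φ s := by simp only [unw, max_eq_left hs]
  rw [h2, ← h1]
  simp only [op, max_eq_left hs]
  rw [← mul_assoc, ← Real.exp_add, add_neg_cancel, Real.exp_zero, one_mul]

theorem hasDerivAt_radialFlux {N : ℕ} (hN : 3 ≤ N) {g : ℝ → ℝ} (hg : Continuous g) {s : ℝ}
    (hs : 0 < s) :
    HasDerivAt (radialFlux N g) (-(((N : ℝ) - 1) / s * radialFlux N g s) + g s) s := by
  have hrep : ∀ r : ℝ, 0 < r → radialFlux N g r =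
      (r ^ (N - 1))⁻¹ * ∫ t in (0 : ℝ)..r, t ^ (N - 1) * g t := by
    intro r hr
    have h1 := intervalIntegral.integral_comp_mul_left (a := 0) (b := 1)
      (fun t : ℝ => t ^ (N - 1) * g t) hr.ne'
    rw [mul_zero, mul_one, smul_eq_mul] at h1
    have h2 : ∀ τ : ℝ, (r * τ) ^ (N - 1) * g (r * τ) = r ^ (N - 1) * (τ ^ (N - 1) * g (r * τ)) :=
      fun τ => by rw [mul_pow]; ring
    simp only [h2] at h1
    rw [intervalIntegral.integral_const_mul] at h1
    have h3 : r ^ (N - 1) ≠ 0 := (pow_pos hr _).ne'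
    unfold radialFlux
    field_simp at h1 ⊢
    linarith
  have hev : radialFlux N g =ᶠ[𝓝 s]
      fun r => (r ^ (N - 1))⁻¹ * ∫ t in (0 : ℝ)..r, t ^ (N - 1) * g t := by
    filter_upwards [Ioi_mem_nhds hs] with r hr using hrep r hr
  have hI : HasDerivAt (fun r => ∫ t in (0 : ℝ)..r, t ^ (N - 1) * g t) (s ^ (N - 1) * g s) s :=
    ((by fun_prop : Continuous fun t : ℝ => t ^ (N - 1) * g t)).integral_hasStrictDerivAt 0 s
      |>.hasDerivAt
  have hpow : HasDerivAt (fun r : ℝ => (r ^ (N - 1))⁻¹) _ s :=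
    (hasDerivAt_pow (N - 1) s).inv (pow_pos hs _).ne'
  refine ((hpow.mul hI).congr_of_eventuallyEq hev).congr_deriv ?_
  rw [hrep s hs]
  obtain ⟨n, rfl⟩ : ∃ n, N = n + 3 := ⟨N - 3, by omega⟩
  have e1 : n + 3 - 1 = n + 2 := rfl
  have e2 : n + 2 - 1 = n + 1 := rfl
  rw [e1, e2]
  have hs' := hs.ne'
  push_cast
  field_simp
  ring

/-- Global solvability of the regular initial value problem for a bounded Lipschitz
nonlinearity. -/
theorem exists_regular_of_lipschitz {N : ℕ} (hN : 3 ≤ N) {g : ℝ → ℝ} {L B : ℝ} (hL : 0 ≤ L)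
    (hlip : ∀ x y, |g x - g y| ≤ L * |x - y|) (hB : ∀ x, |g x| ≤ B) (γ : ℝ) :
    ∃ u v : ℝ → ℝ, Continuous u ∧ Continuous v ∧ u 0 = γ ∧ v 0 = 0 ∧
      HasDerivWithinAt u 0 (Ici 0) 0 ∧
      (∀ s, 0 < s → HasDerivAt u (v s) s ∧
        HasDerivAt v (-(((N : ℝ) - 1) / s * v s) - g (u s)) s) ∧
      ∀ s C, 0 ≤ s → (∀ t ∈ Icc 0 s, |g (u t)| ≤ C) → |v s| ≤ s * C := by
  obtain ⟨u, huc, hu⟩ := exists_integral_solution N hL hlip hB γ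
  have hgc : Continuous g := by
    have : LipschitzWith (Real.toNNReal L) g := by
      refine LipschitzWith.of_dist_le_mul fun x y => ?_
      rw [Real.dist_eq, Real.dist_eq, Real.coe_toNNReal L hL]
      exact hlip x y
    exact this.continuous
  have hfc : Continuous (radialFlux N (g ∘ u)) := continuous_radialFlux N (hgc.comp huc)
  have hI : ∀ s, HasDerivAt (fun s => γ - ∫ r in (0 : ℝ)..s, radialFlux N (g ∘ u) r)
      (-radialFlux N (g ∘ u) s) s := fun s =>
    ((hfc.integral_hasStrictDerivAt 0 s).hasDerivAt.const_sub γ)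
  have h0 : radialFlux N (g ∘ u) 0 = 0 := by simp [radialFlux]
  refine ⟨u, fun s => -radialFlux N (g ∘ u) s, huc, hfc.neg, by simpa using hu 0 le_rfl,
    by simp [h0], ?_, fun s hs => ⟨?_, ?_⟩, ?_⟩
  · have h1 := ((hI 0).hasDerivWithinAt (s := Ici 0)).congr (f₁ := u) (fun s hs => hu s hs)
      (hu 0 le_rfl)
    exact h1.congr_deriv (by rw [h0, neg_zero])
  · refine (hI s).congr_of_eventuallyEq ?_
    filter_upwards [Ioi_mem_nhds hs] with t ht using hu t (le_of_lt ht)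
  · refine (hasDerivAt_radialFlux hN (hgc.comp huc) hs).neg.congr_deriv ?_
    simp only [Function.comp_apply]
    ring
  · intro s C hs h
    rw [abs_neg]
    exact abs_radialFlux_le N hs h

/-! ### Energy and Pohozaev functional -/

/-- The primitive of `nonlin p` vanishing at `0`. -/
def nonlinPrim (p x : ℝ) : ℝ := x ^ (p + 1) / (p + 1) - x ^ 2 / 2

/-- The Pohozaev functional. -/
def pohozaev (N : ℕ) (p : ℝ) (u v : ℝ → ℝ) (s : ℝ) : ℝ :=
  s ^ (N - 1) * (s * (v s ^ 2 / 2 + nonlinPrim p (u s)) + ((N : ℝ) - 2) / 2 * (u s * v s))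

theorem supercritical_iff {N : ℕ} (hN : 3 ≤ N) {p : ℝ} (hp : sobolevExponent N < p) :
    1 < p ∧ (N : ℝ) + 2 < p * ((N : ℝ) - 2) := by
  have hN' : (3 : ℝ) ≤ N := by exact_mod_cast hN
  unfold sobolevExponent at hp
  rw [div_lt_iff₀ (by linarith)] at hp
  refine ⟨?_, hp⟩
  by_contra! h
  nlinarith

theorem hasDerivAt_nonlinPrim {p : ℝ} (hp : 1 < p) (x : ℝ) :
    HasDerivAt (nonlinPrim p) (nonlin p x) x := by
  have h1 : HasDerivAt (fun x : ℝ => x ^ (p + 1)) ((p + 1) * x ^ (p + 1 - 1)) x :=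
    Real.hasDerivAt_rpow_const (Or.inr (by linarith))
  have h2 := (h1.div_const (p + 1)).sub ((hasDerivAt_pow 2 x).div_const 2)
  refine h2.congr_deriv ?_
  have : p + 1 ≠ 0 := by linarith
  unfold nonlin
  rw [add_sub_cancel_right]
  field_simp
  simp
  ring

theorem continuous_nonlinPrim {p : ℝ} (hp : 1 < p) : Continuous (nonlinPrim p) :=
  continuous_iff_continuousAt.2 fun x => (hasDerivAt_nonlinPrim hp x).continuousAt

theorem nonlin_pos {p x : ℝ} (hp : 1 < p) (hx : 1 < x) : 0 < nonlin p x := by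
  have : x ^ (1 : ℝ) < x ^ p := Real.rpow_lt_rpow_of_exponent_lt hx hp
  rw [Real.rpow_one] at this
  unfold nonlin
  linarith

theorem nonlin_neg {p x : ℝ} (hp : 1 < p) (h0 : 0 < x) (hx : x < 1) : nonlin p x < 0 := by
  have : x ^ p < x ^ (1 : ℝ) := Real.rpow_lt_rpow_of_exponent_gt h0 hx hp
  rw [Real.rpow_one] at this
  unfold nonlin
  linarith

theorem strictMonoOn_nonlinPrim {p : ℝ} (hp : 1 < p) : StrictMonoOn (nonlinPrim p) (Ici 1) := by
  apply strictMonoOn_of_deriv_pos (convex_Ici 1) (continuous_nonlinPrim hp).continuousOn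
  intro x hx
  rw [interior_Ici] at hx
  rw [(hasDerivAt_nonlinPrim hp x).deriv]
  exact nonlin_pos hp hx

theorem nonlinPrim_neg {p x : ℝ} (hp : 1 < p) (h0 : 0 < x) (hx : x ≤ 1) : nonlinPrim p x < 0 := by
  have h1 : x ^ (p + 1) ≤ x ^ (2 : ℝ) := Real.rpow_le_rpow_of_exponent_ge h0 hx (by linarith)
  rw [Real.rpow_two] at h1
  have h2 : x ^ (p + 1) / (p + 1) < x ^ 2 / 2 := by
    rw [div_lt_div_iff₀ (by linarith) two_pos]
    nlinarith [pow_pos h0 2]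
  unfold nonlinPrim
  linarith

/-- A threshold above which the primitive is nonnegative. -/
theorem exists_nonlinPrim_nonneg {p : ℝ} (hp : 1 < p) :
    ∃ m : ℝ, 1 ≤ m ∧ ∀ x, m ≤ x → 0 ≤ nonlinPrim p x := by
  -- The positive zero of the primitive.
  set m := ((p + 1) / 2) ^ (1 / (p - 1)) with hm
  have hm1 : 1 ≤ m := Real.one_le_rpow (by linarith) (by
    have : 0 < p - 1 := by linarith
    positivity)
  refine ⟨m, hm1, fun x hx => ?_⟩
  have hx0 : 0 < x := by linarith
  have h1 : (p + 1) / 2 ≤ x ^ (p - 1) := by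
    have : m ^ (p - 1) = (p + 1) / 2 := by
      rw [hm, ← Real.rpow_mul (by linarith), one_div_mul_cancel (by linarith), Real.rpow_one]
    rw [← this]
    exact Real.rpow_le_rpow (by linarith) hx (by linarith)
  have h2 : x ^ (p + 1) = x ^ (p - 1) * x ^ 2 := by
    rw [← Real.rpow_natCast x 2, ← Real.rpow_add hx0]
    norm_num
    congr 1
    ring
  unfold nonlinPrim
  rw [h2, sub_nonneg, div_le_div_iff₀ two_pos (by linarith)]
  nlinarith [pow_pos hx0 2]

section Functionals

variable {N : ℕ} {p : ℝ} {u v : ℝ → ℝ}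

theorem hasDerivAt_energy (hp : 1 < p) {s : ℝ} (h : SolAt N p u v s) :
    HasDerivAt (fun s => v s ^ 2 / 2 + nonlinPrim p (u s)) (-(((N : ℝ) - 1) / s * v s ^ 2)) s := by
  have h1 := ((h.2.pow 2).div_const 2).add ((hasDerivAt_nonlinPrim hp (u s)).comp s h.1)
  refine h1.congr_deriv ?_
  simp
  ring

/-- The positive coefficient of `u ^ (p + 1)` in the Pohozaev identity. -/
def pohozaevCoeff (N : ℕ) (p : ℝ) : ℝ := ((N : ℝ) - 2) / 2 - N / (p + 1)

/-- Clearing denominators turns this into `N + 2 < p (N - 2)`, that is, into supercriticality. -/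
theorem pohozaevCoeff_pos (hN : 3 ≤ N) (hp : sobolevExponent N < p) : 0 < pohozaevCoeff N p := by
  obtain ⟨h1, h2⟩ := supercritical_iff hN hp
  unfold pohozaevCoeff
  rw [sub_pos, div_lt_div_iff₀ (by linarith) two_pos]
  nlinarith

/-- The weight `(N-2)/2` of the term `u v` makes all terms in `v` cancel; what is left is `N F(u) -
(N-2)/2 · u f(u)`, with `F` the primitive of `f`. -/
theorem hasDerivAt_pohozaev (hN : 3 ≤ N) (hp : 1 < p) {s : ℝ} (hs : 0 < s) (h : SolAt N p u v s)
    (hu : 0 ≤ u s) :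
    HasDerivAt (pohozaev N p u v)
      (-(s ^ (N - 1) * (u s ^ 2 + pohozaevCoeff N p * u s ^ (p + 1)))) s := by
  have h1 := (hasDerivAt_pow (N - 1) s).mul (((hasDerivAt_id s).mul
    (((h.2.pow 2).div_const 2).add ((hasDerivAt_nonlinPrim hp (u s)).comp s h.1))).add
      ((h.1.mul h.2).const_mul (((N : ℝ) - 2) / 2)))
  refine h1.congr_deriv ?_
  have h2 : u s ^ (p + 1) = u s ^ p * u s := Real.rpow_add_one' hu (by linarith)
  simp only [pohozaevCoeff, Pi.add_apply, Pi.mul_apply, Pi.pow_apply, Function.comp_apply, id,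
    nonlin, nonlinPrim]
  rw [h2]
  obtain ⟨n, rfl⟩ : ∃ n, N = n + 3 := ⟨N - 3, by omega⟩
  have e1 : n + 3 - 1 = n + 2 := rfl
  have e2 : n + 2 - 1 = n + 1 := rfl
  have hs' := hs.ne'
  have hp' : p + 1 ≠ 0 := by linarith
  rw [e1, e2]
  push_cast
  field_simp
  ring

theorem pohozaev_deriv_nonpos (hN : 3 ≤ N) (hp : sobolevExponent N < p) {s : ℝ} (hs : 0 < s)
    (hu : 0 ≤ u s) : -(s ^ (N - 1) * (u s ^ 2 + pohozaevCoeff N p * u s ^ (p + 1))) ≤ 0 := by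
  have := pohozaevCoeff_pos hN hp
  have := Real.rpow_nonneg hu (p + 1)
  rw [neg_nonpos]
  positivity

theorem pohozaev_deriv_neg (hN : 3 ≤ N) (hp : sobolevExponent N < p) {s : ℝ} (hs : 0 < s)
    (hu : 0 < u s) : -(s ^ (N - 1) * (u s ^ 2 + pohozaevCoeff N p * u s ^ (p + 1))) < 0 := by
  have := pohozaevCoeff_pos hN hp
  have := Real.rpow_pos_of_pos hu (p + 1)
  rw [neg_lt_zero]
  positivity

end Functionals

/-! ### Global positive regular solutions -/

/-- A positive regular solution with its a priori properties. -/
structure RegularSol (N : ℕ) (p γ : ℝ) (u v : ℝ → ℝ) : Prop where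
  sol : ∀ s, 0 < s → SolAt N p u v s
  value_zero : u 0 = γ
  deriv_zero_eq : HasDerivWithinAt u 0 (Ici 0) 0
  pos : ∀ s, 0 ≤ s → 0 < u s
  pohozaev_neg : ∀ s, 0 < s → pohozaev N p u v s < 0
  le_value_zero : 1 ≤ γ → ∀ s, 0 ≤ s → u s ≤ γ
  slope_le : 1 ≤ γ → ∀ s, 0 ≤ s → |v s| ≤ s * γ ^ p
  lower : 1 ≤ γ → ∀ s, 0 ≤ s → γ - s ^ 2 * γ ^ p ≤ u s

/-- A level the decreasing energy cannot reach when started from rest at `γ`. For `γ < 1` the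
primitive is negative at `γ`, so any level where it is nonnegative serves. -/
theorem exists_energy_barrier {p γ : ℝ} (hp : 1 < p) (hγ : 0 < γ) :
    ∃ M, γ < M ∧ nonlinPrim p γ < nonlinPrim p M := by
  obtain ⟨m, hm, hm'⟩ := exists_nonlinPrim_nonneg hp
  rcases le_or_gt 1 γ with h | h
  · exact ⟨γ + 1, by linarith, strictMonoOn_nonlinPrim hp h (by simp; linarith) (by linarith)⟩
  · exact ⟨m, by linarith, (nonlinPrim_neg hp hγ h.le).trans_le (hm' m le_rfl)⟩

/-- Solve the problem with truncated nonlinearity, then show that the truncation is never active: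
the energy excludes reaching `M`, the Pohozaev functional excludes reaching `0`. -/
theorem exists_regularSol {N : ℕ} (hN : 3 ≤ N) {p : ℝ} (hpS : sobolevExponent N < p) {γ : ℝ}
    (hγ : 0 < γ) : ∃ u v, RegularSol N p γ u v := by
  obtain ⟨hp, -⟩ := supercritical_iff hN hpS
  obtain ⟨M, hγM, hFM⟩ := exists_energy_barrier hp hγ
  have hM : 0 < M := hγ.trans hγM
  have hN' : (3 : ℝ) ≤ N := by exact_mod_cast hN
  obtain ⟨L, hL, hlip⟩ := exists_lipschitz_nonlin hp.le M
  -- Projection onto `[0, M]`, so that the composed nonlinearity is bounded and globally Lipschitz.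
  let cl : ℝ → ℝ := fun x => max (min x M) 0
  have hcl : ∀ x, cl x ∈ Icc (-M) M := fun x =>
    ⟨(by linarith : -M ≤ 0).trans (le_max_right _ _), max_le (min_le_right _ _) hM.le⟩
  have hcl' : ∀ x y, |cl x - cl y| ≤ |x - y| := fun x y =>
    (abs_max_sub_max_le_abs _ _ _).trans
      ((abs_min_sub_min_le_max x M y M).trans (by simp))
  have hcl_id : ∀ x, 0 ≤ x → x ≤ M → cl x = x := fun x h0 h1 => by
    simp only [cl, min_eq_left h1, max_eq_left h0]
  obtain ⟨B, hB⟩ := isCompact_Icc.exists_bound_of_continuousOn (s := Icc (-M) M)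
    (contDiff_nonlin hp.le).continuous.continuousOn
  obtain ⟨u, v, huc, hvc, hu0, hv0, hd0, hsol, hslope⟩ := exists_regular_of_lipschitz hN
    (g := fun x => nonlin p (cl x)) hL
    (fun x y => (hlip _ (hcl x) _ (hcl y)).trans (mul_le_mul_of_nonneg_left (hcl' x y) hL))
    (fun x => hB _ (hcl x)) γ
  have hsolAt : ∀ s, 0 < s → 0 ≤ u s → u s ≤ M → SolAt N p u v s := fun s hs h0 h1 => by
    have h := hsol s hs
    simp only [hcl_id _ h0 h1] at h
    exact h
  have hEc : Continuous fun s => v s ^ 2 / 2 + nonlinPrim p (u s) :=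
    ((hvc.pow 2).div_const 2).add ((continuous_nonlinPrim hp).comp huc)
  have hPc : Continuous (pohozaev N p u v) := by
    have := (continuous_nonlinPrim hp).comp huc
    unfold pohozaev
    exact (continuous_pow _).mul ((continuous_id.mul hEc).add
      (continuous_const.mul (huc.mul hvc)))
  have hP0 : pohozaev N p u v 0 = 0 := by
    simp [pohozaev, hv0]
  have henergy : ∀ R, 0 ≤ R → (∀ t ∈ Ico 0 R, 0 < u t ∧ u t < M) →
      v R ^ 2 / 2 + nonlinPrim p (u R) ≤ nonlinPrim p γ := by
    intro R hR h
    have hanti : AntitoneOn (fun s => v s ^ 2 / 2 + nonlinPrim p (u s)) (Icc 0 R) := by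
      refine antitoneOn_of_deriv_nonpos (convex_Icc _ _) hEc.continuousOn ?_ ?_
      all_goals
        rw [interior_Icc]
        intro s hs
        have hb := h s ⟨hs.1.le, hs.2⟩
        have hd := hasDerivAt_energy hp (hsolAt s hs.1 hb.1.le hb.2.le)
      · exact hd.differentiableAt.differentiableWithinAt
      · rw [hd.deriv, neg_nonpos]
        have : 0 ≤ ((N : ℝ) - 1) / s := div_nonneg (by linarith) hs.1.le
        positivity
    have := hanti (left_mem_Icc.2 hR) (right_mem_Icc.2 hR) hR
    simpa [hu0, hv0] using this
  have hpoho : ∀ R, 0 < R → (∀ t ∈ Ico 0 R, 0 < u t ∧ u t < M) → pohozaev N p u v R < 0 := by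
    intro R hR h
    have hanti : StrictAntiOn (pohozaev N p u v) (Icc 0 R) := by
      refine strictAntiOn_of_deriv_neg (convex_Icc _ _) hPc.continuousOn ?_
      rw [interior_Icc]
      intro s hs
      have hb := h s ⟨hs.1.le, hs.2⟩
      rw [(hasDerivAt_pohozaev hN hp hs.1 (hsolAt s hs.1 hb.1.le hb.2.le) hb.1.le).deriv]
      exact pohozaev_deriv_neg hN hpS hs.1 hb.1
    have := hanti (left_mem_Icc.2 hR.le) (right_mem_Icc.2 hR.le) hR
    rwa [hP0] at this
  have hbound : ∀ s, 0 ≤ s → 0 < u s ∧ u s < M := by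
    by_contra! hcon
    -- The exit times from `(0, M)`. At the first one, `R`, both functionals are controlled, since
    -- the original equation holds on `(0, R)`.
    set S : Set ℝ := Ici 0 ∩ (u ⁻¹' Ioo 0 M)ᶜ
    have hSc : IsClosed S := isClosed_Ici.inter (isOpen_Ioo.preimage huc).isClosed_compl
    have hSn : S.Nonempty := by
      obtain ⟨s, hs, h⟩ := hcon
      exact ⟨s, hs, fun h' => absurd h'.2 (not_lt.2 (h h'.1))⟩
    have hSb : BddBelow S := ⟨0, fun s hs => hs.1⟩
    have hRS := hSc.csInf_mem hSn hSb
    set R := sInf S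
    have hR0 : R ≠ 0 := fun h => by
      rw [h] at hRS
      exact hRS.2 (show u 0 ∈ Ioo 0 M by rw [hu0]; exact ⟨hγ, hγM⟩)
    have hR : 0 < R := lt_of_le_of_ne hRS.1 (Ne.symm hR0)
    have hgood : ∀ t ∈ Ico 0 R, 0 < u t ∧ u t < M := by
      intro t ht
      by_contra h
      exact absurd (csInf_le hSb (show t ∈ S from ⟨ht.1, h⟩)) (not_le.2 ht.2)
    have hlim : Tendsto u (𝓝[<] R) (𝓝 (u R)) :=
      huc.continuousAt.tendsto.mono_left nhdsWithin_le_nhds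
    have hev : ∀ᶠ t in 𝓝[<] R, 0 < u t ∧ u t < M := by
      filter_upwards [Ioo_mem_nhdsLT hR] with t ht using hgood t ⟨ht.1.le, ht.2⟩
    have hge : 0 ≤ u R := ge_of_tendsto hlim (hev.mono fun t ht => ht.1.le)
    have hle : u R ≤ M := le_of_tendsto hlim (hev.mono fun t ht => ht.2.le)
    have hE := henergy R hR.le hgood
    have hlt : u R < M := lt_of_le_of_ne hle fun h => by
      rw [h] at hE
      nlinarith [sq_nonneg (v R)]
    have hzero : u R = 0 := by
      by_contra h
      exact hRS.2 ⟨lt_of_le_of_ne hge (Ne.symm h), hlt⟩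
    have hP := hpoho R hR hgood
    have hprim : nonlinPrim p 0 = 0 := by
      simp [nonlinPrim, Real.zero_rpow (by linarith : p + 1 ≠ 0)]
    -- At a zero of `u` only the nonnegative term `R^{N-1} · R · v²/2` survives.
    simp only [pohozaev, hzero, hprim] at hP
    have : 0 ≤ R ^ (N - 1) * (R * (v R ^ 2 / 2 + 0) + ((N : ℝ) - 2) / 2 * (0 * v R)) := by
      simp only [zero_mul, mul_zero, add_zero]
      positivity
    linarith
  have hsolAll : ∀ s, 0 < s → SolAt N p u v s := fun s hs =>
    hsolAt s hs (hbound s hs.le).1.le (hbound s hs.le).2.le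
  have hle : 1 ≤ γ → ∀ s, 0 ≤ s → u s ≤ γ := by
    intro h1 s hs
    by_contra! hlt
    have hE := henergy s hs fun t ht => hbound t ht.1
    have := strictMonoOn_nonlinPrim hp (show γ ∈ Ici 1 from h1) (h1.trans hlt.le) hlt
    nlinarith [sq_nonneg (v s)]
  have hsl : 1 ≤ γ → ∀ s, 0 ≤ s → |v s| ≤ s * γ ^ p := by
    intro h1 s hs
    refine hslope s _ hs fun t ht => ?_
    have hb := hbound t ht.1
    simp only [hcl_id _ hb.1.le hb.2.le]
    have h2 := hle h1 t ht.1
    have h3 : u t ^ p ≤ γ ^ p := Real.rpow_le_rpow hb.1.le h2 (by linarith)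
    have h4 : γ ^ (1 : ℝ) ≤ γ ^ p := Real.rpow_le_rpow_of_exponent_le h1 hp.le
    rw [Real.rpow_one] at h4
    have h5 : 0 ≤ u t ^ p := Real.rpow_nonneg hb.1.le _
    unfold nonlin
    rw [abs_le]
    constructor <;> linarith [hb.1]
  refine ⟨u, v, hsolAll, hu0, hd0, fun s hs => (hbound s hs).1,
    fun s hs => hpoho s hs fun t ht => hbound t ht.1, hle, hsl, ?_⟩
  intro h1 s hs
  have hg : 0 ≤ γ ^ p := by positivity
  have := Convex.norm_image_sub_le_of_norm_hasDerivWithin_le (f := u) (f' := v)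
    (s := Icc 0 s) (C := s * γ ^ p) (x := 0) (y := s)
    (fun t ht => by
      rcases eq_or_lt_of_le ht.1 with h | h
      · rw [← h, hv0]
        exact hd0.mono Icc_subset_Ici_self
      · exact (hsolAll t h).1.hasDerivWithinAt)
    (fun t ht => (hsl h1 t ht.1).trans (mul_le_mul_of_nonneg_right ht.2 hg))
    (convex_Icc _ _) (left_mem_Icc.2 hs) (right_mem_Icc.2 hs)
  rw [hu0, Real.norm_eq_abs, Real.norm_eq_abs, sub_zero, abs_of_nonneg hs] at this
  have := (abs_le.1 this).1
  nlinarith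

/-! ### Emden–Fowler variables and bounds uniform in `γ` -/

/-- The scaling exponent `θ = 2/(p-1)`. -/
def scaleExp (p : ℝ) : ℝ := 2 / (p - 1)

/-- The damping coefficient of the Emden–Fowler equation. -/
def efDamp (N : ℕ) (p : ℝ) : ℝ := (N : ℝ) - 2 - 2 * scaleExp p

/-- The linear coefficient of the Emden–Fowler equation. -/
def efCoeff (N : ℕ) (p : ℝ) : ℝ := scaleExp p * ((N : ℝ) - 2 - scaleExp p)

/-- The Emden–Fowler variable `y(t) = s^θ u(s)`, `s = exp t`. -/
def efY (p : ℝ) (u : ℝ → ℝ) (t : ℝ) : ℝ := Real.exp (scaleExp p * t) * u (Real.exp t)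

/-- The derivative of the Emden–Fowler variable. -/
def efZ (p : ℝ) (u v : ℝ → ℝ) (t : ℝ) : ℝ :=
  Real.exp (scaleExp p * t) * (scaleExp p * u (Real.exp t) + Real.exp t * v (Real.exp t))

/-- The Emden–Fowler equation with damping `a`, force `y^p - b y` and perturbation `e^{2t} y` at
`t`, as a system for `y` and its derivative `z`. -/
def EFAt (a b p : ℝ) (y z : ℝ → ℝ) (t : ℝ) : Prop :=
  HasDerivAt y (z t) t ∧
    HasDerivAt z (-(a * z t) - (y t ^ p - b * y t) + Real.exp (2 * t) * y t) t

section Constants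

variable {N : ℕ} {p : ℝ}

theorem scaleExp_pos (hp : 1 < p) : 0 < scaleExp p := div_pos two_pos (by linarith)

theorem scaleExp_mul (hp : 1 < p) : scaleExp p * (p - 1) = 2 :=
  div_mul_cancel₀ _ (by linarith)

/-- The damping times `p - 1` equals `p (N - 2) - (N + 2)`, so its sign is exactly the
supercriticality condition. -/
theorem efDamp_pos (hN : 3 ≤ N) (hp : sobolevExponent N < p) : 0 < efDamp N p := by
  obtain ⟨h1, h2⟩ := supercritical_iff hN hp
  have h3 : (0 : ℝ) < p - 1 := by linarith
  have h : efDamp N p * (p - 1) = ((N : ℝ) - 2) * (p - 1) - 4 := by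
    unfold efDamp
    linear_combination (-2) * scaleExp_mul h1
  by_contra! hcon
  nlinarith [mul_nonpos_of_nonpos_of_nonneg hcon h3.le]

theorem efCoeff_pos (hN : 3 ≤ N) (hp : sobolevExponent N < p) : 0 < efCoeff N p := by
  have h1 := efDamp_pos hN hp
  have h2 := scaleExp_pos (supercritical_iff hN hp).1
  unfold efDamp at h1
  exact mul_pos h2 (by linarith)

theorem exp_scaleExp_rpow (t q : ℝ) :
    Real.exp (scaleExp p * t) ^ q = Real.exp (scaleExp p * q * t) := by
  rw [← Real.exp_mul]
  congr 1
  ring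

/-- The scaling exponent is chosen so that `θ p = θ + 2`, which makes the power term autonomous in
`t`. -/
theorem efY_rpow (hp : 1 < p) {u : ℝ → ℝ} {t : ℝ} (hu : 0 ≤ u (Real.exp t)) :
    efY p u t ^ p =
      Real.exp (scaleExp p * t) * (Real.exp (2 * t) * u (Real.exp t) ^ p) := by
  unfold efY
  rw [Real.mul_rpow (Real.exp_pos _).le hu, exp_scaleExp_rpow, ← mul_assoc, ← Real.exp_add]
  congr 2
  linear_combination t * scaleExp_mul hp

end Constants

section Transform

variable {N : ℕ} {p : ℝ} {u v : ℝ → ℝ}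

theorem efAt_of_solAt (hp : 1 < p) {t : ℝ} (h : SolAt N p u v (Real.exp t))
    (hu : 0 ≤ u (Real.exp t)) :
    EFAt (efDamp N p) (efCoeff N p) p (efY p u) (efZ p u v) t := by
  have he : HasDerivAt (fun t => Real.exp (scaleExp p * t))
      (Real.exp (scaleExp p * t) * (scaleExp p * 1)) t :=
    ((hasDerivAt_id t).const_mul _).exp
  have hE := Real.hasDerivAt_exp t
  have hu' := h.1.comp t hE
  have hv' := h.2.comp t hE
  refine ⟨(he.mul hu').congr_deriv ?_, ?_⟩
  · simp only [efZ, Function.comp_apply]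
    ring
  · refine (he.mul ((hu'.const_mul (scaleExp p)).add (hE.mul hv'))).congr_deriv ?_
    rw [efY_rpow hp hu]
    have h2 : Real.exp (2 * t) = Real.exp t * Real.exp t := by
      rw [← Real.exp_add]; congr 1; ring
    have h3 : Real.exp t ≠ 0 := (Real.exp_pos t).ne'
    simp only [efZ, efY, Pi.add_apply, Pi.mul_apply, Function.comp_apply, efDamp, efCoeff, nonlin,
      h2]
    field_simp
    ring

/-- A priori inequality from the negativity of the Pohozaev functional. -/
theorem pohozaev_bracket_neg {s : ℝ} (hs : 0 < s) (h : pohozaev N p u v s < 0) :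
    (s * v s) ^ 2 + ((N : ℝ) - 2) * u s * (s * v s) + 2 * s ^ 2 * nonlinPrim p (u s) < 0 := by
  unfold pohozaev at h
  have h1 : s * (v s ^ 2 / 2 + nonlinPrim p (u s)) + ((N : ℝ) - 2) / 2 * (u s * v s) < 0 := by
    by_contra! hcon
    exact absurd h (not_lt.2 (mul_nonneg (pow_pos hs _).le hcon))
  nlinarith [mul_neg_of_neg_of_pos h1 hs]

theorem rpow_add_one_eq {x : ℝ} (hx : 0 < x) : x ^ (p + 1) = x ^ (p - 1) * x ^ 2 := by
  rw [← Real.rpow_natCast x 2, ← Real.rpow_add hx]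
  norm_num
  congr 1
  ring

/-- Complete the square in `s v + (N-2)/2 · u`, drop it, and divide by `u²`. The bound involves
neither `γ` nor `v`. -/
theorem rpow_le_of_pohozaev_neg (hp : 1 < p) {s : ℝ} (hs : 0 < s) (hu : 0 < u s)
    (h : pohozaev N p u v s < 0) :
    s ^ 2 * u s ^ (p - 1) ≤ (p + 1) / 2 * (s ^ 2 + ((N : ℝ) - 2) ^ 2 / 4) := by
  have h1 := pohozaev_bracket_neg hs h
  unfold nonlinPrim at h1
  rw [rpow_add_one_eq hu] at h1
  have h2 : 0 < p + 1 := by linarith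
  have h3 : 2 * s ^ 2 * (u s ^ (p - 1) * u s ^ 2 / (p + 1)) ≤
      (s ^ 2 + ((N : ℝ) - 2) ^ 2 / 4) * u s ^ 2 := by
    nlinarith [sq_nonneg (s * v s + ((N : ℝ) - 2) / 2 * u s)]
  have h4 : 2 * s ^ 2 * (u s ^ (p - 1) * u s ^ 2 / (p + 1)) =
      (2 / (p + 1) * (s ^ 2 * u s ^ (p - 1))) * u s ^ 2 := by ring
  rw [h4] at h3
  have h5 := le_of_mul_le_mul_right h3 (by positivity)
  calc s ^ 2 * u s ^ (p - 1) = (p + 1) / 2 * (2 / (p + 1) * (s ^ 2 * u s ^ (p - 1))) := by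
        field_simp
    _ ≤ _ := mul_le_mul_of_nonneg_left h5 (by positivity)

/-- The same square is kept and the term in `u^{p+1}` is dropped instead. -/
theorem slope_le_of_pohozaev_neg (hN : 3 ≤ N) (hp : 1 < p) {s : ℝ} (hs : 0 < s) (hu : 0 < u s)
    (h : pohozaev N p u v s < 0) : |s * v s| ≤ (s + ((N : ℝ) - 2)) * u s := by
  have hN' : (3 : ℝ) ≤ N := by exact_mod_cast hN
  have h1 := pohozaev_bracket_neg hs h
  have h2 : 0 ≤ u s ^ (p + 1) / (p + 1) :=
    div_nonneg (Real.rpow_nonneg hu.le _) (by linarith)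
  have h3 : (s * v s + ((N : ℝ) - 2) / 2 * u s) ^ 2 ≤ ((s + ((N : ℝ) - 2) / 2) * u s) ^ 2 := by
    unfold nonlinPrim at h1
    have h4 : 0 ≤ 2 * s ^ 2 * (u s ^ (p + 1) / (p + 1)) := by positivity
    have h5 : 0 ≤ s * ((N : ℝ) - 2) * u s ^ 2 := by
      have : (0 : ℝ) ≤ (N : ℝ) - 2 := by linarith
      positivity
    nlinarith
  have h6 := abs_le_of_sq_le_sq' h3 (by
    have : (0 : ℝ) ≤ (N : ℝ) - 2 := by linarith
    positivity)
  rw [abs_le]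
  constructor <;> nlinarith [h6.1, h6.2]

/-- If `v ≥ 0`, every term of the bracket is nonnegative. This gives monotonicity near a blow-up. -/
theorem slope_neg_of_pohozaev_neg (hN : 3 ≤ N) {s : ℝ} (hs : 0 < s) (hu : 0 < u s)
    (hF : 0 ≤ nonlinPrim p (u s)) (h : pohozaev N p u v s < 0) : v s < 0 := by
  have hN' : (3 : ℝ) ≤ N := by exact_mod_cast hN
  have h1 := pohozaev_bracket_neg hs h
  by_contra! hv
  have h2 : (0 : ℝ) ≤ (N : ℝ) - 2 := by linarith
  have h3 : 0 ≤ (s * v s) ^ 2 + ((N : ℝ) - 2) * u s * (s * v s) +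
      2 * s ^ 2 * nonlinPrim p (u s) := by positivity
  linarith

/-- Solutions with negative Pohozaev functional are bounded on `[s₀, ∞)`, uniformly. -/
theorem exists_uniform_bound (hp : 1 < p) {s₀ : ℝ} (h₀ : 0 < s₀) :
    ∃ B : ℝ, 0 < B ∧ ∀ (u v : ℝ → ℝ) (s : ℝ), s₀ ≤ s → 0 < u s → pohozaev N p u v s < 0 →
      u s ≤ B := by
  have hp1 : 0 < p - 1 := by linarith
  set Q := (p + 1) / 2 * (1 + ((N : ℝ) - 2) ^ 2 / 4 / s₀ ^ 2)
  have hQ : 0 < Q := by positivity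
  refine ⟨Q ^ (1 / (p - 1)), by positivity, fun u v s hs hu h => ?_⟩
  have hs0 : 0 < s := h₀.trans_le hs
  have h1 := rpow_le_of_pohozaev_neg hp hs0 hu h
  have h2 : u s ^ (p - 1) ≤ Q := by
    have h3 : u s ^ (p - 1) ≤ (p + 1) / 2 * (1 + ((N : ℝ) - 2) ^ 2 / 4 / s ^ 2) := by
      refine le_of_mul_le_mul_left (h1.trans_eq ?_) (pow_pos hs0 2)
      field_simp
    refine h3.trans ?_
    simp only [Q]
    gcongr
  calc u s = (u s ^ (p - 1)) ^ (1 / (p - 1)) := by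
        rw [← Real.rpow_mul hu.le, mul_one_div_cancel hp1.ne', Real.rpow_one]
    _ ≤ _ := Real.rpow_le_rpow (Real.rpow_nonneg hu.le _) h2 (by positivity)

/-- The Emden–Fowler variables are bounded for `t ≤ 0`, uniformly. -/
theorem exists_ef_bound (hN : 3 ≤ N) (hp : 1 < p) :
    ∃ M : ℝ, 0 < M ∧ ∀ (u v : ℝ → ℝ) (t : ℝ), t ≤ 0 → 0 < u (Real.exp t) →
      pohozaev N p u v (Real.exp t) < 0 → efY p u t ≤ M ∧ |efZ p u v t| ≤ M := by
  have hp1 : 0 < p - 1 := by linarith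
  have hN' : (3 : ℝ) ≤ N := by exact_mod_cast hN
  have hθ := scaleExp_pos hp
  set Q := (p + 1) / 2 * (1 + ((N : ℝ) - 2) ^ 2 / 4)
  have hQ : 0 < Q := by positivity
  set M₁ := Q ^ (1 / (p - 1))
  have hM₁ : 0 < M₁ := by positivity
  refine ⟨(scaleExp p + N) * M₁, by positivity, fun u v t ht hu h => ?_⟩
  have hs0 := Real.exp_pos t
  have hs1 : Real.exp t ≤ 1 := Real.exp_le_one_iff.2 ht
  have hy0 : 0 < efY p u t := mul_pos (Real.exp_pos _) hu
  have h1 := rpow_le_of_pohozaev_neg hp hs0 hu h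
  have h2 : efY p u t ^ (p - 1) ≤ Q := by
    have h3 : efY p u t ^ (p - 1) = Real.exp t ^ 2 * u (Real.exp t) ^ (p - 1) := by
      unfold efY
      rw [Real.mul_rpow (Real.exp_pos _).le hu.le, exp_scaleExp_rpow, scaleExp_mul hp,
        ← Real.exp_nat_mul]
      norm_num
    rw [h3]
    refine h1.trans ?_
    simp only [Q]
    have : Real.exp t ^ 2 ≤ 1 := pow_le_one₀ hs0.le hs1
    gcongr
  have hy : efY p u t ≤ M₁ := by
    calc efY p u t = (efY p u t ^ (p - 1)) ^ (1 / (p - 1)) := by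
          rw [← Real.rpow_mul hy0.le, mul_one_div_cancel hp1.ne', Real.rpow_one]
      _ ≤ _ := Real.rpow_le_rpow (Real.rpow_nonneg hy0.le _) h2 (by positivity)
  have h4 := slope_le_of_pohozaev_neg hN hp hs0 hu h
  have h5 : efZ p u v t = scaleExp p * efY p u t +
      Real.exp (scaleExp p * t) * (Real.exp t * v (Real.exp t)) := by
    unfold efZ efY; ring
  have h6 : |efZ p u v t| ≤ (scaleExp p + N) * efY p u t := by
    rw [h5]
    refine (abs_add_le _ _).trans ?_
    rw [abs_of_pos (mul_pos hθ hy0), abs_mul, Real.abs_exp]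
    have h7 : Real.exp (scaleExp p * t) * |Real.exp t * v (Real.exp t)| ≤
        Real.exp (scaleExp p * t) * ((N : ℝ) * u (Real.exp t)) := by
      refine mul_le_mul_of_nonneg_left (h4.trans ?_) (Real.exp_pos _).le
      exact mul_le_mul_of_nonneg_right (by linarith) hu.le
    unfold efY at *
    nlinarith
  have h7 : (scaleExp p + N) * efY p u t ≤ (scaleExp p + N) * M₁ :=
    mul_le_mul_of_nonneg_left hy (by linarith)
  refine ⟨?_, h6.trans h7⟩
  refine le_trans ?_ h7
  exact le_mul_of_one_le_left hy0.le (by linarith)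

end Transform

/-! ### Negative energy at the matching time -/

/-- The energy of the Emden–Fowler equation. -/
def efEnergy (b p : ℝ) (y z : ℝ → ℝ) (t : ℝ) : ℝ :=
  z t ^ 2 / 2 - b * y t ^ 2 / 2 + y t ^ (p + 1) / (p + 1)

/-- The matching time `log (r γ^{-(p-1)/2})`. -/
def matchTime (p r γ : ℝ) : ℝ := Real.log r - Real.log γ / scaleExp p

theorem tendsto_matchTime {p : ℝ} (hp : 1 < p) (r : ℝ) :
    Tendsto (matchTime p r) atTop atBot := by
  unfold matchTime
  exact tendsto_const_nhds.add_atBot (tendsto_neg_atTop_atBot.comp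
    (Real.tendsto_log_atTop.atTop_div_const (scaleExp_pos hp)))

/-- At the matching time the energy of large regular solutions is uniformly negative. -/
theorem exists_efEnergy_matchTime {N : ℕ} (hN : 3 ≤ N) {p : ℝ} (hpS : sobolevExponent N < p) :
    ∃ r η : ℝ, 0 < r ∧ 0 < η ∧ ∀ (γ : ℝ) (u v : ℝ → ℝ), 1 ≤ γ → RegularSol N p γ u v →
      efEnergy (efCoeff N p) p (efY p u) (efZ p u v) (matchTime p r γ) ≤ -η := by
  obtain ⟨hp, -⟩ := supercritical_iff hN hpS
  have hθ := scaleExp_pos hp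
  have ha := efDamp_pos hN hpS
  have hb := efCoeff_pos hN hpS
  set θ := scaleExp p with hθdef
  set b := efCoeff N p with hbdef
  -- Upper bound for the energy divided by `r^{2θ}`. At `r = 0` it equals `(θ² - b)/2 = -θ a/2`,
  -- where `a` is the damping; by continuity it remains negative for some `r > 0`.
  let br : ℝ → ℝ := fun r => (θ + r ^ 2) ^ 2 / 2 - b * (1 - r ^ 2) ^ 2 / 2 + r ^ 2 / (p + 1)
  have hbr0 : br 0 < 0 := by
    have : br 0 = -(θ * efDamp N p / 2) := by
      simp only [br, hbdef, efCoeff, efDamp, ← hθdef]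
      ring
    rw [this, neg_lt_zero]
    positivity
  have hbrc : Continuous br := by
    simp only [br]
    fun_prop
  have hev : ∀ᶠ r in 𝓝[>] (0 : ℝ), br r < 0 ∧ r < 1 ∧ 0 < r :=
    ((hbrc.continuousAt.eventually_lt continuousAt_const hbr0).filter_mono
      nhdsWithin_le_nhds).and
      (((eventually_lt_nhds one_pos).filter_mono nhdsWithin_le_nhds).and self_mem_nhdsWithin)
  obtain ⟨r, hr, hr1, hr0⟩ := hev.exists
  refine ⟨r, -((r ^ θ) ^ 2 * br r), hr0, ?_, fun γ u v hγ h => ?_⟩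
  · rw [neg_pos]
    exact mul_neg_of_pos_of_neg (by positivity) hr
  have hγ0 : 0 < γ := by linarith
  set t := matchTime p r γ with ht
  set s := Real.exp t with hs
  have hs0 : 0 < s := Real.exp_pos t
  have hk : Real.exp (θ * t) = r ^ θ / γ := by
    rw [ht, matchTime, ← hθdef, mul_sub, mul_div_cancel₀ _ hθ.ne', Real.exp_sub,
      Real.exp_log hγ0, Real.rpow_def_of_pos hr0, mul_comm θ]
  -- At this radius the drop of `u` below `γ` and the size of `s v` are both at most `r² γ`, so
  -- relative to `γ` they are at most `r²`.
  have hs2 : s ^ 2 * γ ^ p = r ^ 2 * γ := by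
    have h1 : s ^ 2 = Real.exp (θ * t) ^ (p - 1) := by
      rw [exp_scaleExp_rpow, scaleExp_mul hp, hs, ← Real.exp_nat_mul]
      norm_num
    rw [h1, hk, Real.div_rpow (by positivity) hγ0.le, ← Real.rpow_mul hr0.le, scaleExp_mul hp,
      Real.rpow_two, Real.rpow_sub hγ0, Real.rpow_one]
    have : γ ^ p ≠ 0 := by positivity
    field_simp
  have hu_le := h.le_value_zero hγ s hs0.le
  have hu_ge := h.lower hγ s hs0.le
  have hv := h.slope_le hγ s hs0.le
  rw [hs2] at hu_ge
  have hsv : |s * v s| ≤ r ^ 2 * γ := by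
    rw [abs_mul, abs_of_pos hs0, ← hs2, sq, mul_assoc]
    exact mul_le_mul_of_nonneg_left hv hs0.le
  set x := u s / γ with hx
  set q := s * v s / γ with hq
  have hx0 : 0 < x := div_pos (h.pos s hs0.le) hγ0
  have hx1 : x ≤ 1 := (div_le_one hγ0).2 hu_le
  have hx2 : 1 - r ^ 2 ≤ x := by
    rw [hx, le_div_iff₀ hγ0]
    linarith
  have hq1 : |q| ≤ r ^ 2 := by
    rw [hq, abs_div, abs_of_pos hγ0, div_le_iff₀ hγ0]
    exact hsv
  have hY : efY p u t = r ^ θ * x := by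
    unfold efY
    rw [← hθdef, hk, ← hs, hx]
    ring
  have hZ : efZ p u v t = r ^ θ * (θ * x + q) := by
    unfold efZ
    rw [← hθdef, hk, ← hs, hx, hq]
    ring
  have hR : 0 < r ^ θ := by positivity
  have hYp : efY p u t ^ (p + 1) ≤ (r ^ θ) ^ 2 * r ^ 2 := by
    rw [hY, Real.mul_rpow hR.le hx0.le, rpow_add_one_eq hR, ← Real.rpow_mul hr0.le,
      scaleExp_mul hp, Real.rpow_two]
    have : x ^ (p + 1) ≤ 1 := Real.rpow_le_one hx0.le hx1 (by linarith)
    rw [mul_comm ((r ^ θ) ^ 2)]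
    exact mul_le_of_le_one_right (by positivity) this
  have hz2 : (θ * x + q) ^ 2 ≤ (θ + r ^ 2) ^ 2 := by
    have := abs_le.1 hq1
    have h1 := mul_pos hθ hx0
    have h2 : θ * x ≤ θ := mul_le_of_le_one_right hθ.le hx1
    apply sq_le_sq' <;> linarith
  have hx3 : (1 - r ^ 2) ^ 2 ≤ x ^ 2 := by
    exact pow_le_pow_left₀ (sub_nonneg.2 (pow_le_one₀ hr0.le hr1.le)) hx2 2
  have hp1 : 0 < p + 1 := by linarith
  unfold efEnergy
  rw [neg_neg]
  have e1 : efZ p u v t ^ 2 / 2 ≤ (r ^ θ) ^ 2 * ((θ + r ^ 2) ^ 2 / 2) := by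
    rw [hZ, mul_pow, mul_div_assoc]
    gcongr
  have e2 : (r ^ θ) ^ 2 * (b * (1 - r ^ 2) ^ 2 / 2) ≤ b * efY p u t ^ 2 / 2 := by
    rw [hY, mul_pow]
    have : b * (1 - r ^ 2) ^ 2 / 2 ≤ b * x ^ 2 / 2 := by gcongr
    have := mul_le_mul_of_nonneg_left this (sq_nonneg (r ^ θ))
    linarith
  have e3 : efY p u t ^ (p + 1) / (p + 1) ≤ (r ^ θ) ^ 2 * (r ^ 2 / (p + 1)) := by
    rw [← mul_div_assoc]
    gcongr
  simp only [br]
  linarith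

/-! ### Dynamics of the Emden–Fowler equation: attraction and contraction -/

/-- The restoring force of the Emden–Fowler equation. -/
def efForce (b p x : ℝ) : ℝ := x ^ p - b * x

/-- The potential of the restoring force. -/
def efPot (b p x : ℝ) : ℝ := x ^ (p + 1) / (p + 1) - b * x ^ 2 / 2

theorem hasDerivAt_efPot {b p : ℝ} (hp : 1 < p) (x : ℝ) :
    HasDerivAt (efPot b p) (efForce b p x) x := by
  have h1 : HasDerivAt (fun x : ℝ => x ^ (p + 1)) ((p + 1) * x ^ (p + 1 - 1)) x :=
    Real.hasDerivAt_rpow_const (Or.inr (by linarith))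
  have h2 := (h1.div_const (p + 1)).sub (((hasDerivAt_pow 2 x).const_mul b).div_const 2)
  refine h2.congr_deriv ?_
  have : p + 1 ≠ 0 := by linarith
  unfold efForce
  rw [add_sub_cancel_right]
  field_simp
  simp
  ring

theorem contDiff_efForce {b p : ℝ} (hp : 1 ≤ p) : ContDiff ℝ 1 (efForce b p) := by
  have h : ContDiff ℝ ((1 : ℕ) : WithTop ℕ∞) fun x : ℝ => x ^ p :=
    Real.contDiff_rpow_const_of_le (by simpa using hp)
  have h' : ContDiff ℝ 1 fun x : ℝ => x ^ p := by simpa using h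
  exact h'.sub (contDiff_const.mul contDiff_id)

theorem efForce_equilibrium {b p A : ℝ} (hA : 0 < A) (hAb : A ^ (p - 1) = b) :
    efForce b p A = 0 := by
  unfold efForce
  rw [← hAb, Real.rpow_sub_one hA.ne']
  field_simp
  ring

theorem efForce_neg {b p A x : ℝ} (hp : 1 < p) (hAb : A ^ (p - 1) = b) (hx : 0 < x)
    (hxA : x < A) : efForce b p x < 0 := by
  have h1 : x ^ (p - 1) < A ^ (p - 1) := Real.rpow_lt_rpow hx.le hxA (by linarith)
  have h2 : x ^ p = x ^ (p - 1) * x := by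
    rw [Real.rpow_sub_one hx.ne']
    field_simp
  unfold efForce
  rw [h2, ← hAb]
  nlinarith

/-- Coercivity of the restoring force away from `0`. -/
theorem efForce_coercive {b p A δ : ℝ} (hp : 1 < p) (hA : 0 < A) (hAb : A ^ (p - 1) = b)
    (hδ : 0 < δ) (hδA : δ < A) :
    ∃ m : ℝ, 0 < m ∧ ∀ x, δ ≤ x → m * (x - A) ^ 2 ≤ (x - A) * efForce b p x := by
  have hconv : ConvexOn ℝ (Ici 0) (efForce b p) := by
    have h1 := convexOn_rpow hp.le
    have h2 : ConcaveOn ℝ (Ici (0 : ℝ)) fun x : ℝ => b * x :=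
      (LinearMap.concaveOn (LinearMap.mul ℝ ℝ b) (convex_Ici 0))
    exact h1.sub h2
  have hAf := efForce_equilibrium hA hAb
  have hδf := efForce_neg hp hAb hδ hδA
  -- The secant slope from `A` to `δ`: by convexity of the force the slopes from `A` increase with
  -- `x`, so this is the smallest one on `[δ, ∞)`.
  refine ⟨efForce b p δ / (δ - A), div_pos_of_neg_of_neg hδf (by linarith), fun x hx => ?_⟩
  rcases eq_or_ne x A with rfl | hne
  · simp
  · have h := hconv.secant_mono (a := A) (x := δ) (y := x) hA.le hδ.le (hδ.le.trans hx) hδA.ne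
      hne hx
    rw [hAf, sub_zero, sub_zero] at h
    have h2 := mul_le_mul_of_nonneg_right h (sq_nonneg (x - A))
    have h3 : efForce b p x / (x - A) * (x - A) ^ 2 = (x - A) * efForce b p x := by
      have := sub_ne_zero.2 hne
      field_simp
    rwa [h3] at h2

/-- By the mean value theorem the difference is the force at an intermediate point times `x - A`.
Coercivity gives its sign, and the Lipschitz bound with vanishing force at `A` gives its size. -/
theorem efPot_bounds {b p A δ M m L : ℝ} (hp : 1 < p) (hA : 0 < A)
    (hAb : A ^ (p - 1) = b) (hδA : δ < A) (hAM : A ≤ M) (hδ : 0 < δ) (hm : 0 < m) (hL : 0 ≤ L)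
    (hcoer : ∀ x, δ ≤ x → m * (x - A) ^ 2 ≤ (x - A) * efForce b p x)
    (hlip : ∀ x ∈ Icc (-M) M, ∀ y ∈ Icc (-M) M,
      |efForce b p x - efForce b p y| ≤ L * |x - y|) {x : ℝ} (hx : δ ≤ x) (hxM : x ≤ M) :
    0 ≤ efPot b p x - efPot b p A ∧ efPot b p x - efPot b p A ≤ L * (x - A) ^ 2 := by
  have hAf := efForce_equilibrium hA hAb
  have hl : ∀ ξ, δ ≤ ξ → ξ ≤ M → |efForce b p ξ| ≤ L * |ξ - A| := by
    intro ξ h1 h2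
    have := hlip ξ ⟨by linarith, h2⟩ A ⟨by linarith, hAM⟩
    rwa [hAf, sub_zero] at this
  have hc : Continuous (efPot b p) :=
    continuous_iff_continuousAt.2 fun x => (hasDerivAt_efPot hp x).continuousAt
  rcases lt_trichotomy x A with h | h | h
  · obtain ⟨ξ, hξ, hξ'⟩ := exists_hasDerivAt_eq_slope (efPot b p) (efForce b p) h
      hc.continuousOn (fun y _ => hasDerivAt_efPot hp y)
    rw [eq_div_iff (by linarith)] at hξ'
    have h1 := hcoer ξ (hx.trans hξ.1.le)
    have h2 := hl ξ (hx.trans hξ.1.le) (hξ.2.le.trans hAM)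
    rw [abs_of_neg (by linarith [hξ.2] : ξ - A < 0)] at h2
    have h3 := (abs_le.1 h2).1
    have h4 : efForce b p ξ ≤ 0 := by
      by_contra! hcon
      nlinarith [hξ.2, mul_nonneg hm.le (sq_nonneg (ξ - A))]
    constructor
    · nlinarith
    · have h5 : -efForce b p ξ ≤ L * (A - x) := by nlinarith [hξ.1]
      nlinarith
  · simp [h]
  · obtain ⟨ξ, hξ, hξ'⟩ := exists_hasDerivAt_eq_slope (efPot b p) (efForce b p) h
      hc.continuousOn (fun y _ => hasDerivAt_efPot hp y)
    rw [eq_div_iff (by linarith)] at hξ'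
    have h1 := hcoer ξ (hδA.le.trans hξ.1.le)
    have h2 := hl ξ (hδA.le.trans hξ.1.le) (hξ.2.le.trans hxM)
    rw [abs_of_pos (by linarith [hξ.1] : 0 < ξ - A)] at h2
    have h3 := (abs_le.1 h2).2
    have h4 : 0 ≤ efForce b p ξ := by
      by_contra! hcon
      nlinarith [hξ.1, mul_nonneg hm.le (sq_nonneg (ξ - A))]
    constructor
    · nlinarith
    · have h5 : efForce b p ξ ≤ L * (x - A) := by nlinarith [hξ.2]
      nlinarith

/-- `e + a/2 · d` is the factor by which a perturbation `r` of the equation enters the derivative of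
the Lyapunov functional for differences. -/
theorem perturbation_le {a d e r ε : ℝ} (ha : 0 ≤ a) (hε : 0 ≤ ε) (hr : |r| ≤ ε * |d|) :
    r * (e + a / 2 * d) ≤ ε * (1 + a) * ((e ^ 2 + d ^ 2) / 2) := by
  have h4 : |e + a / 2 * d| ≤ |e| + a / 2 * |d| := by
    refine (abs_add_le _ _).trans ?_
    rw [abs_mul, abs_of_nonneg (by positivity : 0 ≤ a / 2)]
  have h5 : r * (e + a / 2 * d) ≤ ε * |d| * (|e| + a / 2 * |d|) := by
    refine (le_abs_self _).trans ?_
    rw [abs_mul]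
    exact mul_le_mul hr h4 (abs_nonneg _) (by positivity)
  refine h5.trans ?_
  have h6 : |d| * (|e| + a / 2 * |d|) ≤ (1 + a) * ((e ^ 2 + d ^ 2) / 2) := by
    have h7 : |d| * |e| ≤ (e ^ 2 + d ^ 2) / 2 := by
      nlinarith [sq_nonneg (|d| - |e|), sq_abs d, sq_abs e]
    have h8 : |d| * |d| = d ^ 2 := by rw [← sq, sq_abs]
    have h9 := mul_nonneg ha (sq_nonneg e)
    nlinarith
  have := mul_le_mul_of_nonneg_left h6 hε
  linarith

section EF

variable {a b p : ℝ}

theorem hasDerivAt_efEnergy (hp : 1 < p) {y z : ℝ → ℝ} {t : ℝ} (h : EFAt a b p y z t) :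
    HasDerivAt (efEnergy b p y z) (-(a * z t ^ 2) + Real.exp (2 * t) * (y t * z t)) t := by
  have h1 := ((h.2.pow 2).div_const 2).add ((hasDerivAt_efPot (b := b) hp (y t)).comp t h.1)
  have h2 : efEnergy b p y z = (fun t => (z ^ 2) t / 2) + efPot b p ∘ y := by
    funext s
    simp only [efEnergy, efPot, Pi.add_apply, Pi.pow_apply, Function.comp_apply]
    ring
  rw [h2]
  refine h1.congr_deriv ?_
  simp [efForce]
  ring

/-- A uniformly negative energy keeps the solution away from `0`. -/
theorem exists_ef_lower_bound (ha : 0 < a) (hb : 0 < b) (hp : 1 < p) {M η : ℝ} (hM : 0 < M)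
    (hη : 0 < η) :
    ∃ T δ : ℝ, T ≤ 0 ∧ 0 < δ ∧ ∀ (y z : ℝ → ℝ) (t₀ t : ℝ), t₀ ≤ t → t ≤ T →
      (∀ τ ∈ Icc t₀ t, EFAt a b p y z τ ∧ 0 < y τ ∧ y τ ≤ M ∧ |z τ| ≤ M) →
      efEnergy b p y z t₀ ≤ -η → δ ≤ y t := by
  -- Up to time `T` the perturbation raises the energy by at most `M² e^{2T}/2 ≤ η/2`. So the energy
  -- stays below `-η/2`, where only `-b y²/2` is negative, whence `y² ≥ η/b`.
  refine ⟨min 0 (Real.log (η / M ^ 2) / 2), Real.sqrt (η / b), min_le_left _ _, by positivity, ?_⟩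
  intro y z t₀ t ht htT h hE
  have hexp : Real.exp (2 * t) ≤ η / M ^ 2 := by
    rw [← Real.le_log_iff_exp_le (by positivity)]
    have := htT.trans (min_le_right _ _)
    linarith
  have hanti := le_of_hasDerivAt_nonpos
    (f := fun τ => efEnergy b p y z τ - M ^ 2 / 2 * Real.exp (2 * τ))
    (f' := fun τ => -(a * z τ ^ 2) + Real.exp (2 * τ) * (y τ * z τ) -
      M ^ 2 / 2 * (Real.exp (2 * τ) * (2 * 1))) ht
    (fun τ hτ => (hasDerivAt_efEnergy hp (h τ hτ).1).sub
      ((((hasDerivAt_id τ).const_mul 2).exp).const_mul (M ^ 2 / 2)))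
    (fun τ hτ => by
      obtain ⟨-, h0, h1, h2⟩ := h τ hτ
      have h3 : y τ * z τ ≤ M ^ 2 := by
        calc y τ * z τ ≤ y τ * |z τ| := mul_le_mul_of_nonneg_left (le_abs_self _) h0.le
          _ ≤ M * M := mul_le_mul h1 h2 (abs_nonneg _) hM.le
          _ = M ^ 2 := by ring
      have h4 := mul_le_mul_of_nonneg_left h3 (Real.exp_pos (2 * τ)).le
      have h5 : 0 ≤ a * z τ ^ 2 := by positivity
      linarith)
  have h6 : M ^ 2 / 2 * Real.exp (2 * t) ≤ η / 2 := by
    calc M ^ 2 / 2 * Real.exp (2 * t) ≤ M ^ 2 / 2 * (η / M ^ 2) := by gcongr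
      _ = η / 2 := by field_simp
  have h7 : 0 ≤ M ^ 2 / 2 * Real.exp (2 * t₀) := by positivity
  have h8 : efEnergy b p y z t ≤ -(η / 2) := by linarith
  obtain ⟨-, h0, -, -⟩ := h t ⟨ht, le_rfl⟩
  unfold efEnergy at h8
  have h9 : 0 ≤ y t ^ (p + 1) / (p + 1) := div_nonneg (Real.rpow_nonneg h0.le _) (by linarith)
  rw [Real.sqrt_le_left h0.le, div_le_iff₀ hb]
  nlinarith [sq_nonneg (z t)]

/-- Exponential attraction to the equilibrium `A`. -/
theorem exists_ef_attraction (ha : 0 < a) (hp : 1 < p) {A δ M : ℝ} (hA : 0 < A)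
    (hAb : A ^ (p - 1) = b) (hδ : 0 < δ) (hδA : δ < A) (hAM : A ≤ M) :
    ∃ C c : ℝ, 0 < C ∧ 0 < c ∧ ∀ (y z : ℝ → ℝ) (t₀ t : ℝ), t₀ ≤ t →
      (∀ τ ∈ Icc t₀ t, EFAt a b p y z τ ∧ δ ≤ y τ ∧ y τ ≤ M ∧ |z τ| ≤ M) →
      (y t - A) ^ 2 ≤ C * (Real.exp (-(c * (t - t₀))) + Real.exp (2 * t)) := by
  obtain ⟨m, hm, hcoer⟩ := efForce_coercive hp hA hAb hδ hδA
  obtain ⟨L, hL, hlip⟩ := exists_lipschitz_of_contDiff (contDiff_efForce (b := b) hp.le) M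
  have hM : 0 < M := hA.trans_le hAM
  set k := a ^ 2 / 2 + L with hk
  have hk0 : 0 < k := by positivity
  set c := min (a / 2) (a / 2 * m / k) with hc
  have hc0 : 0 < c := by positivity
  have hc1 : c ≤ a / 2 := min_le_left _ _
  have hc2 : c * k ≤ a / 2 * m := by
    rw [← le_div_iff₀ hk0]
    exact min_le_right _ _
  set Q := M * (M + a / 2 * M) with hQ
  set V₀ := M ^ 2 + k * M ^ 2 with hV₀
  set C := 8 / a ^ 2 * (V₀ + Q) with hC
  refine ⟨C, c, by positivity, hc0, fun y z t₀ t ht h => ?_⟩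
  -- Lyapunov functional: energy relative to `A` plus a multiple of `(y - A) z`, which produces
  -- dissipation in `y - A`. The coefficient `a²/4` cancels the mixed terms in the derivative.
  let V : ℝ → ℝ := fun τ => z τ ^ 2 / 2 + a / 2 * ((y τ - A) * z τ) + a ^ 2 / 4 * (y τ - A) ^ 2 +
    (efPot b p (y τ) - efPot b p A)
  have hpot : ∀ τ ∈ Icc t₀ t, 0 ≤ efPot b p (y τ) - efPot b p A ∧
      efPot b p (y τ) - efPot b p A ≤ L * (y τ - A) ^ 2 := fun τ hτ =>
    efPot_bounds hp hA hAb hδA hAM hδ hm hL hcoer hlip (h τ hτ).2.1 (h τ hτ).2.2.1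
  have hVle : ∀ τ ∈ Icc t₀ t, V τ ≤ z τ ^ 2 + k * (y τ - A) ^ 2 := by
    intro τ hτ
    have := (hpot τ hτ).2
    simp only [V, hk]
    nlinarith [sq_nonneg (z τ - a / 2 * (y τ - A)), sq_nonneg (z τ)]
  have hVge : ∀ τ ∈ Icc t₀ t, a ^ 2 / 8 * (y τ - A) ^ 2 ≤ V τ := by
    intro τ hτ
    have := (hpot τ hτ).1
    simp only [V]
    nlinarith [sq_nonneg (z τ + a / 2 * (y τ - A))]
  have hdist : ∀ τ ∈ Icc t₀ t, |y τ - A| ≤ M := by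
    intro τ hτ
    obtain ⟨-, h1, h2, -⟩ := h τ hτ
    rw [abs_le]
    constructor <;> linarith
  have hV' : ∀ τ ∈ Icc t₀ t, HasDerivAt V (-(a / 2 * z τ ^ 2) -
      a / 2 * ((y τ - A) * efForce b p (y τ)) +
      Real.exp (2 * τ) * (y τ * (z τ + a / 2 * (y τ - A)))) τ := by
    intro τ hτ
    obtain ⟨⟨hy, hz⟩, -⟩ := h τ hτ
    have h1 := ((((hz.pow 2).div_const 2).add (((hy.sub_const A).mul hz).const_mul (a / 2))).add
      (((hy.sub_const A).pow 2).const_mul (a ^ 2 / 4))).add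
      (((hasDerivAt_efPot (b := b) hp (y τ)).comp τ hy).sub_const (efPot b p A))
    refine h1.congr_deriv ?_
    simp only [efForce]
    push_cast
    ring
  -- Integrated form of `V' ≤ -c V + Q e^{2τ}`.
  have hanti := le_of_hasDerivAt_nonpos
    (f := fun τ => Real.exp (c * τ) * V τ - Q / (c + 2) * Real.exp ((c + 2) * τ))
    (f' := fun τ => Real.exp (c * τ) * (c * 1) * V τ + Real.exp (c * τ) * (-(a / 2 * z τ ^ 2) -
      a / 2 * ((y τ - A) * efForce b p (y τ)) +
      Real.exp (2 * τ) * (y τ * (z τ + a / 2 * (y τ - A)))) -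
      Q / (c + 2) * (Real.exp ((c + 2) * τ) * ((c + 2) * 1))) ht
    (fun τ hτ => ((((hasDerivAt_id τ).const_mul c).exp).mul (hV' τ hτ)).sub
      ((((hasDerivAt_id τ).const_mul (c + 2)).exp).const_mul _))
    (fun τ hτ => by
      obtain ⟨-, h0, h1, h2⟩ := h τ hτ
      have h3 := hdist τ hτ
      have h4 : y τ * (z τ + a / 2 * (y τ - A)) ≤ Q := by
        have h5 : z τ + a / 2 * (y τ - A) ≤ M + a / 2 * M := by
          have := (abs_le.1 h2).2
          have := mul_le_mul_of_nonneg_left (abs_le.1 h3).2 (by positivity : 0 ≤ a / 2)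
          linarith
        have h6 : 0 ≤ y τ := hδ.le.trans h0
        calc y τ * (z τ + a / 2 * (y τ - A)) ≤ y τ * (M + a / 2 * M) :=
              mul_le_mul_of_nonneg_left h5 h6
          _ ≤ M * (M + a / 2 * M) := mul_le_mul_of_nonneg_right h1 (by positivity)
      have h5 := mul_le_mul_of_nonneg_left (hVle τ hτ) hc0.le
      have h6 := mul_le_mul_of_nonneg_right hc2 (sq_nonneg (y τ - A))
      have h7 := mul_le_mul_of_nonneg_left (hcoer _ h0) (by positivity : 0 ≤ a / 2)
      have h8 := mul_le_mul_of_nonneg_right hc1 (sq_nonneg (z τ))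
      have h9 := mul_le_mul_of_nonneg_left h4 (Real.exp_pos (2 * τ)).le
      have h10 : Real.exp ((c + 2) * τ) = Real.exp (c * τ) * Real.exp (2 * τ) := by
        rw [← Real.exp_add]; congr 1; ring
      have h11 : c * V τ + (-(a / 2 * z τ ^ 2) - a / 2 * ((y τ - A) * efForce b p (y τ)) +
          Real.exp (2 * τ) * (y τ * (z τ + a / 2 * (y τ - A)))) - Q * Real.exp (2 * τ) ≤ 0 := by
        linarith
      have h12 := mul_nonpos_of_nonneg_of_nonpos (Real.exp_pos (c * τ)).le h11
      have h13 : Q / (c + 2) * (Real.exp ((c + 2) * τ) * ((c + 2) * 1)) =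
          Q * (Real.exp (c * τ) * Real.exp (2 * τ)) := by
        rw [h10]; field_simp
      rw [h13]
      linarith)
  have ht₀ : t₀ ∈ Icc t₀ t := ⟨le_rfl, ht⟩
  have hVt₀ : V t₀ ≤ V₀ := by
    refine (hVle t₀ ht₀).trans ?_
    have h1 := sq_le_sq' (abs_le.1 (h t₀ ht₀).2.2.2).1 (abs_le.1 (h t₀ ht₀).2.2.2).2
    have h2 := sq_le_sq' (abs_le.1 (hdist t₀ ht₀)).1 (abs_le.1 (hdist t₀ ht₀)).2
    have h3 := mul_le_mul_of_nonneg_left h2 hk0.le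
    simp only [hV₀]
    linarith
  have hQ0 : 0 ≤ Q := by positivity
  have hV₀0 : 0 ≤ V₀ := by positivity
  have h1 : Real.exp (c * t) * V t ≤
      Real.exp (c * t₀) * V₀ + Q * (Real.exp (c * t) * Real.exp (2 * t)) := by
    have h2 : 0 ≤ Q / (c + 2) * Real.exp ((c + 2) * t₀) := by positivity
    have h3 : Q / (c + 2) * Real.exp ((c + 2) * t) ≤ Q * (Real.exp (c * t) * Real.exp (2 * t)) := by
      have : Real.exp ((c + 2) * t) = Real.exp (c * t) * Real.exp (2 * t) := by
        rw [← Real.exp_add]; congr 1; ring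
      rw [this]
      refine mul_le_mul_of_nonneg_right (div_le_self hQ0 (by linarith)) (by positivity)
    have h4 := mul_le_mul_of_nonneg_left hVt₀ (Real.exp_pos (c * t₀)).le
    linarith
  have h2 : V t ≤ V₀ * Real.exp (-(c * (t - t₀))) + Q * Real.exp (2 * t) := by
    have h3 : Real.exp (c * t₀) = Real.exp (c * t) * Real.exp (-(c * (t - t₀))) := by
      rw [← Real.exp_add]; congr 1; ring
    rw [h3] at h1
    refine le_of_mul_le_mul_left (h1.trans_eq ?_) (Real.exp_pos (c * t))
    ring
  have h3 : V t ≤ (V₀ + Q) * (Real.exp (-(c * (t - t₀))) + Real.exp (2 * t)) := by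
    have e1 := Real.exp_pos (-(c * (t - t₀)))
    have e2 := Real.exp_pos (2 * t)
    have e3 := mul_nonneg hV₀0 e2.le
    have e4 := mul_nonneg hQ0 e1.le
    rw [add_mul, mul_add, mul_add]
    linarith
  have h4 := (hVge t ⟨ht, le_rfl⟩).trans h3
  calc (y t - A) ^ 2 = 8 / a ^ 2 * (a ^ 2 / 8 * (y t - A) ^ 2) := by field_simp
    _ ≤ 8 / a ^ 2 * ((V₀ + Q) * (Real.exp (-(c * (t - t₀))) + Real.exp (2 * t))) :=
        mul_le_mul_of_nonneg_left h4 (by positivity)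
    _ = _ := by rw [hC]; ring

/-- Exponential contraction of two solutions near the equilibrium `A`. -/
theorem exists_ef_contraction (ha : 0 < a) (hb : 0 < b) (hp : 1 < p) {A : ℝ} (hA : 0 < A)
    (hAb : A ^ (p - 1) = b) :
    ∃ ρ T C c : ℝ, 0 < ρ ∧ 0 < C ∧ 0 < c ∧ ∀ (y₁ z₁ y₂ z₂ : ℝ → ℝ) (t₀ t : ℝ), t₀ ≤ t → t ≤ T →
      (∀ τ ∈ Icc t₀ t, EFAt a b p y₁ z₁ τ ∧ EFAt a b p y₂ z₂ τ ∧ |y₁ τ - A| ≤ ρ ∧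
        |y₂ τ - A| ≤ ρ) →
      gap y₁ z₁ y₂ z₂ t ≤ C * Real.exp (-(c * (t - t₀))) * gap y₁ z₁ y₂ z₂ t₀ := by
  -- The derivative of the force at the equilibrium.
  set κ := (p - 1) * b with hκ
  have hκ0 : 0 < κ := mul_pos (by linarith) hb
  set m := min (a / 2) (a / 2 * κ) with hm
  have hm0 : 0 < m := by positivity
  -- Half of `ε` pays for the nonlinear remainder, half for the term `e^{2τ} y`; together they cost
  -- less than half of the dissipation.
  set ε := m / (2 * (1 + a)) with hε
  have hε0 : 0 < ε := by positivity
  have hεm : ε * (1 + a) = m / 2 := by rw [hε]; field_simp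
  have hstrict : HasStrictDerivAt (efForce b p) κ A := by
    have h1 : HasStrictDerivAt (fun x : ℝ => x ^ p) (p * A ^ (p - 1)) A :=
      Real.hasStrictDerivAt_rpow_const (Or.inl hA.ne')
    have h2 := h1.sub ((hasStrictDerivAt_id A).const_mul b)
    have e : p * A ^ (p - 1) - b * 1 = κ := by rw [hAb, hκ]; ring
    rw [e] at h2
    exact h2
  -- Strict differentiability compares two nearby points with each other; ordinary differentiability
  -- would only compare each with `A`.
  have hlo := hstrict.isLittleO.def (half_pos hε0)
  obtain ⟨ρ', hρ', hball⟩ := Metric.eventually_nhds_iff.1 hlo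
  set ρ := ρ' / 2
  have hρ : 0 < ρ := by positivity
  have hforce : ∀ x₁ x₂, |x₁ - A| ≤ ρ → |x₂ - A| ≤ ρ →
      |efForce b p x₁ - efForce b p x₂ - κ * (x₁ - x₂)| ≤ ε / 2 * |x₁ - x₂| := by
    intro x₁ x₂ h1 h2
    have h3 : dist (x₁, x₂) (A, A) < ρ' := by
      rw [Prod.dist_eq, Real.dist_eq, Real.dist_eq]
      exact (max_le h1 h2).trans_lt (by simp only [ρ]; linarith)
    have h4 := hball h3
    simpa [Real.norm_eq_abs, mul_comm] using h4
  set k := 1 + a ^ 2 + κ with hk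
  have hk0 : 0 < k := by positivity
  set c := m / 2 / k with hc
  have hc0 : 0 < c := by positivity
  have hck : c * k = m / 2 := by rw [hc]; field_simp
  refine ⟨ρ, Real.log (ε / 2) / 2, (8 / a ^ 2 + 8) * k, c, hρ, by positivity, hc0, ?_⟩
  intro y₁ z₁ y₂ z₂ t₀ t ht htT h
  let W : ℝ → ℝ := fun τ => (z₁ τ - z₂ τ) ^ 2 / 2 + a / 2 * ((y₁ τ - y₂ τ) * (z₁ τ - z₂ τ)) +
    (a ^ 2 / 4 + κ / 2) * (y₁ τ - y₂ τ) ^ 2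
  have hWle : ∀ τ, W τ ≤ k * gap y₁ z₁ y₂ z₂ τ := by
    intro τ
    simp only [W, gap, hk]
    nlinarith [sq_nonneg ((z₁ τ - z₂ τ) - a / 2 * (y₁ τ - y₂ τ)), sq_nonneg (z₁ τ - z₂ τ),
      sq_nonneg (y₁ τ - y₂ τ), mul_nonneg hκ0.le (sq_nonneg (z₁ τ - z₂ τ)),
      mul_nonneg hκ0.le (sq_nonneg (y₁ τ - y₂ τ)),
      mul_nonneg (sq_nonneg a) (sq_nonneg (z₁ τ - z₂ τ)),
      mul_nonneg (sq_nonneg a) (sq_nonneg (y₁ τ - y₂ τ))]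
  have hWge : ∀ τ, gap y₁ z₁ y₂ z₂ τ ≤ (8 / a ^ 2 + 8) * W τ := by
    intro τ
    have h1 : a ^ 2 / 8 * (y₁ τ - y₂ τ) ^ 2 ≤ W τ := by
      simp only [W]
      nlinarith [sq_nonneg ((z₁ τ - z₂ τ) + a / 2 * (y₁ τ - y₂ τ)),
        mul_nonneg hκ0.le (sq_nonneg (y₁ τ - y₂ τ))]
    have h2 : (z₁ τ - z₂ τ) ^ 2 / 8 ≤ W τ := by
      simp only [W]
      nlinarith [sq_nonneg ((z₁ τ - z₂ τ) * 3 + a * 2 * (y₁ τ - y₂ τ)),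
        mul_nonneg hκ0.le (sq_nonneg (y₁ τ - y₂ τ)),
        mul_nonneg (sq_nonneg a) (sq_nonneg (y₁ τ - y₂ τ)), sq_nonneg (z₁ τ - z₂ τ)]
    have h3 : (y₁ τ - y₂ τ) ^ 2 ≤ 8 / a ^ 2 * W τ := by
      calc (y₁ τ - y₂ τ) ^ 2 = 8 / a ^ 2 * (a ^ 2 / 8 * (y₁ τ - y₂ τ) ^ 2) := by field_simp
        _ ≤ _ := mul_le_mul_of_nonneg_left h1 (by positivity)
    unfold gap
    linarith
  have hmain := le_exp_mul_of_hasDerivAt_le (e := W) (K := -c) ht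
    (e' := fun τ => -(a / 2 * (z₁ τ - z₂ τ) ^ 2) - a / 2 * κ * (y₁ τ - y₂ τ) ^ 2 +
      (-(efForce b p (y₁ τ) - efForce b p (y₂ τ) - κ * (y₁ τ - y₂ τ)) +
        Real.exp (2 * τ) * (y₁ τ - y₂ τ)) * ((z₁ τ - z₂ τ) + a / 2 * (y₁ τ - y₂ τ)))
    (fun τ hτ => by
      obtain ⟨⟨hy₁, hz₁⟩, ⟨hy₂, hz₂⟩, -, -⟩ := h τ hτ
      have hy := hy₁.sub hy₂
      have hz := hz₁.sub hz₂
      have h1 := (((hz.pow 2).div_const 2).add ((hy.mul hz).const_mul (a / 2))).add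
        ((hy.pow 2).const_mul (a ^ 2 / 4 + κ / 2))
      refine h1.congr_deriv ?_
      simp only [efForce, Pi.sub_apply]
      push_cast
      ring)
    (fun τ hτ => by
      obtain ⟨-, -, h1, h2⟩ := h τ hτ
      have hf := hforce _ _ h1 h2
      have hexp : Real.exp (2 * τ) ≤ ε / 2 := by
        rw [← Real.le_log_iff_exp_le (by positivity)]
        linarith [hτ.2]
      have hwle := hWle τ
      simp only [gap] at hwle
      set d := y₁ τ - y₂ τ
      set e := z₁ τ - z₂ τ
      set r := -(efForce b p (y₁ τ) - efForce b p (y₂ τ) - κ * d) + Real.exp (2 * τ) * d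
      have hr : |r| ≤ ε * |d| := by
        refine (abs_add_le _ _).trans ?_
        rw [abs_neg, abs_mul, Real.abs_exp]
        nlinarith [abs_nonneg d]
      have h3 : r * (e + a / 2 * d) ≤ ε * (1 + a) * ((e ^ 2 + d ^ 2) / 2) :=
        perturbation_le ha.le hε0.le hr
      rw [hεm] at h3
      have h4 := mul_le_mul_of_nonneg_right (min_le_left (a / 2) (a / 2 * κ)) (sq_nonneg e)
      have h5 := mul_le_mul_of_nonneg_right (min_le_right (a / 2) (a / 2 * κ)) (sq_nonneg d)
      have h6 := mul_le_mul_of_nonneg_left hwle hc0.le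
      rw [← mul_assoc, hck] at h6
      have h7 : 0 ≤ m * (e ^ 2 + d ^ 2) := by positivity
      rw [← hm] at h4 h5
      linarith)
  have h1 := mul_le_mul_of_nonneg_left (hWle t₀) (Real.exp_pos (-c * (t - t₀))).le
  have h2 := mul_le_mul_of_nonneg_left (hmain.trans h1) (by positivity : 0 ≤ 8 / a ^ 2 + 8)
  refine ((hWge t).trans h2).trans_eq ?_
  rw [neg_mul]
  ring

end EF

/-! ### Cauchy property of the regular solutions near the origin -/

section Convergence

variable {N : ℕ} {p : ℝ}

theorem RegularSol.efAt {γ : ℝ} {u v : ℝ → ℝ} (hp : 1 < p) (h : RegularSol N p γ u v) (t : ℝ) :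
    EFAt (efDamp N p) (efCoeff N p) p (efY p u) (efZ p u v) t :=
  efAt_of_solAt hp (h.sol _ (Real.exp_pos t)) (h.pos _ (Real.exp_pos t).le).le

/-- At a fixed time the change of variables is linear and invertible, so the constant depends only
on `t` and `p`. -/
theorem gap_le_of_ef (hp : 1 < p) (t : ℝ) :
    ∃ C : ℝ, 0 < C ∧ ∀ u₁ v₁ u₂ v₂ : ℝ → ℝ, gap u₁ v₁ u₂ v₂ (Real.exp t) ≤
      C * gap (efY p u₁) (efZ p u₁ v₁) (efY p u₂) (efZ p u₂ v₂) t := by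
  set θ := scaleExp p with hθ
  have hθ0 : 0 < θ := scaleExp_pos hp
  set s := Real.exp t
  have hs : 0 < s := Real.exp_pos t
  set k := Real.exp (θ * t)
  have hk : 0 < k := Real.exp_pos _
  refine ⟨(2 / s ^ 2 * (1 + θ ^ 2) + 1) / k ^ 2, by positivity, fun u₁ v₁ u₂ v₂ => ?_⟩
  unfold gap efY efZ
  rw [← hθ]
  change (v₁ s - v₂ s) ^ 2 + (u₁ s - u₂ s) ^ 2 ≤ _ *
    ((k * (θ * u₁ s + s * v₁ s) - k * (θ * u₂ s + s * v₂ s)) ^ 2 + (k * u₁ s - k * u₂ s) ^ 2)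
  set d := u₁ s - u₂ s with hd
  set e := v₁ s - v₂ s with he
  have h1 : (k * (θ * u₁ s + s * v₁ s) - k * (θ * u₂ s + s * v₂ s)) ^ 2 + (k * u₁ s - k * u₂ s) ^ 2
      = k ^ 2 * ((θ * d + s * e) ^ 2 + d ^ 2) := by rw [hd, he]; ring
  rw [h1, ← mul_assoc, div_mul_cancel₀ _ (by positivity)]
  have h2 : (s * e) ^ 2 ≤ 2 * (1 + θ ^ 2) * ((θ * d + s * e) ^ 2 + d ^ 2) := by
    nlinarith [sq_nonneg (θ * d + s * e + θ * d), sq_nonneg (θ * d + s * e), sq_nonneg d,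
      mul_nonneg (sq_nonneg θ) (sq_nonneg (θ * d + s * e))]
  have h3 : e ^ 2 ≤ 2 / s ^ 2 * (1 + θ ^ 2) * ((θ * d + s * e) ^ 2 + d ^ 2) := by
    calc e ^ 2 = (s * e) ^ 2 / s ^ 2 := by field_simp
      _ ≤ 2 * (1 + θ ^ 2) * ((θ * d + s * e) ^ 2 + d ^ 2) / s ^ 2 := by gcongr
      _ = _ := by ring
  nlinarith [sq_nonneg (θ * d + s * e)]

/-- For large `γ` the regular solutions are bounded below by a multiple of `s^{-θ}` near `0`, and
their phase points at a fixed small radius form a Cauchy family. -/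
theorem exists_cauchy_near_zero (hN : 3 ≤ N) (hpS : sobolevExponent N < p) :
    ∃ T δ : ℝ, 0 < δ ∧
      (∀ t, t ≤ T → ∃ Γ, ∀ γ u v, Γ ≤ γ → RegularSol N p γ u v → δ ≤ efY p u t) ∧
      (∀ t, t ≤ T → ∀ ε, 0 < ε → ∃ Γ, ∀ γ₁ u₁ v₁ γ₂ u₂ v₂, Γ ≤ γ₁ → Γ ≤ γ₂ →
        RegularSol N p γ₁ u₁ v₁ → RegularSol N p γ₂ u₂ v₂ →
        gap u₁ v₁ u₂ v₂ (Real.exp t) ≤ ε) := by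
  obtain ⟨hp, -⟩ := supercritical_iff hN hpS
  have ha := efDamp_pos hN hpS
  have hb := efCoeff_pos hN hpS
  have hp1 : 0 < p - 1 := by linarith
  set a := efDamp N p
  set b := efCoeff N p
  set A := b ^ (1 / (p - 1)) with hAdef
  have hA : 0 < A := by positivity
  have hAb : A ^ (p - 1) = b := by
    rw [hAdef, ← Real.rpow_mul hb.le, one_div_mul_cancel hp1.ne', Real.rpow_one]
  obtain ⟨M₀, hM₀, hM₀'⟩ := exists_ef_bound hN hp
  set M := max M₀ A
  have hM : 0 < M := hM₀.trans_le (le_max_left _ _)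
  obtain ⟨r, η, hr, hη, hmatch⟩ := exists_efEnergy_matchTime hN hpS
  obtain ⟨T₁, δ, hT₁, hδ, hlow⟩ := exists_ef_lower_bound ha hb hp hM hη
  -- The attraction lemma requires a lower bound strictly below `A`.
  set δ' := min δ (A / 2)
  have hδ' : 0 < δ' := by positivity
  have hδA : δ' < A := (min_le_right _ _).trans_lt (by linarith)
  obtain ⟨C₁, c₁, hC₁, hc₁, hattr⟩ := exists_ef_attraction ha hp hA hAb hδ' hδA
    (le_max_right M₀ A)
  obtain ⟨ρ, T₂, C₂, c₂, hρ, hC₂, hc₂, hcontr⟩ := exists_ef_contraction ha hb hp hA hAb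
  have hbounds : ∀ γ u v t, RegularSol N p γ u v → t ≤ 0 →
      0 < efY p u t ∧ efY p u t ≤ M ∧ |efZ p u v t| ≤ M := by
    intro γ u v t h ht
    have hu := h.pos _ (Real.exp_pos t).le
    have := hM₀' u v t ht hu (h.pohozaev_neg _ (Real.exp_pos t))
    exact ⟨mul_pos (Real.exp_pos _) hu, this.1.trans (le_max_left _ _),
      this.2.trans (le_max_left _ _)⟩
  have hge : ∀ γ u v t, 1 ≤ γ → RegularSol N p γ u v → matchTime p r γ ≤ t → t ≤ T₁ →
      δ ≤ efY p u t := fun γ u v t hγ h h1 h2 =>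
    hlow _ _ _ t h1 h2 (fun τ hτ => ⟨h.efAt hp τ, hbounds γ u v τ h (hτ.2.trans (h2.trans hT₁))⟩)
      (hmatch γ u v hγ h)
  have hlarge : ∀ t, ∃ Γ, ∀ γ, Γ ≤ γ → 1 ≤ γ ∧ matchTime p r γ ≤ t := fun t =>
    eventually_atTop.1 ((eventually_ge_atTop 1).and
      ((tendsto_matchTime hp r).eventually_le_atBot t))
  -- the equilibrium is reached within `ρ` on a fixed window
  set Sw := Real.log (2 * C₁ / ρ ^ 2) / c₁
  set T₃ := Real.log (ρ ^ 2 / (2 * C₁)) / 2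
  have hclose : ∀ γ u v t, 1 ≤ γ → RegularSol N p γ u v → matchTime p r γ ≤ t →
      matchTime p r γ + Sw ≤ t → t ≤ T₁ → t ≤ T₃ → |efY p u t - A| ≤ ρ := by
    intro γ u v t hγ h h0 h1 h2 h3
    have hat := hattr (efY p u) (efZ p u v) (matchTime p r γ) t h0 (fun τ hτ =>
      ⟨h.efAt hp τ, (min_le_left _ _).trans (hge γ u v τ hγ h hτ.1 (hτ.2.trans h2)),
        (hbounds γ u v τ h (hτ.2.trans (h2.trans hT₁))).2⟩)
    have e1 : Real.exp (2 * t) ≤ ρ ^ 2 / (2 * C₁) := by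
      rw [← Real.le_log_iff_exp_le (by positivity)]
      simp only [T₃] at h3
      linarith
    have e2 : Real.exp (-(c₁ * (t - matchTime p r γ))) ≤ ρ ^ 2 / (2 * C₁) := by
      rw [← Real.le_log_iff_exp_le (by positivity)]
      have h4 : c₁ * Sw ≤ c₁ * (t - matchTime p r γ) :=
        mul_le_mul_of_nonneg_left (by linarith) hc₁.le
      have h5 : c₁ * Sw = Real.log (2 * C₁ / ρ ^ 2) := mul_div_cancel₀ _ hc₁.ne'
      have h6 : Real.log (ρ ^ 2 / (2 * C₁)) = -Real.log (2 * C₁ / ρ ^ 2) := by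
        rw [← Real.log_inv, inv_div]
      linarith
    have h7 : (efY p u t - A) ^ 2 ≤ ρ ^ 2 := by
      refine hat.trans ?_
      calc C₁ * (Real.exp (-(c₁ * (t - matchTime p r γ))) + Real.exp (2 * t))
          ≤ C₁ * (ρ ^ 2 / (2 * C₁) + ρ ^ 2 / (2 * C₁)) := by gcongr
        _ = ρ ^ 2 := by field_simp; ring
    exact abs_le_of_sq_le_sq h7 hρ.le
  refine ⟨min T₁ (min T₂ T₃), δ, hδ, fun t ht => ?_, fun t ht ε hε => ?_⟩
  · obtain ⟨Γ, hΓ⟩ := hlarge t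
    exact ⟨Γ, fun γ u v hγ h => hge γ u v t (hΓ γ hγ).1 h (hΓ γ hγ).2
      (ht.trans (min_le_left _ _))⟩
  · have ht1 : t ≤ T₁ := ht.trans (min_le_left _ _)
    have ht2 : t ≤ T₂ := ht.trans ((min_le_right _ _).trans (min_le_left _ _))
    have ht3 : t ≤ T₃ := ht.trans ((min_le_right _ _).trans (min_le_right _ _))
    obtain ⟨C₃, hC₃, hgap⟩ := gap_le_of_ef hp t
    -- Length of the contraction window. The initial gap is at most `2 (2M)² = 8M²`, whatever the
    -- two solutions are.
    obtain ⟨k, hk0, hk⟩ : ∃ k : ℝ, 0 ≤ k ∧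
        C₃ * (C₂ * Real.exp (-(c₂ * k)) * (8 * M ^ 2)) ≤ ε := by
      have h1 : Tendsto (fun k : ℝ => C₃ * (C₂ * Real.exp (-(c₂ * k)) * (8 * M ^ 2))) atTop
          (𝓝 (C₃ * (C₂ * 0 * (8 * M ^ 2)))) :=
        (((Real.tendsto_exp_neg_atTop_nhds_zero.comp
          (tendsto_id.const_mul_atTop hc₂)).const_mul C₂).mul_const _).const_mul C₃
      rw [mul_zero, zero_mul, mul_zero] at h1
      exact ((eventually_ge_atTop 0).and (h1.eventually_le_const hε)).exists
    set τ₀ := t - k with hτ₀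
    -- The matching time must precede the window by at least the waiting time `Sw` after which the
    -- solution is within `ρ` of `A`.
    obtain ⟨Γ, hΓ⟩ := hlarge (min τ₀ (τ₀ - Sw))
    refine ⟨Γ, fun γ₁ u₁ v₁ γ₂ u₂ v₂ h₁ h₂ hs₁ hs₂ => ?_⟩
    have hw : ∀ γ u v, Γ ≤ γ → RegularSol N p γ u v → ∀ τ ∈ Icc τ₀ t,
        |efY p u τ - A| ≤ ρ := by
      intro γ u v hγ h τ hτ
      have e1 := (hΓ γ hγ).2.trans (min_le_left _ _)
      have e2 := (hΓ γ hγ).2.trans (min_le_right _ _)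
      exact hclose γ u v τ (hΓ γ hγ).1 h (e1.trans hτ.1) (by linarith [hτ.1])
        (hτ.2.trans ht1) (hτ.2.trans ht3)
    have hmain := hcontr (efY p u₁) (efZ p u₁ v₁) (efY p u₂) (efZ p u₂ v₂) τ₀ t (by linarith) ht2
      (fun τ hτ => ⟨hs₁.efAt hp τ, hs₂.efAt hp τ, hw γ₁ u₁ v₁ h₁ hs₁ τ hτ,
        hw γ₂ u₂ v₂ h₂ hs₂ τ hτ⟩)
    have hτ0 : τ₀ ≤ 0 := by linarith
    have hg0 : gap (efY p u₁) (efZ p u₁ v₁) (efY p u₂) (efZ p u₂ v₂) τ₀ ≤ 8 * M ^ 2 := by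
      obtain ⟨a1, a2, a3⟩ := hbounds γ₁ u₁ v₁ τ₀ hs₁ hτ0
      obtain ⟨b1, b2, b3⟩ := hbounds γ₂ u₂ v₂ τ₀ hs₂ hτ0
      have a4 := abs_le.1 a3
      have b4 := abs_le.1 b3
      have e1 : (efZ p u₁ v₁ τ₀ - efZ p u₂ v₂ τ₀) ^ 2 ≤ (2 * M) ^ 2 :=
        sq_le_sq' (by linarith) (by linarith)
      have e2 : (efY p u₁ τ₀ - efY p u₂ τ₀) ^ 2 ≤ (2 * M) ^ 2 :=
        sq_le_sq' (by linarith) (by linarith)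
      unfold gap
      linarith
    rw [hτ₀, sub_sub_cancel] at hmain
    refine (hgap u₁ v₁ u₂ v₂).trans (le_trans ?_ hk)
    refine mul_le_mul_of_nonneg_left (hmain.trans ?_) hC₃.le
    exact mul_le_mul_of_nonneg_left hg0 (by positivity)

end Convergence

/-! ### Passage to the limit: the singular solution -/

section Limit

variable {N : ℕ} {p : ℝ}

/-- The family of regular solutions is uniformly Cauchy in phase space on compact intervals. -/
theorem regularSol_uniformly_cauchy (hN : 3 ≤ N) (hpS : sobolevExponent N < p)
    {U V : ℝ → ℝ → ℝ} (hUV : ∀ γ, 0 < γ → RegularSol N p γ (U γ) (V γ)) {s₀ s₁ : ℝ}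
    (h₀ : 0 < s₀) :
    UniformCauchySeqOn U atTop (Icc s₀ s₁) ∧ UniformCauchySeqOn V atTop (Icc s₀ s₁) ∧
    UniformCauchySeqOn (fun γ s => -(((N : ℝ) - 1) / s * V γ s) - nonlin p (U γ s)) atTop
      (Icc s₀ s₁) := by
  obtain ⟨hp, -⟩ := supercritical_iff hN hpS
  have hN' : (3 : ℝ) ≤ N := by exact_mod_cast hN
  obtain ⟨T, -, -, -, hcau⟩ := exists_cauchy_near_zero hN hpS
  -- Start at a radius where the Cauchy estimate holds and which does not exceed `s₀`, then apply
  -- Gronwall forward; the uniform bound `B` makes the Lipschitz constant independent of `γ`.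
  set t := min T (Real.log s₀)
  set σ := Real.exp t
  have hσ : 0 < σ := Real.exp_pos t
  have hσ₀ : σ ≤ s₀ := by
    rw [← Real.le_log_iff_exp_le h₀]
    exact min_le_right _ _
  obtain ⟨B, hB, hbd⟩ := exists_uniform_bound (N := N) hp hσ
  obtain ⟨L, hL, hlip⟩ := exists_lipschitz_nonlin hp.le B
  have hmem : ∀ γ, 0 < γ → ∀ s, σ ≤ s → U γ s ∈ Icc (-B) B := by
    intro γ hγ s hs
    have hs0 := hσ.trans_le hs
    have hpos := (hUV γ hγ).pos s hs0.le
    exact ⟨by linarith, hbd (U γ) (V γ) s hs hpos ((hUV γ hγ).pohozaev_neg s hs0)⟩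
  have key : ∀ ε, 0 < ε → ∃ Γ, ∀ γ₁, Γ ≤ γ₁ → ∀ γ₂, Γ ≤ γ₂ → ∀ s ∈ Icc s₀ s₁,
      |V γ₁ s - V γ₂ s| ≤ ε ∧ |U γ₁ s - U γ₂ s| ≤ ε ∧
      |nonlin p (U γ₁ s) - nonlin p (U γ₂ s)| ≤ L * ε := by
    intro ε hε
    set K := Real.exp ((1 + L) * (s₁ - σ))
    have hK : 0 < K := Real.exp_pos _
    obtain ⟨Γ, hΓ⟩ := hcau t (min_le_left _ _) (ε ^ 2 / K) (by positivity)
    refine ⟨max Γ 1, fun γ₁ h₁ γ₂ h₂ s hs => ?_⟩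
    have hγ₁ : 0 < γ₁ := one_pos.trans_le ((le_max_right _ _).trans h₁)
    have hγ₂ : 0 < γ₂ := one_pos.trans_le ((le_max_right _ _).trans h₂)
    have hg := hΓ γ₁ (U γ₁) (V γ₁) γ₂ (U γ₂) (V γ₂) ((le_max_left _ _).trans h₁)
      ((le_max_left _ _).trans h₂) (hUV γ₁ hγ₁) (hUV γ₂ hγ₂)
    have hσs : σ ≤ s := hσ₀.trans hs.1
    have hfw := gap_forward hN hσ hσs hL (fun r hr => (hUV γ₁ hγ₁).sol r (hσ.trans_le hr.1))
      (fun r hr => (hUV γ₂ hγ₂).sol r (hσ.trans_le hr.1))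
      (fun r hr => hlip _ (hmem γ₁ hγ₁ r hr.1) _ (hmem γ₂ hγ₂ r hr.1))
    have hgs : gap (U γ₁) (V γ₁) (U γ₂) (V γ₂) s ≤ ε ^ 2 := by
      refine hfw.trans ?_
      calc _ ≤ K * (ε ^ 2 / K) := by
            refine mul_le_mul (Real.exp_le_exp.2 ?_) hg (gap_nonneg _ _ _ _ _) hK.le
            exact mul_le_mul_of_nonneg_left (by linarith [hs.2]) (by linarith)
        _ = ε ^ 2 := by field_simp
    unfold gap at hgs
    have hu : |U γ₁ s - U γ₂ s| ≤ ε :=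
      abs_le_of_sq_le_sq (by linarith [sq_nonneg (V γ₁ s - V γ₂ s)]) hε.le
    refine ⟨abs_le_of_sq_le_sq (by linarith [sq_nonneg (U γ₁ s - U γ₂ s)]) hε.le, hu, ?_⟩
    exact (hlip _ (hmem γ₁ hγ₁ s hσs) _ (hmem γ₂ hγ₂ s hσs)).trans
      (mul_le_mul_of_nonneg_left hu hL)
  refine ⟨?_, ?_, ?_⟩
  · rw [Metric.uniformCauchySeqOn_iff]
    intro ε hε
    obtain ⟨Γ, hΓ⟩ := key (ε / 2) (by positivity)
    exact ⟨Γ, fun m hm n hn s hs => ((hΓ m hm n hn s hs).2.1).trans_lt (by linarith)⟩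
  · rw [Metric.uniformCauchySeqOn_iff]
    intro ε hε
    obtain ⟨Γ, hΓ⟩ := key (ε / 2) (by positivity)
    exact ⟨Γ, fun m hm n hn s hs => ((hΓ m hm n hn s hs).1).trans_lt (by linarith)⟩
  · rw [Metric.uniformCauchySeqOn_iff]
    intro ε hε
    set k := ((N : ℝ) - 1) / s₀ with hk
    have hk0 : 0 ≤ k := div_nonneg (by linarith) h₀.le
    obtain ⟨Γ, hΓ⟩ := key (ε / (2 * (k + L + 1))) (by positivity)
    refine ⟨Γ, fun m hm n hn s hs => ?_⟩
    obtain ⟨h1, -, h3⟩ := hΓ m hm n hn s hs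
    set ε' := ε / (2 * (k + L + 1)) with hε'
    have hs0 : 0 < s := h₀.trans_le hs.1
    have hks : ((N : ℝ) - 1) / s ≤ k := div_le_div_of_nonneg_left (by linarith) h₀ hs.1
    have hks0 : 0 ≤ ((N : ℝ) - 1) / s := div_nonneg (by linarith) hs0.le
    rw [Real.dist_eq]
    have h4 : |((N : ℝ) - 1) / s * (V m s - V n s)| ≤ k * ε' := by
      rw [abs_mul, abs_of_nonneg hks0]
      exact mul_le_mul hks h1 (abs_nonneg _) hk0
    have h5 : (k + L) * ε' < ε := by
      have : (k + L + 1) * ε' = ε / 2 := by rw [hε']; field_simp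
      have : 0 < ε' := by positivity
      nlinarith
    have h6 := abs_le.1 h4
    have h7 := abs_le.1 h3
    rw [abs_lt]
    constructor <;> linarith [h6.1, h6.2, h7.1, h7.2]

theorem tendstoLocallyUniformlyOn_of_uniformCauchy {F : ℝ → ℝ → ℝ} {f : ℝ → ℝ}
    (hF : ∀ s₀ s₁, 0 < s₀ → UniformCauchySeqOn F atTop (Icc s₀ s₁))
    (hf : ∀ s, 0 < s → Tendsto (fun γ => F γ s) atTop (𝓝 (f s))) :
    TendstoLocallyUniformlyOn F f atTop (Ioi 0) := by
  refine tendstoLocallyUniformlyOn_of_forall_exists_nhds fun s hs => ?_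
  have hs : 0 < s := hs
  refine ⟨Icc (s / 2) (2 * s), mem_nhdsWithin_of_mem_nhds
    (Icc_mem_nhds (by linarith) (by linarith)), ?_⟩
  exact (hF _ _ (half_pos hs)).tendstoUniformlyOn_of_tendsto fun r hr =>
    hf r ((half_pos hs).trans_le hr.1)

/-- The regular solutions converge, as `γ → ∞`, to a positive singular solution with negative
Pohozaev functional. -/
theorem exists_singular_limit (hN : 3 ≤ N) (hpS : sobolevExponent N < p)
    {U V : ℝ → ℝ → ℝ} (hUV : ∀ γ, 0 < γ → RegularSol N p γ (U γ) (V γ)) :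
    ∃ u v : ℝ → ℝ, (∀ s, 0 < s → SolAt N p u v s) ∧ (∀ s, 0 < s → 0 < u s) ∧
      (∀ s, 0 < s → pohozaev N p u v s < 0) ∧ Tendsto u (𝓝[>] 0) atTop ∧
      TendstoLocallyUniformlyOn U u atTop (Ioi 0) := by
  obtain ⟨hp, -⟩ := supercritical_iff hN hpS
  have hlim : ∀ s, 0 < s → (∃ x, Tendsto (fun γ => U γ s) atTop (𝓝 x)) ∧
      ∃ x, Tendsto (fun γ => V γ s) atTop (𝓝 x) := by
    intro s hs
    obtain ⟨h1, h2, -⟩ := regularSol_uniformly_cauchy hN hpS hUV (s₁ := s) hs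
    exact ⟨cauchySeq_tendsto_of_complete (h1.cauchySeq ⟨le_rfl, le_rfl⟩),
      cauchySeq_tendsto_of_complete (h2.cauchySeq ⟨le_rfl, le_rfl⟩)⟩
  choose! u hu using fun s hs => (hlim s hs).1
  choose! v hv using fun s hs => (hlim s hs).2
  have hw : ∀ s, 0 < s → Tendsto (fun γ => -(((N : ℝ) - 1) / s * V γ s) - nonlin p (U γ s)) atTop
      (𝓝 (-(((N : ℝ) - 1) / s * v s) - nonlin p (u s))) := fun s hs =>
    ((hv s hs).const_mul _).neg.sub
      (((contDiff_nonlin hp.le).continuous.tendsto _).comp (hu s hs))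
  have hU := tendstoLocallyUniformlyOn_of_uniformCauchy
    (fun s₀ s₁ h => (regularSol_uniformly_cauchy hN hpS hUV h).1) hu
  have hV := tendstoLocallyUniformlyOn_of_uniformCauchy
    (fun s₀ s₁ h => (regularSol_uniformly_cauchy hN hpS hUV h).2.1) hv
  have hW := tendstoLocallyUniformlyOn_of_uniformCauchy
    (fun s₀ s₁ h => (regularSol_uniformly_cauchy hN hpS hUV h).2.2) hw
  have hsol : ∀ s, 0 < s → SolAt N p u v s := fun s hs =>
    ⟨hasDerivAt_of_tendstoLocallyUniformlyOn isOpen_Ioi hV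
      ((eventually_gt_atTop 0).mono fun γ hγ s hs => ((hUV γ hγ).sol s hs).1) hu hs,
    hasDerivAt_of_tendstoLocallyUniformlyOn isOpen_Ioi hW
      ((eventually_gt_atTop 0).mono fun γ hγ s hs => ((hUV γ hγ).sol s hs).2) hv hs⟩
  obtain ⟨T, δ, hδ, hlow, -⟩ := exists_cauchy_near_zero hN hpS
  have hge : ∀ t, t ≤ T → δ ≤ efY p u t := by
    intro t ht
    obtain ⟨Γ, hΓ⟩ := hlow t ht
    refine ge_of_tendsto ((hu _ (Real.exp_pos t)).const_mul (Real.exp (scaleExp p * t))) ?_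
    filter_upwards [eventually_ge_atTop Γ, eventually_gt_atTop 0] with γ h1 h2
    exact hΓ γ (U γ) (V γ) h1 (hUV γ h2)
  have hnonneg : ∀ s, 0 < s → 0 ≤ u s := fun s hs => ge_of_tendsto (hu s hs)
    ((eventually_gt_atTop 0).mono fun γ hγ => ((hUV γ hγ).pos s hs.le).le)
  have hnear : ∀ s, 0 < s → s ≤ Real.exp T → δ * s ^ (-scaleExp p) ≤ u s := by
    intro s hs hsT
    have h1 := hge (Real.log s) ((Real.log_le_iff_le_exp hs).2 hsT)
    unfold efY at h1
    rw [Real.exp_log hs] at h1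
    have h2 : s ^ (-scaleExp p) * Real.exp (scaleExp p * Real.log s) = 1 := by
      rw [Real.rpow_def_of_pos hs, ← Real.exp_add]
      ring_nf
      exact Real.exp_zero
    have h3 := mul_le_mul_of_nonneg_left h1 (Real.rpow_nonneg hs.le (-scaleExp p))
    rw [← mul_assoc, h2, one_mul] at h3
    linarith
  have hnearpos : ∀ s, 0 < s → s ≤ Real.exp T → 0 < u s := fun s hs hsT =>
    lt_of_lt_of_le (by positivity) (hnear s hs hsT)
  have hPle : ∀ s, 0 < s → pohozaev N p u v s ≤ 0 := by
    intro s hs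
    have h1 : Tendsto (fun γ => pohozaev N p (U γ) (V γ) s) atTop (𝓝 (pohozaev N p u v s)) :=
      ((((((hv s hs).pow 2).div_const 2).add
        (((continuous_nonlinPrim hp).tendsto _).comp (hu s hs))).const_mul s).add
        (((hu s hs).mul (hv s hs)).const_mul _)).const_mul _
    exact le_of_tendsto h1 ((eventually_gt_atTop 0).mono fun γ hγ =>
      ((hUV γ hγ).pohozaev_neg s hs).le)
  -- The limit only gives `≤ 0`. Strictness comes from strict decrease near the origin, where
  -- positivity of `u` is already known.
  have hP : ∀ s, 0 < s → pohozaev N p u v s < 0 := by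
    intro s hs
    set σ := min s (Real.exp T)
    have hσ : 0 < σ := lt_min hs (Real.exp_pos T)
    have h1 : StrictAntiOn (pohozaev N p u v) (Icc (σ / 2) σ) := by
      refine strictAntiOn_of_deriv_neg (convex_Icc _ _) (fun r hr => ?_) ?_
      · have hr0 : 0 < r := (half_pos hσ).trans_le hr.1
        exact (hasDerivAt_pohozaev hN hp hr0 (hsol r hr0)
          (hnonneg r hr0)).continuousAt.continuousWithinAt
      · rw [interior_Icc]
        intro r hr
        have hr0 : 0 < r := (half_pos hσ).trans hr.1
        rw [(hasDerivAt_pohozaev hN hp hr0 (hsol r hr0) (hnonneg r hr0)).deriv]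
        exact pohozaev_deriv_neg hN hpS hr0 (hnearpos r hr0 (hr.2.le.trans (min_le_right _ _)))
    have h2 := h1 (left_mem_Icc.2 (by linarith)) (right_mem_Icc.2 (by linarith)) (half_lt_self hσ)
    have h3 := le_of_hasDerivAt_nonpos (min_le_left s (Real.exp T))
      (fun r hr => hasDerivAt_pohozaev hN hp (hσ.trans_le hr.1) (hsol r (hσ.trans_le hr.1))
        (hnonneg r (hσ.trans_le hr.1)))
      (fun r hr => pohozaev_deriv_nonpos hN hpS (hσ.trans_le hr.1) (hnonneg r (hσ.trans_le hr.1)))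
    linarith [hPle (σ / 2) (half_pos hσ)]
  refine ⟨u, v, hsol, fun s hs => lt_of_le_of_ne (hnonneg s hs) fun h => ?_, hP, ?_, hU⟩
  -- At a zero of `u` the Pohozaev functional would be nonnegative, as for the regular solutions.
  · have h1 := hP s hs
    have hprim : nonlinPrim p 0 = 0 := by
      simp [nonlinPrim, Real.zero_rpow (by linarith : p + 1 ≠ 0)]
    simp only [pohozaev, ← h, hprim, zero_mul, mul_zero, add_zero] at h1
    have : 0 ≤ s ^ (N - 1) * (s * (v s ^ 2 / 2)) := by positivity
    linarith
  · have h1 : Tendsto (fun s : ℝ => δ * s ^ (-scaleExp p)) (𝓝[>] 0) atTop :=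
      (tendsto_rpow_neg_nhdsGT_zero (neg_lt_zero.2 (scaleExp_pos hp))).const_mul_atTop hδ
    refine tendsto_atTop_mono' _ ?_ h1
    filter_upwards [Ioc_mem_nhdsGT (Real.exp_pos T)] with s hs using hnear s hs.1 hs.2

end Limit

/-! ### Oscillation around `1` -/

/-- A damped linear oscillator with restoring coefficient bounded below has no eventually positive
solution. -/
theorem not_eventually_pos_of_oscillator {z w Q : ℝ → ℝ} {k c S : ℝ} (hk : 0 ≤ k) (hc : 0 < c)
    (hS : 0 < S) (hz : ∀ s, S ≤ s → HasDerivAt z (w s) s)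
    (hw : ∀ s, S ≤ s → HasDerivAt w (-(k / s * w s) - Q s) s)
    (hQ : ∀ s, S ≤ s → c * z s ≤ Q s) (hpos : ∀ s, S ≤ s → 0 < z s) : False := by
  set m := min c 1 / 2 with hm
  have hm0 : 0 < m := by positivity
  -- Beyond this point `(k/s)² ≤ c`, so the friction is too weak to stop the rotation.
  set S₁ := max S (k / Real.sqrt c)
  have hS₁ : S ≤ S₁ := le_max_left _ _
  -- Prüfer angle: `r = w/z` satisfies `r' ≤ -c/2 - r²/2`, so `arctan r` falls at rate at least `m`.
  -- Over a length `π/m` it would drop by `π`, more than its range allows.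
  have hanti : ∀ s, S₁ ≤ s → Real.arctan (w s / z s) + m * s ≤
      Real.arctan (w S₁ / z S₁) + m * S₁ := by
    intro s hs
    refine le_of_hasDerivAt_nonpos (f := fun s => Real.arctan (w s / z s) + m * s)
      (f' := fun s => 1 / (1 + (w s / z s) ^ 2) *
        (((-(k / s * w s) - Q s) * z s - w s * w s) / z s ^ 2) + m * 1) hs
      (fun x hx => ((hw x (hS₁.trans hx.1)).div (hz x (hS₁.trans hx.1))
        (hpos x (hS₁.trans hx.1)).ne').arctan.add ((hasDerivAt_id x).const_mul m)) ?_
    intro x hx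
    have hxS : S ≤ x := hS₁.trans hx.1
    have hx0 : 0 < x := hS.trans_le hxS
    have hzx := hpos x hxS
    set r := w x / z x with hr
    have hkx : (k / x) ^ 2 ≤ c := by
      have h1 : k / Real.sqrt c ≤ x := (le_max_right _ _).trans hx.1
      have h2 : k / x ≤ Real.sqrt c := by
        rw [div_le_iff₀ (Real.sqrt_pos.2 hc)] at h1
        rw [div_le_iff₀ hx0]
        linarith
      calc (k / x) ^ 2 ≤ Real.sqrt c ^ 2 := pow_le_pow_left₀ (by positivity) h2 2
        _ = c := Real.sq_sqrt hc.le
    have hd : ((-(k / x * w x) - Q x) * z x - w x * w x) / z x ^ 2 =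
        -(k / x * r) - Q x / z x - r ^ 2 := by
      rw [hr]; field_simp
    have hq : c ≤ Q x / z x := by
      rw [le_div_iff₀ hzx]
      exact hQ x hxS
    have h3 : -(k / x * r) - Q x / z x - r ^ 2 ≤ -(c / 2) - r ^ 2 / 2 := by
      nlinarith [sq_nonneg (k / x + r)]
    have h4 : m * (1 + r ^ 2) ≤ c / 2 + r ^ 2 / 2 := by
      have e1 : min c 1 ≤ c := min_le_left _ _
      have e2 : min c 1 ≤ 1 := min_le_right _ _
      rw [hm]
      nlinarith [sq_nonneg r]
    have h5 : 0 < 1 + r ^ 2 := by positivity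
    have h6 : 1 / (1 + r ^ 2) * (-(k / x * r) - Q x / z x - r ^ 2) ≤ -m := by
      rw [one_div, inv_mul_le_iff₀ h5]
      linarith
    rw [hd]
    linarith
  have h1 := hanti (S₁ + Real.pi / m) (by
    have : 0 < Real.pi / m := div_pos Real.pi_pos hm0
    linarith)
  have h2 := Real.neg_pi_div_two_lt_arctan
    (w (S₁ + Real.pi / m) / z (S₁ + Real.pi / m))
  have h3 := Real.arctan_lt_pi_div_two (w S₁ / z S₁)
  have h4 : m * (S₁ + Real.pi / m) = m * S₁ + Real.pi := by field_simp
  linarith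

theorem nonlin_coercive {p δ : ℝ} (hp : 1 < p) (hδ : 0 < δ) (hδ1 : δ < 1) :
    ∃ m : ℝ, 0 < m ∧ ∀ x, δ ≤ x → m * (x - 1) ^ 2 ≤ (x - 1) * nonlin p x := by
  obtain ⟨m, hm, h⟩ := efForce_coercive (b := 1) (A := 1) hp one_pos (Real.one_rpow _) hδ hδ1
  refine ⟨m, hm, fun x hx => (h x hx).trans_eq ?_⟩
  unfold efForce nonlin
  ring

section Oscillation

variable {N : ℕ} {p : ℝ} {u v : ℝ → ℝ}

theorem hasDerivAt_flux (hN : 3 ≤ N) {s : ℝ} (hs : 0 < s) (h : SolAt N p u v s) :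
    HasDerivAt (fun s => s ^ (N - 1) * v s) (-(s ^ (N - 1) * nonlin p (u s))) s := by
  refine ((hasDerivAt_pow (N - 1) s).mul h.2).congr_deriv ?_
  obtain ⟨n, rfl⟩ : ∃ n, N = n + 3 := ⟨N - 3, by omega⟩
  have e1 : n + 3 - 1 = n + 2 := rfl
  have e2 : n + 2 - 1 = n + 1 := rfl
  have hs' := hs.ne'
  rw [e1, e2]
  push_cast
  field_simp
  ring

/-- In divergence form the derivative of `s^{N-1} v` is `-s^{N-1} f(u)`, and `f < 0` on `(0, 1)`. -/
theorem flux_lt_of_lt_one (hN : 3 ≤ N) (hp : 1 < p) (hsol : ∀ s, 0 < s → SolAt N p u v s)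
    (hpos : ∀ s, 0 < s → 0 < u s) {a b : ℝ} (ha : 0 < a) (hab : a < b)
    (hu : ∀ s ∈ Ioo a b, u s < 1) : a ^ (N - 1) * v a < b ^ (N - 1) * v b := by
  have : StrictMonoOn (fun s => s ^ (N - 1) * v s) (Icc a b) := by
    refine strictMonoOn_of_deriv_pos (convex_Icc a b) (fun s hs => ?_) ?_
    · have hs0 := ha.trans_le hs.1
      exact (hasDerivAt_flux hN hs0 (hsol s hs0)).continuousAt.continuousWithinAt
    · rw [interior_Icc]
      intro s hs
      have hs0 := ha.trans hs.1
      rw [(hasDerivAt_flux hN hs0 (hsol s hs0)).deriv, neg_pos]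
      exact mul_neg_of_pos_of_neg (by positivity) (nonlin_neg hp (hpos s hs0) (hu s hs))
  exact this (left_mem_Icc.2 hab.le) (right_mem_Icc.2 hab.le) hab

theorem flux_lt_of_one_lt (hN : 3 ≤ N) (hp : 1 < p) (hsol : ∀ s, 0 < s → SolAt N p u v s)
    {a b : ℝ} (ha : 0 < a) (hab : a < b)
    (hu : ∀ s ∈ Ioo a b, 1 < u s) : b ^ (N - 1) * v b < a ^ (N - 1) * v a := by
  have : StrictAntiOn (fun s => s ^ (N - 1) * v s) (Icc a b) := by
    refine strictAntiOn_of_deriv_neg (convex_Icc a b) (fun s hs => ?_) ?_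
    · have hs0 := ha.trans_le hs.1
      exact (hasDerivAt_flux hN hs0 (hsol s hs0)).continuousAt.continuousWithinAt
    · rw [interior_Icc]
      intro s hs
      have hs0 := ha.trans hs.1
      rw [(hasDerivAt_flux hN hs0 (hsol s hs0)).deriv, neg_lt_zero]
      have := nonlin_pos hp (hu s hs)
      positivity
  exact this (left_mem_Icc.2 hab.le) (right_mem_Icc.2 hab.le) hab

theorem exists_critical_of_gt {a b c : ℝ} (hd : ∀ s ∈ Icc a b, HasDerivAt u (v s) s)
    (hc : c ∈ Ioo a b) (h1 : u a < u c) (h2 : u b < u c) : ∃ x ∈ Ioo a b, v x = 0 := by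
  obtain ⟨x, hx, hmax⟩ := isCompact_Icc.exists_isMaxOn ⟨c, Ioo_subset_Icc_self hc⟩
    (fun s hs => (hd s hs).continuousAt.continuousWithinAt : ContinuousOn u (Icc a b))
  have hcx : u c ≤ u x := hmax (Ioo_subset_Icc_self hc)
  have hxa : x ≠ a := fun h => by rw [h] at hcx; linarith
  have hxb : x ≠ b := fun h => by rw [h] at hcx; linarith
  have hx' : x ∈ Ioo a b := ⟨lt_of_le_of_ne hx.1 hxa.symm, lt_of_le_of_ne hx.2 hxb⟩
  exact ⟨x, hx', (hmax.isLocalMax (Icc_mem_nhds hx'.1 hx'.2)).hasDerivAt_eq_zero (hd x hx)⟩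

theorem exists_critical_of_lt {a b c : ℝ} (hd : ∀ s ∈ Icc a b, HasDerivAt u (v s) s)
    (hc : c ∈ Ioo a b) (h1 : u c < u a) (h2 : u c < u b) : ∃ x ∈ Ioo a b, v x = 0 := by
  obtain ⟨x, hx, h⟩ := exists_critical_of_gt (u := fun s => -u s) (v := fun s => -v s)
    (fun s hs => (hd s hs).neg) hc (neg_lt_neg h1) (neg_lt_neg h2)
  exact ⟨x, hx, neg_eq_zero.1 h⟩

theorem not_eventually_gt_one (hN : 3 ≤ N) (hp : 1 < p)
    (hsol : ∀ s, 0 < s → SolAt N p u v s) {S : ℝ} (hS : 0 < S) (h : ∀ s, S ≤ s → 1 < u s) :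
    False := by
  have hN' : (3 : ℝ) ≤ N := by exact_mod_cast hN
  obtain ⟨m, hm, hcoer⟩ := nonlin_coercive hp (by norm_num : (0 : ℝ) < 1 / 2) (by norm_num)
  refine not_eventually_pos_of_oscillator (z := fun s => u s - 1) (w := v)
    (Q := fun s => nonlin p (u s)) (k := (N : ℝ) - 1) (by linarith) hm hS
    (fun s hs => (hsol s (hS.trans_le hs)).1.sub_const 1)
    (fun s hs => (hsol s (hS.trans_le hs)).2) (fun s hs => ?_) (fun s hs => sub_pos.2 (h s hs))
  have h1 := hcoer (u s) (by linarith [h s hs])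
  have h2 : 0 < u s - 1 := sub_pos.2 (h s hs)
  refine le_of_mul_le_mul_left ?_ h2
  linarith

/-- The oscillator argument for `1 - u`. The lower bound is needed since `f(u)/(u - 1)` degenerates
as `u → 0`. -/
theorem not_eventually_lt_one_of_lower_bound (hN : 3 ≤ N) (hp : 1 < p)
    (hsol : ∀ s, 0 < s → SolAt N p u v s) {S δ : ℝ} (hS : 0 < S) (hδ : 0 < δ)
    (h : ∀ s, S ≤ s → δ ≤ u s ∧ u s < 1) : False := by
  have hN' : (3 : ℝ) ≤ N := by exact_mod_cast hN
  have hδ1 : δ < 1 := (h S le_rfl).1.trans_lt (h S le_rfl).2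
  obtain ⟨m, hm, hcoer⟩ := nonlin_coercive hp hδ hδ1
  refine not_eventually_pos_of_oscillator (z := fun s => 1 - u s) (w := fun s => -v s)
    (Q := fun s => -nonlin p (u s)) (k := (N : ℝ) - 1) (by linarith) hm hS
    (fun s hs => (hsol s (hS.trans_le hs)).1.const_sub 1)
    (fun s hs => (hsol s (hS.trans_le hs)).2.neg.congr_deriv (by ring)) (fun s hs => ?_)
    (fun s hs => sub_pos.2 (h s hs).2)
  have h1 := hcoer (u s) (h s hs).1
  have h2 : 0 < 1 - u s := sub_pos.2 (h s hs).2
  refine le_of_mul_le_mul_left ?_ h2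
  linarith

/-- A solution with negative Pohozaev functional cannot decrease to `0`. -/
theorem not_decreasing_to_zero (hN : 3 ≤ N) (hpS : sobolevExponent N < p)
    (hsol : ∀ s, 0 < s → SolAt N p u v s) (hpos : ∀ s, 0 < s → 0 < u s)
    (hP : ∀ s, 0 < s → pohozaev N p u v s < 0) {S : ℝ} (hS : 0 < S)
    (hv : ∀ s, S ≤ s → v s < 0) (hsmall : ∀ ε, 0 < ε → ∃ s, S ≤ s ∧ u s < ε) : False := by
  obtain ⟨hp, -⟩ := supercritical_iff hN hpS
  have hN' : (3 : ℝ) ≤ N := by exact_mod_cast hN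
  have hp1 : 0 < p - 1 := by linarith
  have hanti : ∀ s t, S ≤ s → s ≤ t → u t ≤ u s := fun s t hs hst =>
    le_of_hasDerivAt_nonpos hst
      (fun x hx => (hsol x (hS.trans_le (hs.trans hx.1))).1)
      (fun x hx => (hv x (hs.trans hx.1)).le)
  -- Below this level `u^p ≤ 3/4 · u`, hence `-f(u) ≥ u/4`, matching the coefficient `1/4` in `g`.
  obtain ⟨S₀, hSS₀, hS₀⟩ := hsmall ((3 / 4) ^ (1 / (p - 1))) (by positivity)
  set S₁ := max S₀ 1
  have hSS₁ : S ≤ S₁ := hSS₀.trans (le_max_left _ _)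
  have h1S₁ : 1 ≤ S₁ := le_max_right _ _
  have hforce : ∀ s, S₁ ≤ s → u s ^ p ≤ 3 / 4 * u s := by
    intro s hs
    have hs0 : 0 < s := by linarith
    have hus := hpos s hs0
    have h1 : u s ≤ (3 / 4) ^ (1 / (p - 1)) :=
      (hanti S₀ s hSS₀ ((le_max_left _ _).trans hs)).trans hS₀.le
    have h2 : u s ^ (p - 1) ≤ 3 / 4 := by
      calc u s ^ (p - 1) ≤ ((3 / 4) ^ (1 / (p - 1))) ^ (p - 1) :=
            Real.rpow_le_rpow hus.le h1 hp1.le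
        _ = 3 / 4 := by
            rw [← Real.rpow_mul (by norm_num), one_div_mul_cancel hp1.ne', Real.rpow_one]
    have h3 : u s ^ p = u s ^ (p - 1) * u s := by
      rw [Real.rpow_sub_one hus.ne']
      field_simp
    rw [h3]
    exact mul_le_mul_of_nonneg_right h2 hus.le
  let g : ℝ → ℝ := fun s => v s ^ 2 - u s ^ 2 / 4
  have hg : ∀ s t, S₁ ≤ s → s ≤ t → g t ≤ g s := by
    intro s t hs hst
    refine le_of_hasDerivAt_nonpos (f' := fun x => 2 * v x *
      (-(((N : ℝ) - 1) / x * v x) + (3 / 4 * u x - u x ^ p))) hst (fun x hx => ?_) (fun x hx => ?_)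
    · have hx0 : 0 < x := by linarith [hx.1]
      refine (((hsol x hx0).2.pow 2).sub (((hsol x hx0).1.pow 2).div_const 4)).congr_deriv ?_
      unfold nonlin
      push_cast
      ring
    · have hx0 : 0 < x := by linarith [hx.1]
      have hvx := hv x (hSS₁.trans (hs.trans hx.1))
      have h1 := hforce x (hs.trans hx.1)
      have h2 : 0 ≤ -(((N : ℝ) - 1) / x * v x) := by
        rw [neg_nonneg]
        exact mul_nonpos_of_nonneg_of_nonpos (div_nonneg (by linarith) hx0.le) hvx.le
      exact mul_nonpos_of_nonpos_of_nonneg (by linarith) (by linarith)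
  -- A negative value of the nonincreasing `g` would persist, while `g ≥ -u²/4` and `u` becomes
  -- arbitrarily small. With `v < 0` this yields `v ≤ -u/2`, that is, exponential decay.
  have hg0 : ∀ s, S₁ ≤ s → 0 ≤ g s := by
    intro s hs
    by_contra! hneg
    obtain ⟨t, ht, hut⟩ := hsmall (Real.sqrt (-g s)) (Real.sqrt_pos.2 (neg_pos.2 hneg))
    set τ := max s t
    have hsτ : s ≤ τ := le_max_left _ _
    have hτ0 : 0 < τ := by linarith
    have h1 : u τ < Real.sqrt (-g s) := (hanti t τ ht (le_max_right _ _)).trans_lt hut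
    have h2 : u τ ^ 2 < -g s := (Real.lt_sqrt (hpos τ hτ0).le).1 h1
    have h3 := hg s τ hs hsτ
    simp only [g] at h3 h2
    nlinarith [sq_nonneg (v τ), sq_nonneg (u τ)]
  have hdecay : ∀ s, S₁ ≤ s → u s ≤ Real.exp (-(1 / 2) * (s - S₁)) * u S₁ := by
    intro s hs
    refine le_exp_mul_of_hasDerivAt_le hs (fun x hx => (hsol x (by linarith [hx.1])).1) ?_
    intro x hx
    have h1 := hg0 x hx.1
    have h2 := hv x (hSS₁.trans hx.1)
    have h3 := hpos x (by linarith [hx.1])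
    simp only [g] at h1
    by_contra! hcon
    nlinarith
  have hPle : ∀ s, S₁ ≤ s → pohozaev N p u v s ≤ pohozaev N p u v S₁ := fun s hs =>
    le_of_hasDerivAt_nonpos hs
      (fun x hx => hasDerivAt_pohozaev hN hp (by linarith [hx.1]) (hsol x (by linarith [hx.1]))
        (hpos x (by linarith [hx.1])).le)
      (fun x hx => pohozaev_deriv_nonpos hN hpS (by linarith [hx.1])
        (hpos x (by linarith [hx.1])).le)
  -- The functional is at least a negative multiple of `s^N u²`, which tends to `0` by the decay;
  -- being nonincreasing, it would then be nonnegative at `S₁`.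
  have hPge : ∀ s, S₁ ≤ s → -((1 + (N : ℝ) ^ 2) * (s ^ N * u s ^ 2)) ≤ pohozaev N p u v s := by
    intro s hs
    have hs1 : 1 ≤ s := h1S₁.trans hs
    have hs0 : 0 < s := by linarith
    have hus := hpos s hs0
    have h1 := slope_le_of_pohozaev_neg hN hp hs0 hus (hP s hs0)
    have h2 : -(((N : ℝ) - 1) * u s) ≤ v s := by
      have h3 : (s + ((N : ℝ) - 2)) * u s ≤ s * (((N : ℝ) - 1) * u s) := by
        have : s + ((N : ℝ) - 2) ≤ s * ((N : ℝ) - 1) := by nlinarith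
        nlinarith
      have h4 := (abs_le.1 h1).1
      by_contra! hcon
      nlinarith
    have h5 : 0 ≤ u s ^ (p + 1) / (p + 1) := div_nonneg (Real.rpow_nonneg hus.le _) (by linarith)
    have h6 : -((1 + (N : ℝ) ^ 2) * (s * u s ^ 2)) ≤
        s * (v s ^ 2 / 2 + nonlinPrim p (u s)) + ((N : ℝ) - 2) / 2 * (u s * v s) := by
      unfold nonlinPrim
      have e1 : -(((N : ℝ) - 1) * u s ^ 2) ≤ u s * v s := by nlinarith
      have e2 : ((N : ℝ) - 2) / 2 * (-(((N : ℝ) - 1) * u s ^ 2)) ≤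
          ((N : ℝ) - 2) / 2 * (u s * v s) := mul_le_mul_of_nonneg_left e1 (by linarith)
      have e3 : ((N : ℝ) - 2) / 2 * (((N : ℝ) - 1) * u s ^ 2) ≤ (N : ℝ) ^ 2 * u s ^ 2 := by
        have : ((N : ℝ) - 2) / 2 * ((N : ℝ) - 1) ≤ (N : ℝ) ^ 2 := by nlinarith
        have := mul_le_mul_of_nonneg_right this (sq_nonneg (u s))
        linarith
      have e4 : (N : ℝ) ^ 2 * u s ^ 2 ≤ (N : ℝ) ^ 2 * (s * u s ^ 2) :=
        mul_le_mul_of_nonneg_left (le_mul_of_one_le_left (sq_nonneg _) hs1) (sq_nonneg _)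
      have e5 : 0 ≤ s * (v s ^ 2 / 2 + u s ^ (p + 1) / (p + 1)) := by positivity
      have e6 : 0 ≤ s * u s ^ 2 := by positivity
      linarith
    have h7 : s ^ N = s ^ (N - 1) * s := by
      rw [← pow_succ, Nat.sub_add_cancel (by omega)]
    unfold pohozaev
    rw [h7]
    have := mul_le_mul_of_nonneg_left h6 (pow_pos hs0 (N - 1)).le
    linarith
  have hlim : Tendsto (fun s : ℝ => -((1 + (N : ℝ) ^ 2) *
      ((Real.exp S₁ * u S₁ ^ 2) * (s ^ N * Real.exp (-s))))) atTop (𝓝 0) := by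
    have := (((Real.tendsto_pow_mul_exp_neg_atTop_nhds_zero N).const_mul
      (Real.exp S₁ * u S₁ ^ 2)).const_mul (1 + (N : ℝ) ^ 2)).neg
    simpa using this
  have hneg := hP S₁ (by linarith)
  have hcontr : (0 : ℝ) ≤ pohozaev N p u v S₁ := by
    refine le_of_tendsto hlim ?_
    filter_upwards [eventually_ge_atTop S₁] with s hs
    have hs0 : 0 < s := by linarith
    have h1 := hdecay s hs
    have h2 : u s ^ 2 ≤ Real.exp S₁ * u S₁ ^ 2 * Real.exp (-s) := by
      calc u s ^ 2 ≤ (Real.exp (-(1 / 2) * (s - S₁)) * u S₁) ^ 2 :=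
            pow_le_pow_left₀ (hpos s hs0).le h1 2
        _ = Real.exp S₁ * u S₁ ^ 2 * Real.exp (-s) := by
            rw [mul_pow, ← Real.exp_nat_mul]
            have : Real.exp (((2 : ℕ) : ℝ) * (-(1 / 2) * (s - S₁))) =
                Real.exp S₁ * Real.exp (-s) := by
              rw [← Real.exp_add]; congr 1; push_cast; ring
            rw [this]; ring
    have h3 : s ^ N * u s ^ 2 ≤ Real.exp S₁ * u S₁ ^ 2 * (s ^ N * Real.exp (-s)) := by
      have := mul_le_mul_of_nonneg_left h2 (pow_pos hs0 N).le
      linarith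
    have h4 := mul_le_mul_of_nonneg_left h3 (by positivity : 0 ≤ 1 + (N : ℝ) ^ 2)
    linarith [hPle s hs, hPge s hs]
  linarith

/-- Once `v ≥ 0`, increase of the flux keeps `u` nondecreasing, hence bounded below. Otherwise `u`
decreases forever, either to a positive lower bound or to `0`, and each case is excluded separately.
-/
theorem not_eventually_lt_one (hN : 3 ≤ N) (hpS : sobolevExponent N < p)
    (hsol : ∀ s, 0 < s → SolAt N p u v s) (hpos : ∀ s, 0 < s → 0 < u s)
    (hP : ∀ s, 0 < s → pohozaev N p u v s < 0) {S : ℝ} (hS : 0 < S)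
    (h : ∀ s, S ≤ s → u s < 1) : False := by
  obtain ⟨hp, -⟩ := supercritical_iff hN hpS
  by_cases hv : ∃ s₁, S ≤ s₁ ∧ 0 ≤ v s₁
  · obtain ⟨s₁, hs₁, hv₁⟩ := hv
    have hs₁0 := hS.trans_le hs₁
    have hv : ∀ s, s₁ ≤ s → 0 ≤ v s := by
      intro s hs
      rcases eq_or_lt_of_le hs with rfl | hlt
      · exact hv₁
      · have h1 := flux_lt_of_lt_one hN hp hsol hpos hs₁0 hlt
          (fun x hx => h x (hs₁.trans hx.1.le))
        have h2 : 0 ≤ s₁ ^ (N - 1) * v s₁ := by positivity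
        exact (pos_of_mul_pos_right (h2.trans_lt h1)
          (pow_pos (hs₁0.trans hlt) (N - 1)).le).le
    refine not_eventually_lt_one_of_lower_bound hN hp hsol hs₁0 (hpos s₁ hs₁0) fun s hs =>
      ⟨?_, h s (hs₁.trans hs)⟩
    have := le_of_hasDerivAt_nonpos (f := fun s => -u s) (f' := fun s => -v s) hs
      (fun x hx => (hsol x (hs₁0.trans_le hx.1)).1.neg)
      (fun x hx => neg_nonpos.2 (hv x hx.1))
    linarith
  · push Not at hv
    by_cases hδ : ∃ δ, 0 < δ ∧ ∀ s, S ≤ s → δ ≤ u s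
    · obtain ⟨δ, hδ, hδ'⟩ := hδ
      exact not_eventually_lt_one_of_lower_bound hN hp hsol hS hδ fun s hs => ⟨hδ' s hs, h s hs⟩
    · push Not at hδ
      exact not_decreasing_to_zero hN hpS hsol hpos hP hS hv hδ

/-- A nonconstant solution has no critical point at level `1`. -/
theorem ne_one_of_critical (hN : 3 ≤ N) (hp : 1 < p)
    (hsol : ∀ s, 0 < s → SolAt N p u v s) (hinf : Tendsto u (𝓝[>] 0) atTop) {s : ℝ} (hs : 0 < s)
    (hv : v s = 0) : u s ≠ 1 := by
  intro h
  have hone : ∀ r, 0 < r → SolAt N p (fun _ => 1) (fun _ => 0) r := fun r _ =>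
    ⟨hasDerivAt_const r 1, (hasDerivAt_const r (0 : ℝ)).congr_deriv (by simp [nonlin])⟩
  have heq : ∀ r, 0 < r → u r = 1 := fun r hr =>
    solution_unique (u₂ := fun _ => 1) (v₂ := fun _ => 0) hN hp.le hsol hone hs h hv hr
  obtain ⟨r, hr1, hr2⟩ := ((hinf.eventually_gt_atTop 1).and self_mem_nhdsWithin).exists
  linarith [heq r hr2]

/-- If `u ≥ 1` from some point on, touching `1` would give a minimum at level `1`, excluded by
uniqueness; so `u > 1` eventually, which the oscillator argument forbids. -/
theorem exists_gt_lt_one (hN : 3 ≤ N) (hp : 1 < p)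
    (hsol : ∀ s, 0 < s → SolAt N p u v s) (hinf : Tendsto u (𝓝[>] 0) atTop) (S : ℝ) :
    ∃ s, S < s ∧ u s < 1 := by
  by_contra! h
  set S₁ := max S 0 + 1
  have hS₁ : S < S₁ := by linarith [le_max_left S 0]
  have hS₁0 : 0 < S₁ := by linarith [le_max_right S 0]
  refine not_eventually_gt_one hN hp hsol hS₁0 fun s hs => lt_of_le_of_ne (h s (by linarith)) ?_
  intro heq
  have hs0 : 0 < s := hS₁0.trans_le hs
  refine ne_one_of_critical hN hp hsol hinf hs0 ?_ heq.symm
  refine IsLocalMin.hasDerivAt_eq_zero ?_ (hsol s hs0).1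
  filter_upwards [Ioi_mem_nhds (hS₁.trans_le hs)] with r hr
  rw [← heq]
  exact h r hr

theorem exists_gt_one_lt (hN : 3 ≤ N) (hpS : sobolevExponent N < p)
    (hsol : ∀ s, 0 < s → SolAt N p u v s) (hpos : ∀ s, 0 < s → 0 < u s)
    (hP : ∀ s, 0 < s → pohozaev N p u v s < 0) (hinf : Tendsto u (𝓝[>] 0) atTop) (S : ℝ) :
    ∃ s, S < s ∧ 1 < u s := by
  obtain ⟨hp, -⟩ := supercritical_iff hN hpS
  by_contra! h
  set S₁ := max S 0 + 1
  have hS₁ : S < S₁ := by linarith [le_max_left S 0]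
  have hS₁0 : 0 < S₁ := by linarith [le_max_right S 0]
  refine not_eventually_lt_one hN hpS hsol hpos hP hS₁0 fun s hs =>
    lt_of_le_of_ne (h s (by linarith)) ?_
  intro heq
  have hs0 : 0 < s := hS₁0.trans_le hs
  refine ne_one_of_critical hN hp hsol hinf hs0 ?_ heq
  refine IsLocalMax.hasDerivAt_eq_zero ?_ (hsol s hs0).1
  filter_upwards [Ioi_mem_nhds (hS₁.trans_le hs)] with r hr
  rw [heq]
  exact h r hr

end Oscillation

/-! ### Enumeration and alternation of the critical points -/

/-- An unbounded set of reals with finite initial segments is the range of a strictly increasing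
sequence. -/
theorem exists_strictMono_range_eq {C : Set ℝ} (hfin : ∀ M, (C ∩ Iic M).Finite)
    (hunb : ∀ M, ∃ c ∈ C, M < c) :
    ∃ s : ℕ → ℝ, StrictMono s ∧ Tendsto s atTop atTop ∧ range s = C := by
  classical
  -- A locally finite linear order with a least and no greatest element is isomorphic to `ℕ`; the
  -- inverse isomorphism is the sequence.
  let _ : LocallyFiniteOrder C := LocallyFiniteOrder.ofFiniteIcc fun a b => by
    refine Set.Finite.of_finite_image ((hfin b).subset ?_) Subtype.val_injective.injOn
    rintro _ ⟨x, hx, rfl⟩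
    exact ⟨x.2, hx.2⟩
  obtain ⟨c₀, hc₀, -⟩ := hunb 0
  obtain ⟨m, hm, hmin⟩ := (hfin c₀).exists_minimal ⟨c₀, hc₀, self_mem_Iic⟩
  let _ : OrderBot C :=
    { bot := ⟨m, hm.1⟩
      bot_le := fun x => by
        change m ≤ x.1
        rcases le_total x.1 c₀ with h | h
        · rcases le_total m x.1 with h' | h'
          · exact h'
          · exact hmin ⟨x.2, h⟩ h'
        · exact (show m ≤ c₀ from hm.2).trans h }
  have _ : NoMaxOrder C := ⟨fun x => by
    obtain ⟨c, hc, h⟩ := hunb x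
    exact ⟨⟨c, hc⟩, h⟩⟩
  let _ : SuccOrder C := LinearLocallyFiniteOrder.succOrder C
  let _ : PredOrder C := LinearLocallyFiniteOrder.predOrder C
  let e : C ≃o ℕ := orderIsoNatOfLinearSuccPredArch
  have hmono : StrictMono fun n => (e.symm n : ℝ) := fun a b h => e.symm.strictMono h
  refine ⟨fun n => e.symm n, hmono, ?_, ?_⟩
  · refine tendsto_atTop_atTop.2 fun M => ?_
    obtain ⟨c, hc, h⟩ := hunb M
    refine ⟨e ⟨c, hc⟩, fun n hn => h.le.trans ?_⟩
    have : (e.symm (e ⟨c, hc⟩) : ℝ) ≤ e.symm n := hmono.monotone hn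
    simpa using this
  · ext x
    constructor
    · rintro ⟨n, rfl⟩
      exact (e.symm n).2
    · intro hx
      exact ⟨e ⟨x, hx⟩, by simp⟩

section Critical

variable {N : ℕ} {p : ℝ} {u v : ℝ → ℝ}

theorem exists_slope_neg_near_zero (hN : 3 ≤ N) (hp : 1 < p)
    (hpos : ∀ s, 0 < s → 0 < u s) (hP : ∀ s, 0 < s → pohozaev N p u v s < 0)
    (hinf : Tendsto u (𝓝[>] 0) atTop) : ∃ σ, 0 < σ ∧ ∀ s, 0 < s → s < σ → v s < 0 := by
  obtain ⟨m, -, hm⟩ := exists_nonlinPrim_nonneg hp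
  obtain ⟨σ, hσ, h⟩ := mem_nhdsGT_iff_exists_Ioo_subset.1 (hinf.eventually_ge_atTop m)
  exact ⟨σ, hσ, fun s h0 hs =>
    slope_neg_of_pohozaev_neg hN h0 (hpos s h0) (hm _ (h ⟨h0, hs⟩)) (hP s h0)⟩

/-- Critical points stay away from the origin, where `v < 0`. Infinitely many below `M` would
accumulate at a zero of `v`, but there `v' = -f(u) ≠ 0` because `u ≠ 1`. -/
theorem finite_critical (hN : 3 ≤ N) (hp : 1 < p)
    (hsol : ∀ s, 0 < s → SolAt N p u v s) (hpos : ∀ s, 0 < s → 0 < u s)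
    (hP : ∀ s, 0 < s → pohozaev N p u v s < 0) (hinf : Tendsto u (𝓝[>] 0) atTop) (M : ℝ) :
    ({s | 0 < s ∧ v s = 0} ∩ Iic M).Finite := by
  obtain ⟨σ, hσ, hneg⟩ := exists_slope_neg_near_zero hN hp hpos hP hinf
  by_contra hcon
  obtain ⟨x, hx, hacc⟩ := Set.Infinite.exists_accPt_of_subset_isCompact hcon
    (isCompact_Icc (a := σ) (b := M)) (by
      rintro s ⟨⟨h0, hv⟩, hM⟩
      refine ⟨?_, hM⟩
      by_contra! hs
      exact (hneg s h0 hs).ne hv)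
  have hx0 : 0 < x := hσ.trans_le hx.1
  rw [accPt_iff_frequently_nhdsNE] at hacc
  have hzero : ∃ᶠ y in 𝓝[≠] x, v y = 0 := hacc.mono fun y hy => hy.1.2
  have hvx : v x = 0 := by
    by_contra hne
    exact hzero (((hsol x hx0).2.continuousAt.eventually_ne hne).filter_mono nhdsWithin_le_nhds)
  refine hzero ((hsol x hx0).2.eventually_ne ?_)
  have h1 := ne_one_of_critical hN hp hsol hinf hx0 hvx
  rw [hvx, mul_zero, neg_zero, zero_sub, neg_ne_zero]
  rcases lt_or_gt_of_ne h1 with h | h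
  · exact (nonlin_neg hp (hpos x hx0) h).ne
  · exact (nonlin_pos hp h).ne'

theorem exists_gt_critical (hN : 3 ≤ N) (hpS : sobolevExponent N < p)
    (hsol : ∀ s, 0 < s → SolAt N p u v s) (hpos : ∀ s, 0 < s → 0 < u s)
    (hP : ∀ s, 0 < s → pohozaev N p u v s < 0) (hinf : Tendsto u (𝓝[>] 0) atTop) (M : ℝ) :
    ∃ s ∈ {s | 0 < s ∧ v s = 0}, M < s := by
  obtain ⟨hp, -⟩ := supercritical_iff hN hpS
  obtain ⟨a, ha, hua⟩ := exists_gt_lt_one hN hp hsol hinf (max M 0)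
  obtain ⟨c, hc, huc⟩ := exists_gt_one_lt hN hpS hsol hpos hP hinf a
  obtain ⟨b, hb, hub⟩ := exists_gt_lt_one hN hp hsol hinf c
  have ha0 : 0 < a := (le_max_right _ _).trans_lt ha
  obtain ⟨x, hx, hvx⟩ := exists_critical_of_gt (fun s hs => (hsol s (ha0.trans_le hs.1)).1)
    ⟨hc, hb⟩ (hua.trans huc) (hub.trans huc)
  exact ⟨x, ⟨ha0.trans hx.1, hvx⟩, ((le_max_left _ _).trans_lt ha).trans hx.1⟩

/-- After a critical point below `1`, the next one is above `1`. -/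
theorem one_lt_of_next_critical (hN : 3 ≤ N) (hp : 1 < p)
    (hsol : ∀ s, 0 < s → SolAt N p u v s) (hpos : ∀ s, 0 < s → 0 < u s)
    (hinf : Tendsto u (𝓝[>] 0) atTop) {a b : ℝ} (ha0 : 0 < a) (hab : a < b) (ha : v a = 0)
    (hb : v b = 0) (hne : ∀ s ∈ Ioo a b, v s ≠ 0) (hua : u a < 1) : 1 < u b := by
  by_contra! hle
  have hub : u b < 1 :=
    lt_of_le_of_ne hle (ne_one_of_critical hN hp hsol hinf (ha0.trans hab) hb)
  -- If both ends lie below `1`, so does everything between, or an interior maximum would be another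
  -- critical point. The flux would then increase strictly from `0` to `0`.
  have h := flux_lt_of_lt_one hN hp hsol hpos ha0 hab fun s hs => by
    by_contra! hs1
    obtain ⟨x, hx, hvx⟩ := exists_critical_of_gt (fun s hs => (hsol s (ha0.trans_le hs.1)).1)
      hs (hua.trans_le hs1) (hub.trans_le hs1)
    exact hne x hx hvx
  rw [ha, hb, mul_zero, mul_zero] at h
  exact lt_irrefl _ h

/-- A solution above `1` at `a` which is not increasing there has its next critical point
below `1`. -/
theorem lt_one_of_next_critical (hN : 3 ≤ N) (hp : 1 < p)
    (hsol : ∀ s, 0 < s → SolAt N p u v s) (hinf : Tendsto u (𝓝[>] 0) atTop) {a b : ℝ}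
    (ha0 : 0 < a) (hab : a < b) (ha : v a ≤ 0)
    (hb : v b = 0) (hne : ∀ s ∈ Ioo a b, v s ≠ 0) (hua : 1 < u a) : u b < 1 := by
  by_contra! hge
  have hub : 1 < u b :=
    lt_of_le_of_ne hge (ne_one_of_critical hN hp hsol hinf (ha0.trans hab) hb).symm
  have h := flux_lt_of_one_lt hN hp hsol ha0 hab fun s hs => by
    by_contra! hs1
    obtain ⟨x, hx, hvx⟩ := exists_critical_of_lt (fun s hs => (hsol s (ha0.trans_le hs.1)).1)
      hs (hs1.trans_lt hua) (hs1.trans_lt hub)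
    exact hne x hx hvx
  rw [hb, mul_zero] at h
  exact absurd h (not_lt.2 (mul_nonpos_of_nonneg_of_nonpos (pow_pos ha0 _).le ha))

theorem isLocalMin_of_critical (hp : 1 < p) (hrad : IsRadialSolution N p u)
    {s : ℝ} (hs : 0 < s) (hpos : 0 < u s) (hd : deriv u s = 0) (h : u s < 1) :
    IsLocalMin u s := by
  refine isLocalMin_of_deriv_deriv_pos ?_ hd (hrad.solAt hs).1.continuousAt
  have := hrad.2 s hs
  rw [hd, mul_zero, add_zero] at this
  linarith [nonlin_neg hp hpos h]

theorem isLocalMax_of_critical (hp : 1 < p) (hrad : IsRadialSolution N p u)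
    {s : ℝ} (hs : 0 < s) (hd : deriv u s = 0) (h : 1 < u s) :
    IsLocalMax u s := by
  refine isLocalMax_of_deriv_deriv_neg ?_ hd (hrad.solAt hs).1.continuousAt
  have := hrad.2 s hs
  rw [hd, mul_zero, add_zero] at this
  linarith [nonlin_pos hp h]

/-- Indices start at `0`, so even `n` corresponds to the odd-numbered points of the usual
enumeration, the minima. -/
theorem exists_critical_sequence (hN : 3 ≤ N) (hpS : sobolevExponent N < p)
    (hsol : ∀ s, 0 < s → SolAt N p u v s) (hpos : ∀ s, 0 < s → 0 < u s)
    (hP : ∀ s, 0 < s → pohozaev N p u v s < 0) (hinf : Tendsto u (𝓝[>] 0) atTop) :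
    ∃ s : ℕ → ℝ, StrictMono s ∧ Tendsto s atTop atTop ∧ range s = {s | 0 < s ∧ v s = 0} ∧
      ∀ n, (Even n → u (s n) < 1) ∧ (Odd n → 1 < u (s n)) := by
  obtain ⟨hp, -⟩ := supercritical_iff hN hpS
  obtain ⟨s, hmono, htop, hrange⟩ := exists_strictMono_range_eq
    (finite_critical hN hp hsol hpos hP hinf) (exists_gt_critical hN hpS hsol hpos hP hinf)
  have hmem : ∀ n, 0 < s n ∧ v (s n) = 0 := fun n => by
    have : s n ∈ range s := ⟨n, rfl⟩
    rwa [hrange] at this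
  have hidx : ∀ x, 0 < x → v x = 0 → ∃ n, s n = x := fun x h0 hv => by
    have : x ∈ range s := by rw [hrange]; exact ⟨h0, hv⟩
    exact this
  have hnext : ∀ n, ∀ x ∈ Ioo (s n) (s (n + 1)), v x ≠ 0 := by
    rintro n x ⟨h1, h2⟩ hv
    obtain ⟨k, rfl⟩ := hidx x ((hmem n).1.trans h1) hv
    have := hmono.lt_iff_lt.1 h1
    have := hmono.lt_iff_lt.1 h2
    omega
  -- There is no preceding critical point; a point `a` near the origin with `u > 1` and `v < 0`
  -- takes its place, which is why `lt_one_of_next_critical` only asks for `v a ≤ 0`.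
  have hfirst : u (s 0) < 1 := by
    obtain ⟨σ, hσ, hneg⟩ := exists_slope_neg_near_zero hN hp hpos hP hinf
    obtain ⟨a, hua, ha0, haσ⟩ := ((hinf.eventually_gt_atTop 1).and
      (Ioo_mem_nhdsGT (lt_min hσ (hmem 0).1))).exists
    refine lt_one_of_next_critical hN hp hsol hinf ha0 (haσ.trans_le (min_le_right _ _))
      (hneg a ha0 (haσ.trans_le (min_le_left _ _))).le (hmem 0).2 ?_ hua
    rintro x ⟨h1, h2⟩ hv
    obtain ⟨k, rfl⟩ := hidx x (ha0.trans h1) hv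
    exact absurd (hmono.lt_iff_lt.1 h2) (Nat.not_lt_zero _)
  refine ⟨s, hmono, htop, hrange, fun n => ?_⟩
  induction n with
  | zero => exact ⟨fun _ => hfirst, fun h => absurd h (by decide)⟩
  | succ n ih =>
    refine ⟨fun h => ?_, fun h => ?_⟩
    · have hn : Odd n := by
        rw [Nat.even_add_one, Nat.not_even_iff_odd] at h
        exact h
      exact lt_one_of_next_critical hN hp hsol hinf (hmem n).1 (hmono n.lt_succ_self)
        (hmem n).2.le (hmem (n + 1)).2 (hnext n) (ih.2 hn)
    · have hn : Even n := by
        rw [Nat.odd_add_one, Nat.not_odd_iff_even] at h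
        exact h
      exact one_lt_of_next_critical hN hp hsol hpos hinf (hmem n).1 (hmono n.lt_succ_self)
        (hmem n).2 (hmem (n + 1)).2 (hnext n) (ih.1 hn)

end Critical

end

/-! ### The main theorem -/

theorem theorem1p1 (N : ℕ) (hN : 3 ≤ N) (p : ℝ) (hp : sobolevExponent N < p) :
    ∃ (ustar : ℝ → ℝ) (u : ℝ → ℝ → ℝ),
      -- `ustar` is a positive singular solution
      IsPositiveSingularSolution N p ustar ∧
      -- it oscillates around `1`
      OscillatesAround ustar 1 ∧
      -- its critical points form a sequence increasing to infinity,
      -- with values alternately below and above `1`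
      (∃ sstar : ℕ → ℝ, StrictMono sstar ∧ Tendsto sstar atTop atTop ∧
        Set.range sstar = criticalPoints ustar ∧
        ∀ n : ℕ, (Even n → IsLocalMin ustar (sstar n) ∧ ustar (sstar n) < 1) ∧
          (Odd n → IsLocalMax ustar (sstar n) ∧ 1 < ustar (sstar n))) ∧
      -- `u γ` is the solution of the initial value problem with `u(0) = γ`, and it is positive
      (∀ γ : ℝ, 0 < γ → IsRegularSolution N p γ (u γ) ∧ (∀ s : ℝ, 0 ≤ s → 0 < u γ s) ∧
        ∀ v : ℝ → ℝ, IsRegularSolution N p γ v → EqOn v (u γ) (Ici 0)) ∧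
      -- `u γ → ustar` uniformly on compact subsets of `(0,∞)` as `γ → ∞`
      TendstoLocallyUniformlyOn u ustar atTop (Ioi 0) := by
  obtain ⟨hp1, -⟩ := supercritical_iff hN hp
  -- For `γ ≤ 0` the values are arbitrary; the limit `γ → ∞` does not see them.
  choose! U V hUV using fun (γ : ℝ) (hγ : 0 < γ) => exists_regularSol hN hp hγ
  obtain ⟨u, v, hsol, hpos, hP, hinf, hconv⟩ := exists_singular_limit hN hp hUV
  obtain ⟨hrad, hderiv⟩ := SolAt.isRadialSolution hp1.le hsol
  refine ⟨u, U, ⟨hrad, hpos, hinf⟩, ⟨?_, ?_⟩, ?_, fun γ hγ => ⟨?_, (hUV γ hγ).pos, ?_⟩, hconv⟩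
  · exact frequently_atTop'.2 fun S => exists_gt_lt_one hN hp1 hsol hinf S
  · exact frequently_atTop'.2 fun S => exists_gt_one_lt hN hp hsol hpos hP hinf S
  · obtain ⟨s, hmono, htop, hrange, hpar⟩ := exists_critical_sequence hN hp hsol hpos hP hinf
    have hcrit : criticalPoints u = {s | 0 < s ∧ v s = 0} := by
      ext x
      exact and_congr_right fun hx => by rw [hderiv x hx]
    refine ⟨s, hmono, htop, hrange.trans hcrit.symm, fun n => ?_⟩
    obtain ⟨h0, hv⟩ : 0 < s n ∧ v (s n) = 0 := by
      have : s n ∈ range s := ⟨n, rfl⟩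
      rwa [hrange] at this
    have hd : deriv u (s n) = 0 := (hderiv _ h0).trans hv
    exact ⟨fun h => ⟨isLocalMin_of_critical hp1 hrad h0 (hpos _ h0) hd ((hpar n).1 h),
      (hpar n).1 h⟩, fun h => ⟨isLocalMax_of_critical hp1 hrad h0 hd ((hpar n).2 h),
      (hpar n).2 h⟩⟩
  · exact ⟨(SolAt.isRadialSolution hp1.le (hUV γ hγ).sol).1, (hUV γ hγ).value_zero,
      (hUV γ hγ).deriv_zero_eq⟩
  · intro w hw s hs
    rcases eq_or_lt_of_le (show (0 : ℝ) ≤ s from hs) with rfl | h0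
    · rw [hw.2.1, (hUV γ hγ).value_zero]
    · exact regular_unique hN hp1.le (fun r hr => hw.1.solAt hr) (hUV γ hγ).sol
        (hw.2.1.trans (hUV γ hγ).value_zero.symm) hw.2.2 (hUV γ hγ).deriv_zero_eq h0
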